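/- Let $n\ge 0$ be an integer and $t_0>0$. For $t\ge t_0$ let $\phi(t,\cdot,\cdot)\colon\mathbb R^n\times(\mathbb R^n\setminus\{0\})\to\mathbb R$ and $a(t,\cdot,\cdot)\colon\mathbb R^n\times\mathbb R^n\to\mathbb C$ be functions of class $C^{4n+4}$ in $(x,\xi)$ (no regularity in $t$ is required). Assume: 1. $\phi(t,x,r\xi)=r\,\phi(t,x,\xi)$ for all $r>0$, $t\ge t_0$, $x\in\mathbb R^n$, $\xi\neq0$. 2. There is $C_0>0$ such that $$|\det(\mathrm I+t\,\partial_x\partial_\xi\phi(t,x,\xi))|\ge C_0\qquad\text{for all } t\ge t_0,\ x\in\mathbb R^n,\ \xi\ne0 .$$ 3. For all multi-indices $\alpha,\beta$ with $1\le|\alpha|\le 2n+2$ and $1\le|\beta|\le 2n+2$ there is a constant $C_{\alpha,\beta}$ with $$\bigl|t^{|\alpha|}\partial_x^\alpha\partial_\xi^\beta\phi(t,x,\xi)\bigr|\le C_{\alpha,\beta}\qquad\text{for all } t\ge t_0,\ x\in\mathbb R^n,\ |\xi|\ge1 .$$ 4. There is $c>0$ such that, for every $t\ge t_0$, $a(t,x,\xi)$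 is supported in $t|\xi|\ge c$. 5. For all multi-indices $\alpha,\beta$ with $|\alpha|\le 2n+2$ and $|\beta|\le 2n+2$ there is a constant $C'_{\alpha,\beta}$ with $$\bigl|t^{|\alpha|}\partial_x^\alpha\partial_\xi^\beta a(t,x,\xi)\bigr|\le C'_{\alpha,\beta}\qquad\text{for all } t\ge t_0,\ x,\xi\in\mathbb R^n .$$ For $u\in\mathcal S(\mathbb R^n)$ put $\widehat u(\xi)=\int_{\mathbb R^n}\mathrm e^{-\mathrm i x\cdot\xi}u(x)\,\mathrm dx$ and $$T_tu(x)=\int_{\mathbb R^n}\mathrm e^{\mathrm i(x\cdot\xi+t\phi(t,x,\xi))}\,a(t,x,\xi)\,\widehat u(\xi)\,\mathrm d\xi .$$ Then this integral converges absolutely for every $x$, and the family $T_t$, $t\ge t_0$, is uniformly bounded on $L^2$: there is a constant $K$ such that for all $t\ge t_0$ and all $u\in\mathcal S(\mathbb R^n)$ one has $T_tu\in L^2(\mathbb R^n)$ and $$\|T_tu\|_{L^2(\mathbb R^n)}\le K\,\|u\|_{L^2(\mathbb R^n)} .$$ -/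

import Mathlib

open MeasureTheory
open scoped SchwartzMap NNReal

/-- The mixed partial derivative
`∂_{x_{I 0}} ⋯ ∂_{x_{I (p-1)}} ∂_{ξ_{J 0}} ⋯ ∂_{ξ_{J (q-1)}} f` at `(x, ξ)`.
For a multi-index `α` with `|α| = p`, the operator `∂_x^α` is the one given by any tuple `I` in which
each coordinate `i` occurs `α i` times, and every tuple arises so; hence letting `I` and `J`
range over all tuples of lengths `p` and `q` means letting `α` and `β` range over all
multi-indices with `|α| = p` and `|β| = q`. -/
noncomputable def mixedPartial {n : ℕ} {F : Type*} [NormedAddCommGroup F] [NormedSpace ℝ F]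
    {p q : ℕ} (I : Fin p → Fin n) (J : Fin q → Fin n)
    (f : EuclideanSpace ℝ (Fin n) → EuclideanSpace ℝ (Fin n) → F)
    (x ξ : EuclideanSpace ℝ (Fin n)) : F :=
  iteratedFDeriv ℝ p
    (fun y => iteratedFDeriv ℝ q (fun η => f y η) ξ (fun k => EuclideanSpace.single (J k) (1 : ℝ)))
    x (fun k => EuclideanSpace.single (I k) (1 : ℝ))

/-- The matrix `∂_x ∂_ξ f` with entries `∂_{x_i} ∂_{ξ_j} f`. -/
noncomputable def mixedHessian {n : ℕ}
    (f : EuclideanSpace ℝ (Fin n) → EuclideanSpace ℝ (Fin n) → ℝ)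
    (x ξ : EuclideanSpace ℝ (Fin n)) : Matrix (Fin n) (Fin n) ℝ :=
  Matrix.of fun i j => mixedPartial ![i] ![j] f x ξ

/-- The Fourier transform `û(ξ) = ∫ e^{-i x·ξ} u(x) dx`. -/
noncomputable def angularFourier {n : ℕ} (u : EuclideanSpace ℝ (Fin n) → ℂ)
    (ξ : EuclideanSpace ℝ (Fin n)) : ℂ :=
  ∫ x, Complex.exp (-(Complex.I * ((inner ℝ x ξ : ℝ) : ℂ))) * u x

/-- The integrand `e^{i (x·ξ + t φ(t,x,ξ))} a(t,x,ξ) û(ξ)`. -/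
noncomputable def fioIntegrand {n : ℕ}
    (φ : ℝ → EuclideanSpace ℝ (Fin n) → EuclideanSpace ℝ (Fin n) → ℝ)
    (a : ℝ → EuclideanSpace ℝ (Fin n) → EuclideanSpace ℝ (Fin n) → ℂ)
    (t : ℝ) (u : EuclideanSpace ℝ (Fin n) → ℂ) (x ξ : EuclideanSpace ℝ (Fin n)) : ℂ :=
  Complex.exp (Complex.I * ((inner ℝ x ξ + t * φ t x ξ : ℝ) : ℂ)) * a t x ξ * angularFourier u ξ

/-- The operator `T_t u (x) = ∫ e^{i (x·ξ + t φ(t,x,ξ))} a(t,x,ξ) û(ξ) dξ`. -/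
noncomputable def fio {n : ℕ}
    (φ : ℝ → EuclideanSpace ℝ (Fin n) → EuclideanSpace ℝ (Fin n) → ℝ)
    (a : ℝ → EuclideanSpace ℝ (Fin n) → EuclideanSpace ℝ (Fin n) → ℂ)
    (t : ℝ) (u : EuclideanSpace ℝ (Fin n) → ℂ) (x : EuclideanSpace ℝ (Fin n)) : ℂ :=
  ∫ ξ, fioIntegrand φ a t u x ξ

/-! The dilation `x = tμ y`, `ξ = η / (tμ)` and the homogeneity of the phase turn `x·ξ + tφ(t,x,ξ)`
into `Φ = y·η + ψ(y,η)` with `ψ(y,η) = μ⁻¹ φ(t, tμy, η)`. All weights in `t` disappear: mixed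
derivatives of `ψ` are bounded on `|η| ≥ 1` and the amplitude `b` lives in `|η| ≥ 2n + 10`,
uniformly in `t`, which becomes a mere index. By Plancherel it remains to bound `v ↦ ∫ e^{iΦ(y,η)}
b(y,η) v(η) dη` on `L²` (`exists_lintegral_globalPhase_le`). Since `b` vanishes near `η = 0`, the
singularity of `ψ` there is cut off (`globalPhase`).

The operator is decomposed over unit cubes with corners `j` in `y` and `k` in `η`. On such a pair
`Φ(y,η) = Φ(y,k) + Φ(j,η) - Φ(j,k) + r`, where the second difference `r` involves only mixed
derivatives and so is bounded with its derivatives. Hence `e^{ir} b`, cut off, has a Fourier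
transform decaying like `(1+|w|)^{-(2n+1)}`, integrable on `ℝ²ⁿ`. At each frequency `w` the operator
has product form: `v` is tested against `e^{iΦ(j,η)}` on the cube `k`, and the results are
coefficients of `e^{iΦ(y,k)}` on the cube `j`. Both systems are almost orthogonal (`exists_bessel`,
`exists_dual_bessel`): `2n` integrations by parts give Gram matrices decaying like `|k-l|^{-2n}`,
dominated by a product weight to which Schur's test applies.

Integration by parts needs gradients that separate linearly. For fixed `η` the map `y ↦ ∂_η Φ` has a
uniformly invertible Lipschitz derivative on all of `ℝⁿ`, so a quantitative Hadamard theorem applies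
(`mul_norm_sub_le_of_fderiv`). In `η` the mixed Hessian is homogeneous of degree 0 away from the
cutoff, hence almost constant on narrow cones; finitely many cones cover all directions, and their
number only affects the constant. -/

/-! ### Calculus of families with uniformly bounded derivatives. -/

/-- A family `f i` of functions is `N` times continuously differentiable on `U`, and all its iterated
directional derivatives of order at most `N` along the directions `d e` are bounded on `U`,
uniformly in `i`. -/
def BddDeriv {ι κ V F : Type*} [NormedAddCommGroup V] [NormedSpace ℝ V]
    [NormedAddCommGroup F] [NormedSpace ℝ F] (d : κ → V) (U : Set V) : ℕ → (ι → V → F) → Prop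
  | 0, f => (∀ i, ContDiffOn ℝ (0 : ℕ) (f i) U) ∧ ∃ C, ∀ i, ∀ x ∈ U, ‖f i x‖ ≤ C
  | N + 1, f => (∀ i, ContDiffOn ℝ (N + 1 : ℕ) (f i) U) ∧ (∃ C, ∀ i, ∀ x ∈ U, ‖f i x‖ ≤ C) ∧
      ∀ e, BddDeriv d U N (fun i x => fderiv ℝ (f i) x (d e))

namespace BddDeriv

section
variable {ι ι' κ κ' V V' F G H : Type*} [NormedAddCommGroup V] [NormedSpace ℝ V]
  [NormedAddCommGroup V'] [NormedSpace ℝ V'] [NormedAddCommGroup F] [NormedSpace ℝ F]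
  [NormedAddCommGroup G] [NormedSpace ℝ G] [NormedAddCommGroup H] [NormedSpace ℝ H]
  {d : κ → V} {d' : κ' → V'} {U U' : Set V} {N : ℕ} {f g : ι → V → F}

theorem contDiffOn (h : BddDeriv d U N f) (i : ι) : ContDiffOn ℝ N (f i) U := by
  cases N with
  | zero => exact h.1 i
  | succ N => exact h.1 i

theorem bound (h : BddDeriv d U N f) : ∃ C, ∀ i, ∀ x ∈ U, ‖f i x‖ ≤ C := by
  cases N with
  | zero => exact h.2
  | succ N => exact h.2.1

theorem bound_nonneg (h : BddDeriv d U N f) : ∃ C, 0 ≤ C ∧ ∀ i, ∀ x ∈ U, ‖f i x‖ ≤ C := by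
  obtain ⟨C, hC⟩ := h.bound
  exact ⟨max C 0, le_max_right _ _, fun i x hx => (hC i x hx).trans (le_max_left _ _)⟩

theorem deriv (h : BddDeriv d U (N + 1) f) (e : κ) :
    BddDeriv d U N (fun i x => fderiv ℝ (f i) x (d e)) := h.2.2 e

theorem mono_set (hU : U' ⊆ U) (h : BddDeriv d U N f) : BddDeriv d U' N f := by
  induction N generalizing f with
  | zero => exact ⟨fun i => (h.1 i).mono hU, h.2.imp fun C hC i x hx => hC i x (hU hx)⟩
  | succ N ih =>
    exact ⟨fun i => (h.1 i).mono hU, h.2.1.imp fun C hC i x hx => hC i x (hU hx),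
      fun e => ih (h.2.2 e)⟩

theorem of_succ (h : BddDeriv d U (N + 1) f) : BddDeriv d U N f := by
  induction N generalizing f with
  | zero => exact ⟨fun i => (h.1 i).of_le (by norm_num), h.2.1⟩
  | succ N ih =>
    exact ⟨fun i => (h.1 i).of_le (by norm_cast; omega), h.2.1, fun e => ih (h.2.2 e)⟩

theorem mono {M : ℕ} (hM : M ≤ N) (h : BddDeriv d U N f) : BddDeriv d U M f := by
  induction N, hM using Nat.le_induction with
  | base => exact h
  | succ N _ ih => exact ih h.of_succ

theorem congr (hU : IsOpen U) (h : BddDeriv d U N f) (hfg : ∀ i, ∀ x ∈ U, g i x = f i x) :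
    BddDeriv d U N g := by
  induction N generalizing f g with
  | zero =>
    refine ⟨fun i => (h.1 i).congr (hfg i), h.2.imp fun C hC i x hx => ?_⟩
    rw [hfg i x hx]; exact hC i x hx
  | succ N ih =>
    refine ⟨fun i => (h.1 i).congr (hfg i), h.2.1.imp fun C hC i x hx => ?_, fun e => ?_⟩
    · rw [hfg i x hx]; exact hC i x hx
    · refine ih (h.2.2 e) fun i x hx => ?_
      have : g i =ᶠ[nhds x] f i := Filter.eventually_of_mem (hU.mem_nhds hx) (hfg i)
      rw [this.fderiv_eq]

theorem comp_param (h : BddDeriv d U N f) (σ : ι' → ι) : BddDeriv d U N (fun i => f (σ i)) := by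
  induction N generalizing f with
  | zero => exact ⟨fun i => h.1 _, h.2.imp fun C hC i x hx => hC _ x hx⟩
  | succ N ih =>
    exact ⟨fun i => h.1 _, h.2.1.imp fun C hC i x hx => hC _ x hx, fun e => ih (h.2.2 e)⟩

theorem differentiableAt (hU : IsOpen U) (h : BddDeriv d U (N + 1) f) (i : ι) {x : V}
    (hx : x ∈ U) : DifferentiableAt ℝ (f i) x :=
  ((h.1 i).contDiffAt (hU.mem_nhds hx)).differentiableAt (by norm_cast)

theorem const {c : ι → F} {C : ℝ} (hc : ∀ i, ‖c i‖ ≤ C) : BddDeriv d U N (fun i _ => c i) := by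
  induction N generalizing c C with
  | zero => exact ⟨fun i => contDiffOn_const, C, fun i x _ => hc i⟩
  | succ N ih =>
    refine ⟨fun i => contDiffOn_const, ⟨C, fun i x _ => hc i⟩, fun e => ?_⟩
    simpa using ih (c := fun _ : ι => (0 : F)) (C := 0) (by simp)

theorem add (hU : IsOpen U) (hf : BddDeriv d U N f) (hg : BddDeriv d U N g) :
    BddDeriv d U N (fun i x => f i x + g i x) := by
  induction N generalizing f g with
  | zero =>
    obtain ⟨C, hC⟩ := hf.2
    obtain ⟨D, hD⟩ := hg.2
    exact ⟨fun i => (hf.1 i).add (hg.1 i), C + D, fun i x hx =>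
      (norm_add_le _ _).trans (add_le_add (hC i x hx) (hD i x hx))⟩
  | succ N ih =>
    obtain ⟨C, hC⟩ := hf.2.1
    obtain ⟨D, hD⟩ := hg.2.1
    refine ⟨fun i => (hf.1 i).add (hg.1 i), ⟨C + D, fun i x hx =>
      (norm_add_le _ _).trans (add_le_add (hC i x hx) (hD i x hx))⟩, fun e => ?_⟩
    refine (ih (hf.2.2 e) (hg.2.2 e)).congr hU fun i x hx => ?_
    rw [fderiv_fun_add (hf.differentiableAt hU i hx) (hg.differentiableAt hU i hx)]
    rfl

theorem sum (hU : IsOpen U) {α : Type*} (s : Finset α) {f : α → ι → V → F}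
    (hf : ∀ a ∈ s, BddDeriv d U N (f a)) : BddDeriv d U N (fun i x => ∑ a ∈ s, f a i x) := by
  classical
  induction s using Finset.induction_on with
  | empty => simpa using BddDeriv.const (c := fun _ : ι => (0 : F)) (C := 0) (by simp)
  | insert a s ha ih =>
    simp only [Finset.sum_insert ha]
    exact (hf a (by simp)).add hU (ih fun b hb => hf b (by simp [hb]))

theorem clm (hU : IsOpen U) (A : F →L[ℝ] G) (hf : BddDeriv d U N f) :
    BddDeriv d U N (fun i x => A (f i x)) := by
  induction N generalizing f with
  | zero =>
    obtain ⟨C, hC⟩ := hf.2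
    exact ⟨fun i => A.contDiff.comp_contDiffOn (hf.1 i), ‖A‖ * C, fun i x hx =>
      A.le_opNorm_of_le (hC i x hx)⟩
  | succ N ih =>
    obtain ⟨C, hC⟩ := hf.2.1
    refine ⟨fun i => A.contDiff.comp_contDiffOn (hf.1 i), ⟨‖A‖ * C, fun i x hx =>
      A.le_opNorm_of_le (hC i x hx)⟩, fun e => (ih (hf.2.2 e)).congr hU fun i x hx => ?_⟩
    have := (A.hasFDerivAt.comp x (hf.differentiableAt hU i hx).hasFDerivAt).fderiv
    simp only [Function.comp_def] at this
    rw [this]; rfl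

theorem bilin (hU : IsOpen U) (B : F →L[ℝ] G →L[ℝ] H) {g : ι → V → G} (hf : BddDeriv d U N f)
    (hg : BddDeriv d U N g) : BddDeriv d U N (fun i x => B (f i x) (g i x)) := by
  have key : ∀ {M : ℕ} {f : ι → V → F} {g : ι → V → G}, BddDeriv d U M f → BddDeriv d U M g →
      ∃ C, ∀ i, ∀ x ∈ U, ‖B (f i x) (g i x)‖ ≤ C := by
    intro M f g hf hg
    obtain ⟨C, hC0, hC⟩ := hf.bound_nonneg
    obtain ⟨D, hD⟩ := hg.bound
    refine ⟨‖B‖ * C * D, fun i x hx => (B.le_opNorm₂ _ _).trans ?_⟩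
    exact mul_le_mul (mul_le_mul_of_nonneg_left (hC i x hx) (by positivity)) (hD i x hx)
      (norm_nonneg _) (by positivity)
  induction N generalizing f g with
  | zero =>
    exact ⟨fun i => B.isBoundedBilinearMap.contDiff.comp_contDiffOn ((hf.1 i).prodMk (hg.1 i)),
      key hf hg⟩
  | succ N ih =>
    refine ⟨fun i => B.isBoundedBilinearMap.contDiff.comp_contDiffOn ((hf.1 i).prodMk (hg.1 i)),
      key hf hg, fun e => ?_⟩
    refine ((ih (hf.2.2 e) hg.of_succ).add hU (ih hf.of_succ (hg.2.2 e))).congr hU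
      fun i x hx => ?_
    rw [(B.hasFDerivAt_of_bilinear (hf.differentiableAt hU i hx).hasFDerivAt
      (hg.differentiableAt hU i hx).hasFDerivAt).fderiv]
    simp [add_comm]

theorem mul {A : Type*} [NormedRing A] [NormedAlgebra ℝ A] (hU : IsOpen U) {f g : ι → V → A}
    (hf : BddDeriv d U N f) (hg : BddDeriv d U N g) : BddDeriv d U N (fun i x => f i x * g i x) :=
  hf.bilin hU (ContinuousLinearMap.mul ℝ A) hg

theorem neg (hU : IsOpen U) (hf : BddDeriv d U N f) : BddDeriv d U N (fun i x => -f i x) :=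
  hf.clm hU (-ContinuousLinearMap.id ℝ F)

theorem sub (hU : IsOpen U) (hf : BddDeriv d U N f) (hg : BddDeriv d U N g) :
    BddDeriv d U N (fun i x => f i x - g i x) := by
  simpa only [sub_eq_add_neg] using hf.add hU (hg.neg hU)

theorem ofReal (hU : IsOpen U) {f : ι → V → ℝ} (hf : BddDeriv d U N f) :
    BddDeriv d U N (fun i x => (f i x : ℂ)) :=
  hf.clm hU Complex.ofRealCLM

theorem const_mul {A : Type*} [NormedRing A] [NormedAlgebra ℝ A] (hU : IsOpen U) {f : ι → V → A}
    (hf : BddDeriv d U N f) {c : ι → A} {C : ℝ} (hc : ∀ i, ‖c i‖ ≤ C) :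
    BddDeriv d U N (fun i x => c i * f i x) :=
  (BddDeriv.const hc).mul hU hf

/-- The derivative of `e^g` is `e^g ∂g`, so the induction needs bounds on the gradient and an upper
bound on `Re g`, but none on `|g|`. -/
theorem exp (hU : IsOpen U) {g : ι → V → ℂ} (hg : ∀ i, ContDiffOn ℝ N (g i) U)
    (hg' : ∀ e, BddDeriv d U (N - 1) (fun i x => fderiv ℝ (g i) x (d e)))
    {C : ℝ} (hC : ∀ i, ∀ x ∈ U, (g i x).re ≤ C) :
    BddDeriv d U N (fun i x => Complex.exp (g i x)) := by
  have key : ∀ i, ∀ x ∈ U, ‖Complex.exp (g i x)‖ ≤ Real.exp C := fun i x hx => by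
    rw [Complex.norm_exp]; exact Real.exp_le_exp.2 (hC i x hx)
  induction N with
  | zero => exact ⟨fun i => (hg i).cexp, _, key⟩
  | succ N ih =>
    refine ⟨fun i => (hg i).cexp, ⟨_, key⟩, fun e => ?_⟩
    have h1 := ih (fun i => (hg i).of_le (by norm_cast; omega))
      (fun e => (hg' e).mono (by omega))
    refine (h1.mul hU (hg' e)).congr hU fun i x hx => ?_
    have hd : DifferentiableAt ℝ (g i) x :=
      ((hg i).contDiffAt (hU.mem_nhds hx)).differentiableAt (by norm_cast)
    rw [hd.hasFDerivAt.cexp.fderiv]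
    simp

theorem inv (hU : IsOpen U) {q : ι → V → ℝ} (hq : BddDeriv d U N q) {δ : ℝ} (hδ : 0 < δ)
    (hb : ∀ i, ∀ x ∈ U, δ ≤ q i x) : BddDeriv d U N (fun i x => (q i x)⁻¹) := by
  have key : ∀ i, ∀ x ∈ U, ‖(q i x)⁻¹‖ ≤ δ⁻¹ := fun i x hx => by
    rw [Real.norm_of_nonneg (inv_nonneg.2 (hδ.le.trans (hb i x hx)))]
    exact inv_anti₀ hδ (hb i x hx)
  have hne : ∀ i, ∀ x ∈ U, q i x ≠ 0 := fun i x hx => (hδ.trans_le (hb i x hx)).ne'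
  induction N with
  | zero => exact ⟨fun i => (hq.1 i).inv (hne i), _, key⟩
  | succ N ih =>
    refine ⟨fun i => (hq.1 i).inv (hne i), ⟨_, key⟩, fun e => ?_⟩
    have h1 := ih hq.of_succ
    refine (((hq.2.2 e).mul hU (h1.mul hU h1)).neg hU).congr hU fun i x hx => ?_
    have hd := ((hq.differentiableAt hU i hx).hasFDerivAt)
    have := (hasDerivAt_inv (hne i x hx)).comp_hasFDerivAt x hd
    simp only [Function.comp_def] at this
    rw [this.fderiv]
    simp [sq]
    ring

/-- Only derivatives along the chosen directions are controlled, so `A` has to carry chosen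
directions to chosen directions. The translation may depend on the index, which makes later bounds
uniform in base points. -/
theorem comp_affine (hU : IsOpen U) (hf : BddDeriv d U N f) {U' : Set V'} (hU' : IsOpen U')
    (A : V' →L[ℝ] V) (b : ι' → V) (σ : ι' → ι) (τ : κ' → κ) (hA : ∀ e, A (d' e) = d (τ e))
    (hm : ∀ i, ∀ x ∈ U', A x + b i ∈ U) :
    BddDeriv d' U' N (fun i x => f (σ i) (A x + b i)) := by
  induction N generalizing f with
  | zero =>
    exact ⟨fun i => (hf.1 _).comp (A.contDiff.add contDiff_const).contDiffOn (hm i),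
      hf.2.imp fun C hC i x hx => hC _ _ (hm i x hx)⟩
  | succ N ih =>
    refine ⟨fun i => (hf.1 _).comp (A.contDiff.add contDiff_const).contDiffOn (hm i),
      hf.2.1.imp fun C hC i x hx => hC _ _ (hm i x hx), fun e => ?_⟩
    refine (ih (hf.2.2 (τ e))).congr hU' fun i x hx => ?_
    have h1 := (hf.differentiableAt hU (σ i) (hm i x hx)).hasFDerivAt
    have h2 : HasFDerivAt (fun x => A x + b i) A x := A.hasFDerivAt.add_const _
    have := (h1.comp x h2).fderiv
    simp only [Function.comp_def] at this
    rw [this]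
    simp [hA]

/-- Derivatives are local, so functions vanishing on the open set `W` need control on `U` only. This
serves to extend by zero what is estimated on a part of the space. -/
theorem of_eq_zero {W : Set V} (hUo : IsOpen U) (hW : IsOpen W) (h : BddDeriv d U N f)
    (h0 : ∀ i, ∀ x ∈ W, f i x = 0) (hcov : ∀ x, x ∈ U ∨ x ∈ W) :
    BddDeriv d Set.univ N f := by
  have hsm : ∀ {M : ℕ} {f : ι → V → F}, (∀ i, ContDiffOn ℝ M (f i) U) →
      (∀ i, ∀ x ∈ W, f i x = 0) → ∀ i, ContDiffOn ℝ M (f i) Set.univ := by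
    intro M f hf h0 i
    rw [contDiffOn_univ, contDiff_iff_contDiffAt]
    intro x
    rcases hcov x with hx | hx
    · exact (hf i).contDiffAt (hUo.mem_nhds hx)
    · exact (contDiffAt_const (c := (0 : F))).congr_of_eventuallyEq
        (Filter.eventually_of_mem (hW.mem_nhds hx) (h0 i))
  have hbd : ∀ {f : ι → V → F}, (∃ C, ∀ i, ∀ x ∈ U, ‖f i x‖ ≤ C) →
      (∀ i, ∀ x ∈ W, f i x = 0) → ∃ C, ∀ i, ∀ x ∈ Set.univ, ‖f i x‖ ≤ C := by
    rintro f ⟨C, hC⟩ h0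
    refine ⟨max C 0, fun i x _ => ?_⟩
    rcases hcov x with hx | hx
    · exact (hC i x hx).trans (le_max_left _ _)
    · rw [h0 i x hx]; simp
  induction N generalizing f with
  | zero => exact ⟨hsm h.1 h0, hbd h.2 h0⟩
  | succ N ih =>
    refine ⟨hsm h.1 h0, hbd h.2.1 h0, fun e => ih (h.2.2 e) fun i x hx => ?_⟩
    have : f i =ᶠ[nhds x] fun _ => 0 := Filter.eventually_of_mem (hW.mem_nhds hx) (h0 i)
    rw [this.fderiv_eq]; simp

theorem of_hasCompactSupport {f : V → F} (hf : ContDiff ℝ N f) (hs : HasCompactSupport f) :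
    BddDeriv d Set.univ N (fun _ : ι => f) := by
  have hb : ∀ {f : V → F}, Continuous f → HasCompactSupport f →
      ∃ C, ∀ _ : ι, ∀ x ∈ Set.univ, ‖f x‖ ≤ C := fun h1 h2 => by
    obtain ⟨C, hC⟩ := h1.bounded_above_of_compact_support h2
    exact ⟨C, fun _ x _ => hC x⟩
  induction N generalizing f with
  | zero => exact ⟨fun _ => hf.contDiffOn, hb hf.continuous hs⟩
  | succ N ih =>
    refine ⟨fun _ => hf.contDiffOn, hb hf.continuous hs, fun e => ih ?_ (hs.fderiv_apply ℝ _)⟩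
    exact (hf.fderiv_right (m := N) (by norm_cast)).clm_apply contDiff_const

end

end BddDeriv

/-! ### Nonstationary phase. -/

section
variable {ι κ V : Type*} [NormedAddCommGroup V] [NormedSpace ℝ V]

theorem BddDeriv.contDiff {F : Type*} [NormedAddCommGroup F] [NormedSpace ℝ F] {d : κ → V} {N : ℕ}
    {f : ι → V → F} (h : BddDeriv d Set.univ N f) (i : ι) : ContDiff ℝ N (f i) :=
  contDiffOn_univ.1 (h.contDiffOn i)

variable [FiniteDimensional ℝ V] [MeasurableSpace V] [BorelSpace V]

/-- Since `∂_e e^{ilθ} = i l (∂_e θ) e^{ilθ}`, integration by parts in each direction moves the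
derivative onto `B e` and exhibits the factor `l`. -/
theorem integral_mul_cexp_eq {μ : Measure V} [μ.IsAddHaarMeasure] [Fintype κ] (d : κ → V)
    {θ : V → ℝ} {B : κ → V → ℂ} (hθ : ContDiff ℝ 1 θ) (hB : ∀ e, ContDiff ℝ 1 (B e))
    (hs : ∀ e, HasCompactSupport (B e)) (l : ℝ) :
    Complex.I * l * ∫ x, Complex.exp (Complex.I * (l * θ x : ℝ)) *
        ∑ e, (fderiv ℝ θ x (d e) : ℂ) * B e x ∂μ =
      -∫ x, Complex.exp (Complex.I * (l * θ x : ℝ)) * ∑ e, fderiv ℝ (B e) x (d e) ∂μ := by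
  set E : V → ℂ := fun x => Complex.exp (Complex.I * (l * θ x : ℝ)) with hE
  have hEc : ContDiff ℝ 1 E := by
    refine ContDiff.cexp (contDiff_const.mul ?_)
    exact Complex.ofRealCLM.contDiff.comp (contDiff_const.mul hθ)
  have hEd : ∀ e x, fderiv ℝ E x (d e) = Complex.I * l * (E x * fderiv ℝ θ x (d e)) := by
    intro e x
    have h1 : HasFDerivAt θ (fderiv ℝ θ x) x := (hθ.differentiable (by norm_num) x).hasFDerivAt
    have h2 := (((Complex.ofRealCLM.hasFDerivAt.comp x
      (h1.const_mul l)).const_mul Complex.I).cexp).fderiv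
    simp only [Function.comp_def, Complex.ofRealCLM_apply] at h2
    rw [hE, h2]
    simp
    ring
  have hdB : ∀ e, Continuous fun x => fderiv ℝ (B e) x (d e) := fun e =>
    ((hB e).continuous_fderiv (by norm_num)).clm_apply continuous_const
  have hdE : ∀ e, Continuous fun x => fderiv ℝ E x (d e) := fun e =>
    (hEc.continuous_fderiv (by norm_num)).clm_apply continuous_const
  have hdt : ∀ e, Continuous fun x => (fderiv ℝ θ x (d e) : ℂ) := fun e =>
    Complex.continuous_ofReal.comp
      ((hθ.continuous_fderiv (by norm_num)).clm_apply continuous_const)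
  have i1 : ∀ e, Integrable (fun x => fderiv ℝ (B e) x (d e) * E x) μ := fun e =>
    ((hdB e).mul hEc.continuous).integrable_of_hasCompactSupport
      (((hs e).fderiv_apply ℝ (d e)).mul_right)
  have i2 : ∀ e, Integrable (fun x => B e x * fderiv ℝ E x (d e)) μ := fun e =>
    ((hB e).continuous.mul (hdE e)).integrable_of_hasCompactSupport (hs e).mul_right
  have i3 : ∀ e, Integrable (fun x => B e x * E x) μ := fun e =>
    ((hB e).continuous.mul hEc.continuous).integrable_of_hasCompactSupport (hs e).mul_right
  have key : ∀ e, ∫ x, B e x * fderiv ℝ E x (d e) ∂μ = -∫ x, fderiv ℝ (B e) x (d e) * E x ∂μ :=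
    fun e => integral_mul_fderiv_eq_neg_fderiv_mul_of_integrable (i1 e) (i2 e) (i3 e)
      (fun x _ => (hB e).differentiable (by norm_num) x)
      (fun x _ => hEc.differentiable (by norm_num) x)
  rw [← integral_const_mul]
  calc _ = ∫ x, ∑ e, B e x * fderiv ℝ E x (d e) ∂μ := by
        congr 1; ext x
        simp only [hEd, Finset.mul_sum]
        refine Finset.sum_congr rfl fun e _ => by ring
    _ = ∑ e, ∫ x, B e x * fderiv ℝ E x (d e) ∂μ := integral_finsetSum _ fun e _ => i2 e
    _ = -∑ e, ∫ x, fderiv ℝ (B e) x (d e) * E x ∂μ := by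
        simp only [key, Finset.sum_neg_distrib]
    _ = _ := by
        rw [← integral_finsetSum _ fun e _ => i1 e]
        congr 2; ext x
        rw [Finset.mul_sum]
        exact Finset.sum_congr rfl fun e _ => mul_comm _ _

theorem norm_integral_le_of_tsupport_subset {μ : Measure V} [μ.IsAddHaarMeasure] {f : V → ℂ}
    {x₀ : V} {r C : ℝ} (hs : tsupport f ⊆ Metric.closedBall x₀ r) (hC : ∀ x, ‖f x‖ ≤ C) :
    ‖∫ x, f x ∂μ‖ ≤ C * μ.real (Metric.closedBall 0 r) := by
  have h2 : ∫ x, f x ∂μ = ∫ x in Metric.closedBall x₀ r, f x ∂μ :=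
    (setIntegral_eq_integral_of_forall_compl_eq_zero fun x hx =>
      image_eq_zero_of_notMem_tsupport fun h => hx (hs h)).symm
  rw [h2]
  refine (norm_setIntegral_le_of_norm_le_const (C := C) ?_ fun x _ => hC x).trans_eq ?_
  · exact (isCompact_closedBall _ _).measure_lt_top
  · simp [Measure.real, Measure.addHaar_closedBall_center]

/-- Nonstationary phase, uniformly in a family of phases and amplitudes. -/
theorem exists_norm_integral_cexp_le (μ : Measure V) [μ.IsAddHaarMeasure] [Fintype κ]
    {d : κ → V} {N : ℕ} {θ w : ι → V → ℝ} {A : ι → V → ℂ}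
    (hθ : ∀ i, ContDiff ℝ (N + 1 : ℕ) (θ i))
    (hθ' : ∀ e, BddDeriv d Set.univ N (fun i x => fderiv ℝ (θ i) x (d e)))
    (hw : BddDeriv d Set.univ N w) (hA : BddDeriv d Set.univ N A) {x₀ : ι → V} {r : ℝ}
    (hs : ∀ i, tsupport (A i) ⊆ Metric.closedBall (x₀ i) r)
    (h1 : ∀ i, ∀ x ∈ tsupport (A i), w i x * ∑ e, (fderiv ℝ (θ i) x (d e)) ^ 2 = 1) :
    ∃ C, ∀ i, ∀ l : ℝ, 0 < l →
      ‖∫ x, Complex.exp (Complex.I * (l * θ i x : ℝ)) * A i x ∂μ‖ ≤ C * (l ^ N)⁻¹ := by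
  have hns : ∀ (i : ι) (l : ℝ) x, ‖Complex.exp (Complex.I * (l * θ i x : ℝ))‖ = 1 := fun i l x => by
    rw [mul_comm]; exact Complex.norm_exp_ofReal_mul_I _
  induction N generalizing A with
  | zero =>
    obtain ⟨C, hC0, hC⟩ := hA.bound_nonneg
    refine ⟨C * μ.real (Metric.closedBall 0 r), fun i l _ => ?_⟩
    rw [pow_zero, inv_one, mul_one]
    refine norm_integral_le_of_tsupport_subset (tsupport_mul_subset_right.trans (hs i))
      fun x => ?_
    rw [norm_mul, hns, one_mul]
    exact hC i x trivial
  | succ N ih =>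
    have hcs : ∀ i, HasCompactSupport (A i) := fun i =>
      (isCompact_closedBall (x₀ i) r).of_isClosed_subset (isClosed_tsupport _) (hs i)
    -- On the support of `A` the relation `w ∑ (∂_e θ)² = 1` gives `A = ∑ (∂_e θ) B_e`. One
    -- integration by parts replaces `A` by the divergence `A'` of `B`, at the gain of `1/l` and the
    -- cost of one derivative.
    set B : ι → κ → V → ℂ := fun i e x => (w i x * fderiv ℝ (θ i) x (d e) : ℝ) * A i x with hB
    have hBb : ∀ e, BddDeriv d Set.univ (N + 1) (fun i => B i e) := fun e =>
      (((hw.mul isOpen_univ (hθ' e))).ofReal isOpen_univ).mul isOpen_univ hA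
    set A' : ι → V → ℂ := fun i x => ∑ e, fderiv ℝ (B i e) x (d e) with hA'
    have hA'b : BddDeriv d Set.univ N A' :=
      BddDeriv.sum isOpen_univ _ fun e _ => (hBb e).deriv e
    have hts : ∀ i, tsupport (A' i) ⊆ tsupport (A i) := fun i => by
      refine closure_minimal (fun x hx => ?_) (isClosed_tsupport _)
      by_contra hx'
      refine hx (Finset.sum_eq_zero fun e _ => ?_)
      have h0 : B i e =ᶠ[nhds x] fun _ => 0 := by
        filter_upwards [notMem_tsupport_iff_eventuallyEq.1 hx'] with y hy
        simp [hB, hy]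
      rw [h0.fderiv_eq]; simp
    obtain ⟨C, hC⟩ := ih (fun i => (hθ i).of_le (by norm_cast; omega)) (fun e => (hθ' e).of_succ)
      hw.of_succ hA'b (fun i => (hts i).trans (hs i)) (fun i x hx => h1 i x (hts i hx))
    refine ⟨C, fun i l hl => ?_⟩
    have hid := integral_mul_cexp_eq (μ := μ) d (θ := θ i) (B := B i)
      ((hθ i).of_le (by norm_cast; omega))
      (fun e => ((hBb e).contDiff i).of_le (by norm_cast; omega)) (fun e => (hcs i).mul_left) l
    have hAe : ∀ x, ∑ e, (fderiv ℝ (θ i) x (d e) : ℂ) * B i e x = A i x := fun x => by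
      by_cases hx : x ∈ tsupport (A i)
      · have := congrArg (fun s : ℝ => (s : ℂ) * A i x) (h1 i x hx)
        simp only [Complex.ofReal_one, one_mul] at this
        rw [← this]
        push_cast
        rw [Finset.mul_sum, Finset.sum_mul]
        refine Finset.sum_congr rfl fun e _ => ?_
        simp only [hB]; push_cast; ring
      · simp [hB, image_eq_zero_of_notMem_tsupport hx]
    simp only [hAe] at hid
    have hn := congrArg norm hid
    rw [norm_neg, norm_mul, norm_mul, Complex.norm_I, one_mul, Complex.norm_real,
      Real.norm_of_nonneg hl.le] at hn
    have := hC i l hl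
    rw [← hn] at this
    rw [pow_succ, mul_inv, ← mul_assoc, ← div_eq_mul_inv, le_div_iff₀ hl, mul_comm]
    exact this

end

/-! ### Coordinate directions and differences in one variable. -/

/-- The coordinate directions of `ℝⁿ`. -/
noncomputable def coordDir {κ : Type*} [DecidableEq κ] (e : κ) : EuclideanSpace ℝ κ :=
  EuclideanSpace.single e 1

/-- The coordinate directions of `ℝⁿ × ℝⁿ`. -/
noncomputable def pairDir {n : ℕ} :
    Fin n ⊕ Fin n → EuclideanSpace ℝ (Fin n) × EuclideanSpace ℝ (Fin n) :=
  Sum.elim (fun i => (coordDir i, 0)) (fun i => (0, coordDir i))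

/-- Directional derivatives of a `C²` function commute. -/
theorem fderiv_fderiv_apply_comm {V F : Type*} [NormedAddCommGroup V] [NormedSpace ℝ V]
    [NormedAddCommGroup F] [NormedSpace ℝ F] {f : V → F} {x : V} (hf : ContDiffAt ℝ 2 f x)
    (u v : V) :
    fderiv ℝ (fun z => fderiv ℝ f z u) x v = fderiv ℝ (fun z => fderiv ℝ f z v) x u := by
  have hs : IsSymmSndFDerivAt ℝ f x := hf.isSymmSndFDerivAt (by simp)
  have hd : DifferentiableAt ℝ (fderiv ℝ f) x :=
    (hf.fderiv_right (m := 1) (by norm_num)).differentiableAt (by norm_num)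
  have h : ∀ w w', fderiv ℝ (fun z => fderiv ℝ f z w) x w' = fderiv ℝ (fderiv ℝ f) x w' w := by
    intro w w'
    have := (hd.hasFDerivAt.clm_apply (hasFDerivAt_const w x)).fderiv
    rw [this]; simp
  rw [h, h, hs.eq]

section
variable {n : ℕ}

theorem norm_clm_apply_le_of_coordDir {F : Type*} [NormedAddCommGroup F] [NormedSpace ℝ F]
    (L : EuclideanSpace ℝ (Fin n) →L[ℝ] F) {C : ℝ}
    (hL : ∀ l, ‖L (coordDir l)‖ ≤ C) (v : EuclideanSpace ℝ (Fin n)) : ‖L v‖ ≤ n * C * ‖v‖ := by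
  have hv : v = ∑ l, v l • coordDir l := by
    have := (EuclideanSpace.basisFun (Fin n) ℝ).sum_repr v
    simpa [coordDir] using this.symm
  have : L v = ∑ l, v l • L (coordDir l) := by
    conv_lhs => rw [hv]
    simp
  rw [this]
  refine (norm_sum_le _ _).trans ?_
  calc _ ≤ ∑ _l : Fin n, ‖v‖ * C := Finset.sum_le_sum fun l _ => by
        rw [norm_smul]
        exact mul_le_mul (PiLp.norm_apply_le v l) (hL l) (norm_nonneg _) (norm_nonneg _)
    _ = _ := by simp; ring

theorem norm_sub_le_of_fderiv_snd_le {F : Type*} [NormedAddCommGroup F] [NormedSpace ℝ F]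
    {S : EuclideanSpace ℝ (Fin n) × EuclideanSpace ℝ (Fin n) → F}
    {s : Set (EuclideanSpace ℝ (Fin n))} (hs : Convex ℝ s) {y : EuclideanSpace ℝ (Fin n)}
    (hS : ∀ η ∈ s, DifferentiableAt ℝ S (y, η)) {C : ℝ} (hC0 : 0 ≤ C)
    (hC : ∀ l, ∀ η ∈ s, ‖fderiv ℝ S (y, η) (pairDir (Sum.inr l))‖ ≤ C)
    {k l : EuclideanSpace ℝ (Fin n)} (hk : k ∈ s) (hl : l ∈ s) :
    ‖S (y, k) - S (y, l)‖ ≤ n * C * ‖k - l‖ := by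
  have hd : ∀ η ∈ s, HasFDerivAt (fun η => S (y, η))
      ((fderiv ℝ S (y, η)).comp (ContinuousLinearMap.inr ℝ _ _)) η := fun η hη =>
    (hS η hη).hasFDerivAt.comp η (hasFDerivAt_prodMk_right y η)
  refine hs.norm_image_sub_le_of_norm_hasFDerivWithin_le
    (fun η hη => (hd η hη).hasFDerivWithinAt) (fun η hη => ?_) hl hk
  refine ContinuousLinearMap.opNorm_le_bound _ (by positivity) fun v => ?_
  exact norm_clm_apply_le_of_coordDir _ (fun l => hC l η hη) v

end

namespace BddDeriv
variable {ι : Type*} {n N : ℕ}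

section
variable {S : ι → EuclideanSpace ℝ (Fin n) × EuclideanSpace ℝ (Fin n) → ℝ}

/-- Symmetry of second derivatives transfers the control of `∂_η S` to `∂_η` of any first derivative
of `S`. Inductions on the order can thus replace `S` by its derivatives. -/
theorem fderiv_snd_fderiv_fst (hS : ∀ i, ContDiff ℝ (N + 2 : ℕ) (S i))
    (h : ∀ l, BddDeriv pairDir Set.univ (N + 1) (fun i z => fderiv ℝ (S i) z (pairDir (.inr l))))
    (u : Fin n ⊕ Fin n) (l : Fin n) :
    BddDeriv pairDir Set.univ N (fun i z =>
      fderiv ℝ (fun z => fderiv ℝ (S i) z (pairDir u)) z (pairDir (.inr l))) :=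
  ((h l).deriv u).congr isOpen_univ fun i z _ =>
    fderiv_fderiv_apply_comm ((hS i).contDiffAt.of_le (by norm_cast; omega)) _ _

theorem contDiff_fderiv_apply (hS : ∀ i, ContDiff ℝ (N + 1 : ℕ) (S i))
    (u : EuclideanSpace ℝ (Fin n) × EuclideanSpace ℝ (Fin n)) (i : ι) :
    ContDiff ℝ (N : ℕ) (fun z => fderiv ℝ (S i) z u) :=
  ((hS i).fderiv_right (m := N) (by norm_cast)).clm_apply contDiff_const

theorem norm_sub_le (hS : ∀ i, ContDiff ℝ (N + 1 : ℕ) (S i))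
    (h : ∀ l, BddDeriv pairDir Set.univ N (fun i z => fderiv ℝ (S i) z (pairDir (.inr l)))) :
    ∃ C, 0 ≤ C ∧ ∀ i y k l, ‖S i (y, k) - S i (y, l)‖ ≤ C * ‖k - l‖ := by
  choose C hC using fun l => (h l).bound
  refine ⟨n * ∑ l, |C l|, by positivity, fun i y k l => ?_⟩
  exact norm_sub_le_of_fderiv_snd_le (S := S i) convex_univ (y := y)
    (fun η _ => (hS i).differentiable (by norm_cast) _) (C := ∑ l, |C l|) (by positivity)
    (fun l η _ => ((hC l _ _ trivial).trans (le_abs_self _)).trans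
      (Finset.single_le_sum (f := fun l => |C l|) (fun _ _ => abs_nonneg _)
        (Finset.mem_univ l))) (Set.mem_univ k) (Set.mem_univ l)

/-- Difference quotients in the second variable. -/
theorem diffQuotient (hS : ∀ i, ContDiff ℝ (N + 1 : ℕ) (S i))
    (h : ∀ l, BddDeriv pairDir Set.univ N (fun i z => fderiv ℝ (S i) z (pairDir (.inr l)))) :
    BddDeriv coordDir Set.univ N
      (fun (p : ι × EuclideanSpace ℝ (Fin n) × EuclideanSpace ℝ (Fin n)) y =>
        ‖p.2.1 - p.2.2‖⁻¹ * (S p.1 (y, p.2.1) - S p.1 (y, p.2.2))) := by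
  have hb : ∃ C, ∀ (p : ι × EuclideanSpace ℝ (Fin n) × EuclideanSpace ℝ (Fin n)),
      ∀ y ∈ Set.univ, ‖‖p.2.1 - p.2.2‖⁻¹ * (S p.1 (y, p.2.1) - S p.1 (y, p.2.2))‖ ≤ C := by
    obtain ⟨C, hC0, hC⟩ := norm_sub_le hS h
    refine ⟨C, fun p y _ => ?_⟩
    rw [norm_mul, norm_inv, norm_norm]
    refine (mul_le_mul_of_nonneg_left (hC p.1 y p.2.1 p.2.2) (by positivity)).trans ?_
    -- For coinciding points the convention `0⁻¹ = 0` makes the quotient vanish.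
    by_cases h0 : ‖p.2.1 - p.2.2‖ = 0
    · rw [h0]; simpa using hC0
    · rw [mul_comm, mul_assoc, mul_inv_cancel₀ h0, mul_one]
  have hcd : ∀ (p : ι × EuclideanSpace ℝ (Fin n) × EuclideanSpace ℝ (Fin n)),
      ContDiff ℝ (N + 1 : ℕ) fun y =>
        ‖p.2.1 - p.2.2‖⁻¹ * (S p.1 (y, p.2.1) - S p.1 (y, p.2.2)) := fun p =>
    contDiff_const.mul (((hS p.1).comp (contDiff_prodMk_left _)).sub
      ((hS p.1).comp (contDiff_prodMk_left _)))
  induction N generalizing S with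
  | zero => exact ⟨fun p => ((hcd p).of_le (by norm_cast)).contDiffOn, hb⟩
  | succ N ih =>
    refine ⟨fun p => ((hcd p).of_le (by norm_cast; omega)).contDiffOn, hb, fun e => ?_⟩
    have hd : ∀ (p : ι × EuclideanSpace ℝ (Fin n) × EuclideanSpace ℝ (Fin n)) y,
        fderiv ℝ (fun y => ‖p.2.1 - p.2.2‖⁻¹ * (S p.1 (y, p.2.1) - S p.1 (y, p.2.2))) y
          (coordDir e) = ‖p.2.1 - p.2.2‖⁻¹ * (fderiv ℝ (S p.1) (y, p.2.1) (pairDir (.inl e)) -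
            fderiv ℝ (S p.1) (y, p.2.2) (pairDir (.inl e))) := fun p y => by
      have hk : ∀ k, HasFDerivAt (fun y => S p.1 (y, k))
          ((fderiv ℝ (S p.1) (y, k)).comp (ContinuousLinearMap.inl ℝ _ _)) y := fun k =>
        ((hS p.1).differentiable (by norm_cast) _).hasFDerivAt.comp y
          (hasFDerivAt_prodMk_left y k)
      have h3 : HasFDerivAt (fun y => ‖p.2.1 - p.2.2‖⁻¹ * (S p.1 (y, p.2.1) - S p.1 (y, p.2.2)))
        _ y := ((hk p.2.1).fun_sub (hk p.2.2)).const_mul _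
      rw [h3.fderiv]
      simp [pairDir]
    have hS' := contDiff_fderiv_apply hS (pairDir (.inl e))
    have h' := fderiv_snd_fderiv_fst hS h (.inl e)
    -- A `y`-derivative of the quotient is the same quotient for `∂_y S`.
    refine (ih hS' h' ?_ ?_).congr isOpen_univ fun p y _ => hd p y
    · obtain ⟨C, hC0, hC⟩ := norm_sub_le hS' h'
      refine ⟨C, fun p y _ => ?_⟩
      rw [norm_mul, norm_inv, norm_norm]
      refine (mul_le_mul_of_nonneg_left (hC p.1 y p.2.1 p.2.2) (by positivity)).trans ?_
      by_cases h0 : ‖p.2.1 - p.2.2‖ = 0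
      · rw [h0]; simpa using hC0
      · rw [mul_comm, mul_assoc, mul_inv_cancel₀ h0, mul_one]
    · exact fun p => contDiff_const.mul (((hS' p.1).comp (contDiff_prodMk_left _)).sub
        ((hS' p.1).comp (contDiff_prodMk_left _)))

/-- Differences in the second variable, along an affine map. -/
theorem diffAffine {V : Type*} [NormedAddCommGroup V] [NormedSpace ℝ V]
    {d : Fin n ⊕ Fin n → V}
    (Q : V →L[ℝ] EuclideanSpace ℝ (Fin n) × EuclideanSpace ℝ (Fin n))
    (τ : Fin n ⊕ Fin n → Fin n ⊕ Fin n) (hQ : ∀ e, Q (d e) = pairDir (τ e)) {U : Set V}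
    (hU : IsOpen U) {r : ℝ} (hr : ∀ x ∈ U, ‖(Q x).2‖ ≤ r)
    (hS : ∀ i, ContDiff ℝ (N + 1 : ℕ) (S i))
    (h : ∀ l, BddDeriv pairDir Set.univ N (fun i z => fderiv ℝ (S i) z (pairDir (.inr l)))) :
    BddDeriv d U N
      (fun (p : ι × EuclideanSpace ℝ (Fin n) × EuclideanSpace ℝ (Fin n)) x =>
        S p.1 (Q x + p.2) - S p.1 ((Q x).1 + p.2.1, p.2.2)) := by
  set Q₁ : V →L[ℝ] EuclideanSpace ℝ (Fin n) × EuclideanSpace ℝ (Fin n) :=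
    (ContinuousLinearMap.inl ℝ _ _).comp ((ContinuousLinearMap.fst ℝ _ _).comp Q) with hQ₁
  have hQ₁a : ∀ x (b : EuclideanSpace ℝ (Fin n) × EuclideanSpace ℝ (Fin n)),
      ((Q x).1 + b.1, b.2) = Q₁ x + b := fun x b => by
    ext <;> simp [Q₁]
  have hb : ∀ {N : ℕ} {S : ι → EuclideanSpace ℝ (Fin n) × EuclideanSpace ℝ (Fin n) → ℝ},
      (∀ i, ContDiff ℝ (N + 1 : ℕ) (S i)) →
      (∀ l, BddDeriv pairDir Set.univ N (fun i z => fderiv ℝ (S i) z (pairDir (.inr l)))) →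
      ∃ C, ∀ (p : ι × EuclideanSpace ℝ (Fin n) × EuclideanSpace ℝ (Fin n)), ∀ x ∈ U,
        ‖S p.1 (Q x + p.2) - S p.1 ((Q x).1 + p.2.1, p.2.2)‖ ≤ C := by
    intro N S hS h
    obtain ⟨C, hC0, hC⟩ := norm_sub_le hS h
    refine ⟨C * r, fun p x hx => ?_⟩
    refine (hC p.1 ((Q x).1 + p.2.1) ((Q x).2 + p.2.2) p.2.2).trans ?_
    rw [add_sub_cancel_right]
    exact mul_le_mul_of_nonneg_left (hr x hx) hC0
  simp only [hQ₁a] at hb ⊢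
  have hcd : ∀ {N : ℕ} {S : ι → EuclideanSpace ℝ (Fin n) × EuclideanSpace ℝ (Fin n) → ℝ},
      (∀ i, ContDiff ℝ (N + 1 : ℕ) (S i)) →
      ∀ (p : ι × EuclideanSpace ℝ (Fin n) × EuclideanSpace ℝ (Fin n)),
      ContDiff ℝ N fun x => S p.1 (Q x + p.2) - S p.1 (Q₁ x + p.2) := fun hS p =>
    (((hS p.1).comp (Q.contDiff.add contDiff_const)).sub
      ((hS p.1).comp (Q₁.contDiff.add contDiff_const))).of_le (by norm_cast; omega)
  induction N generalizing S with
  | zero => exact ⟨fun p => (hcd hS p).contDiffOn, hb hS h⟩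
  | succ N ih =>
    refine ⟨fun p => (hcd hS p).contDiffOn, hb hS h, fun e => ?_⟩
    have hd : ∀ (p : ι × EuclideanSpace ℝ (Fin n) × EuclideanSpace ℝ (Fin n)) x,
        fderiv ℝ (fun x => S p.1 (Q x + p.2) - S p.1 (Q₁ x + p.2)) x (d e) =
          fderiv ℝ (S p.1) (Q x + p.2) (Q (d e)) - fderiv ℝ (S p.1) (Q₁ x + p.2) (Q₁ (d e)) :=
        fun p x => by
      have hk : ∀ T : V →L[ℝ] EuclideanSpace ℝ (Fin n) × EuclideanSpace ℝ (Fin n),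
          HasFDerivAt (fun x => S p.1 (T x + p.2)) ((fderiv ℝ (S p.1) (T x + p.2)).comp T) x :=
        fun T => ((hS p.1).differentiable (by norm_cast) _).hasFDerivAt.comp x
          (T.hasFDerivAt.add_const _)
      rw [((hk Q).fun_sub (hk Q₁)).fderiv]
      simp
    cases hτ : τ e with
    | inl m =>
      refine (ih (contDiff_fderiv_apply hS (pairDir (.inl m)))
        (fderiv_snd_fderiv_fst hS h (.inl m))).congr hU fun p x _ => ?_
      rw [hd, hQ, hτ]
      have : Q₁ (d e) = pairDir (.inl m) := by simp [Q₁, hQ, hτ, pairDir]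
      rw [this]
    | inr m =>
      -- In an `η`-direction the subtracted term is constant; what remains is `∂_η S` itself,
      -- bounded by hypothesis.
      refine ((h m).of_succ.comp_affine isOpen_univ hU Q (fun p => p.2) Prod.fst τ hQ
        (fun _ _ _ => trivial)).congr hU fun p x _ => ?_
      rw [hd, hQ, hτ]
      have : Q₁ (d e) = 0 := by simp [Q₁, hQ, hτ, pairDir]
      rw [this]; simp

end
end BddDeriv

/-! ### Quantitative global inverse function theorem. -/

section Hadamard

variable {X Y : Type*} [NormedAddCommGroup X] [NormedAddCommGroup Y] {G : X → Y} {ρ m : ℝ}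

/-- Preimages near `y s` exist by `h2` and are unique there by `h1`. The bound `m * ρ / 2` keeps
them within `ρ / 2` of `y s`, so that preimages at neighbouring parameters lie in a common ball of
radius `ρ`, where `h1` gives continuity. -/
theorem exists_continuous_lift {T : Type*} [TopologicalSpace T] (hm : 0 < m) (hρ : 0 < ρ)
    (h1 : ∀ y, ∀ p ∈ Metric.closedBall y ρ, ∀ q ∈ Metric.closedBall y ρ,
      m * ‖p - q‖ ≤ ‖G p - G q‖)
    (h2 : ∀ y, ∀ z ∈ Metric.closedBall (G y) (m * ρ), ∃ p ∈ Metric.closedBall y ρ, G p = z)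
    {y : T → X} {z : T → Y} (hy : Continuous y) (hz : Continuous z)
    (hyz : ∀ s, ‖z s - G (y s)‖ ≤ m * ρ / 2) :
    ∃ p : T → X, Continuous p ∧ (∀ s, G (p s) = z s) ∧
      ∀ s, m * ‖p s - y s‖ ≤ ‖z s - G (y s)‖ := by
  have hz' : ∀ s, z s ∈ Metric.closedBall (G (y s)) (m * ρ) := fun s => by
    rw [mem_closedBall_iff_norm]
    exact (hyz s).trans (by have := mul_pos hm hρ; linarith)
  choose p hp hpz using fun s => h2 (y s) (z s) (hz' s)
  have hpy : ∀ s, m * ‖p s - y s‖ ≤ ‖z s - G (y s)‖ := fun s => by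
    have := h1 (y s) (p s) (hp s) (y s) (Metric.mem_closedBall_self hρ.le)
    rwa [hpz] at this
  have hpy' : ∀ s, dist (p s) (y s) ≤ ρ / 2 := fun s => by
    rw [dist_eq_norm]
    have := (hpy s).trans (hyz s)
    rw [mul_div_assoc] at this
    exact le_of_mul_le_mul_left this hm
  refine ⟨p, continuous_iff_continuousAt.2 fun s₀ => ?_, hpz, hpy⟩
  have hnear : ∀ᶠ s in nhds s₀, dist (y s) (y s₀) < ρ / 2 :=
    (hy.continuousAt (x := s₀)).eventually (Metric.ball_mem_nhds _ (by linarith))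
  have hlim : Filter.Tendsto (fun s => m⁻¹ * ‖z s - z s₀‖) (nhds s₀) (nhds 0) := by
    have : Continuous fun s => m⁻¹ * ‖z s - z s₀‖ := by fun_prop
    simpa using this.tendsto s₀
  rw [ContinuousAt, tendsto_iff_norm_sub_tendsto_zero]
  refine squeeze_zero' (Filter.Eventually.of_forall fun s => norm_nonneg _) ?_ hlim
  filter_upwards [hnear] with s hs
  have h3 : p s ∈ Metric.closedBall (y s₀) ρ := by
    rw [Metric.mem_closedBall]
    linarith [dist_triangle (p s) (y s) (y s₀), hpy' s]
  have := h1 (y s₀) (p s) h3 (p s₀) (hp s₀)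
  rw [hpz, hpz] at this
  rwa [← div_eq_inv_mul, le_div_iff₀' hm]

variable [NormedSpace ℝ X] [NormedSpace ℝ Y]

/-- A continuous map with uniform local inverses is globally injective. -/
theorem injective_of_uniform_local_inverse (hG : Continuous G) (hm : 0 < m) (hρ : 0 < ρ)
    (h1 : ∀ y, ∀ p ∈ Metric.closedBall y ρ, ∀ q ∈ Metric.closedBall y ρ,
      m * ‖p - q‖ ≤ ‖G p - G q‖)
    (h2 : ∀ y, ∀ z ∈ Metric.closedBall (G y) (m * ρ), ∃ p ∈ Metric.closedBall y ρ, G p = z) :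
    Function.Injective G := by
  intro a b hab
  set γ : unitInterval → X := fun s => a + (s : ℝ) • (b - a) with hγ
  have hγc : Continuous γ := by fun_prop
  have hγ0 : γ 0 = a := by simp [γ]
  have hγ1 : γ 1 = b := by simp [γ]
  obtain ⟨D, hD⟩ := (isCompact_univ (X := unitInterval)).exists_bound_of_continuousOn
    (f := fun s => G a - G (γ s)) (by fun_prop)
  obtain ⟨M, hM⟩ := exists_nat_gt (D / (m * ρ / 2))
  have hD0 : 0 ≤ D := (norm_nonneg _).trans (hD 0 trivial)
  have hMpos : (0 : ℝ) < M := lt_of_le_of_lt (by positivity) hM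
  have hDM : D / M ≤ m * ρ / 2 := by
    rw [div_le_iff₀ hMpos]
    rw [div_lt_iff₀ (by positivity)] at hM
    linarith
  -- The path `G ∘ γ`, closed because `G a = G b`, is contracted linearly to the point `G a` in `M`
  -- steps of size at most `m * ρ / 2`. Each step is lifted with both end points fixed.
  have key : ∀ k : ℕ, ∃ y : unitInterval → X, Continuous y ∧
      (∀ s, G (y s) = G (γ s) + ((k : ℝ) / M) • (G a - G (γ s))) ∧ y 0 = a ∧ y 1 = b := by
    intro k
    induction k with
    | zero => exact ⟨γ, hγc, fun s => by simp, hγ0, hγ1⟩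
    | succ k ih =>
      obtain ⟨y, hyc, hy, hy0, hy1⟩ := ih
      have hdiff : ∀ s, (G (γ s) + (((k + 1 : ℕ) : ℝ) / M) • (G a - G (γ s))) - G (y s) =
          (1 / M : ℝ) • (G a - G (γ s)) := fun s => by
        rw [hy, add_sub_add_left_eq_sub, ← sub_smul]
        congr 1; push_cast; ring
      obtain ⟨p, hpc, hp, hpy⟩ := exists_continuous_lift hm hρ h1 h2 hyc
        (z := fun s => G (γ s) + (((k + 1 : ℕ) : ℝ) / M) • (G a - G (γ s))) (by fun_prop)
        (fun s => by
          rw [hdiff, norm_smul, Real.norm_of_nonneg (by positivity)]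
          refine le_trans ?_ hDM
          rw [one_div, ← div_eq_inv_mul]
          exact div_le_div_of_nonneg_right (hD s trivial) hMpos.le)
      refine ⟨p, hpc, hp, ?_, ?_⟩
      · have := hpy 0
        rw [hdiff, hγ0, sub_self, smul_zero, norm_zero, hy0] at this
        exact sub_eq_zero.1 (norm_le_zero_iff.1 (nonpos_of_mul_nonpos_right this hm))
      · have := hpy 1
        rw [hdiff, hγ1, hab, sub_self, smul_zero, norm_zero, hy1] at this
        exact sub_eq_zero.1 (norm_le_zero_iff.1 (nonpos_of_mul_nonpos_right this hm))
  obtain ⟨y, hyc, hy, hy0, hy1⟩ := key M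
  have hconst : ∀ s, G (y s) = G a := fun s => by
    rw [hy, div_self hMpos.ne', one_smul]; abel
  -- The last lift stays in the fibre over `G a`, which is discrete by `h1`; being continuous, it is
  -- constant, and its ends `a` and `b` coincide.
  have hloc : IsLocallyConstant y := by
    rw [IsLocallyConstant.iff_eventually_eq]
    intro s₀
    have hnear : ∀ᶠ s in nhds s₀, y s ∈ Metric.closedBall (y s₀) ρ :=
      (hyc.continuousAt (x := s₀)).eventually (Metric.closedBall_mem_nhds _ hρ)
    filter_upwards [hnear] with s hs
    have := h1 (y s₀) (y s) hs (y s₀) (Metric.mem_closedBall_self hρ.le)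
    rw [hconst, hconst, sub_self, norm_zero] at this
    exact sub_eq_zero.1 (norm_le_zero_iff.1 (nonpos_of_mul_nonpos_right this hm))
  rw [← hy0, ← hy1]
  exact hloc.apply_eq_of_preconnectedSpace 0 1

/-- The segment from `G a` to `G b` is lifted from `a` in `M` short steps, each moving by at most
`m⁻¹` times its length. Global injectivity identifies the end of the lift with `b`. -/
theorem mul_norm_sub_le_of_uniform_local_inverse (hG : Continuous G) (hm : 0 < m) (hρ : 0 < ρ)
    (h1 : ∀ y, ∀ p ∈ Metric.closedBall y ρ, ∀ q ∈ Metric.closedBall y ρ,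
      m * ‖p - q‖ ≤ ‖G p - G q‖)
    (h2 : ∀ y, ∀ z ∈ Metric.closedBall (G y) (m * ρ), ∃ p ∈ Metric.closedBall y ρ, G p = z)
    (a b : X) : m * ‖b - a‖ ≤ ‖G b - G a‖ := by
  obtain ⟨M, hM⟩ := exists_nat_gt (‖G b - G a‖ / (m * ρ))
  have hMpos : (0 : ℝ) < M := lt_of_le_of_lt (by positivity) hM
  have hDM : ‖G b - G a‖ / M ≤ m * ρ := by
    rw [div_le_iff₀ hMpos]
    rw [div_lt_iff₀ (by positivity)] at hM
    linarith
  have key : ∀ k : ℕ, ∃ y : X, G y = G a + ((k : ℝ) / M) • (G b - G a) ∧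
      m * ‖y - a‖ ≤ (k : ℝ) / M * ‖G b - G a‖ := by
    intro k
    induction k with
    | zero => exact ⟨a, by simp, by simp⟩
    | succ k ih =>
      obtain ⟨y, hy, hya⟩ := ih
      have hdiff : G a + (((k + 1 : ℕ) : ℝ) / M) • (G b - G a) - G y =
          (1 / M : ℝ) • (G b - G a) := by
        rw [hy, add_sub_add_left_eq_sub, ← sub_smul]
        congr 1; push_cast; ring
      have hn : ‖(1 / M : ℝ) • (G b - G a)‖ = ‖G b - G a‖ / M := by
        rw [norm_smul, Real.norm_of_nonneg (by positivity)]; ring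
      obtain ⟨p, hp, hpz⟩ := h2 y (G a + (((k + 1 : ℕ) : ℝ) / M) • (G b - G a)) (by
        rw [mem_closedBall_iff_norm, hdiff, hn]; exact hDM)
      refine ⟨p, hpz, ?_⟩
      have h3 := h1 y p hp y (Metric.mem_closedBall_self hρ.le)
      rw [hpz, hdiff, hn] at h3
      have h4 : ‖p - a‖ ≤ ‖p - y‖ + ‖y - a‖ := norm_sub_le_norm_sub_add_norm_sub _ _ _
      have h5 := mul_le_mul_of_nonneg_left h4 hm.le
      have h6 : ((k + 1 : ℕ) : ℝ) / M * ‖G b - G a‖ =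
        ‖G b - G a‖ / M + (k : ℝ) / M * ‖G b - G a‖ := by push_cast; ring
      rw [h6]
      linarith [mul_add m ‖p - y‖ ‖y - a‖]
  obtain ⟨y, hy, hya⟩ := key M
  rw [div_self hMpos.ne', one_smul, add_sub_cancel] at hy
  rw [div_self hMpos.ne', one_mul, injective_of_uniform_local_inverse hG hm hρ h1 h2 hy] at hya
  exact hya

/-- **Hadamard's global inverse function theorem**, quantitative form. -/
theorem mul_norm_sub_le_of_fderiv [FiniteDimensional ℝ X] {G : X → X} {G' : X → X →L[ℝ] X}
    {c Λ : ℝ} (hc : 0 < c) (hΛ : 0 ≤ Λ) (hG : ∀ y, HasFDerivAt G (G' y) y)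
    (hlow : ∀ y w, c * ‖w‖ ≤ ‖G' y w‖) (hlip : ∀ y y', ‖G' y - G' y'‖ ≤ Λ * ‖y - y'‖) (a b : X) :
    c / 2 * ‖b - a‖ ≤ ‖G b - G a‖ := by
  have : CompleteSpace X := FiniteDimensional.complete ℝ X
  -- On balls of this radius the derivative varies by at most `c / 2`, so `G` is a small
  -- perturbation of a linear isomorphism with lower bound `c`, and the uniform local inverse exists
  -- with `m = c / 2`.
  set ρ := c / (2 * (Λ + 1)) with hρ
  have hρ0 : 0 < ρ := by positivity
  have hΛρ : Λ * ρ ≤ c / 2 := by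
    rw [hρ, mul_div_assoc', div_le_div_iff₀ (by positivity) (by norm_num)]
    nlinarith
  have happ : ∀ y, ∀ p ∈ Metric.closedBall y ρ, ∀ q ∈ Metric.closedBall y ρ,
      ‖G p - G q - G' y (p - q)‖ ≤ c / 2 * ‖p - q‖ := by
    intro y p hp q hq
    refine (convex_closedBall y ρ).norm_image_sub_le_of_norm_hasFDerivWithin_le' (f' := G')
      (fun x _ => (hG x).hasFDerivWithinAt) (fun x hx => ?_) hq hp
    refine (hlip x y).trans (le_trans ?_ hΛρ)
    exact mul_le_mul_of_nonneg_left (mem_closedBall_iff_norm.1 hx) hΛ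
  refine mul_norm_sub_le_of_uniform_local_inverse (ρ := ρ)
    (continuous_iff_continuousAt.2 fun y => (hG y).continuousAt) (by positivity) hρ0 ?_ ?_ a b
  · intro y p hp q hq
    have h3 := happ y p hp q hq
    have h4 := hlow y (p - q)
    have h5 : ‖G' y (p - q)‖ ≤ ‖G p - G q‖ + ‖G p - G q - G' y (p - q)‖ := by
      have := norm_sub_le (G p - G q) (G p - G q - G' y (p - q))
      simpa using this
    linarith
  · intro y z hz
    have hinj : Function.Injective (G' y) := by
      intro u v huv
      have := hlow y (u - v)
      rw [map_sub, huv, sub_self, norm_zero] at this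
      exact sub_eq_zero.1 (norm_le_zero_iff.1 (nonpos_of_mul_nonpos_right this hc))
    have hsurj : Function.Surjective (G' y) :=
      (LinearMap.injective_iff_surjective (f := (G' y : X →ₗ[ℝ] X))).1 hinj
    have happ' : ApproximatesLinearOn G (G' y) (Metric.closedBall y ρ) ⟨c / 2, by positivity⟩ :=
      happ y
    let R : (G' y).NonlinearRightInverse :=
      { toFun := Function.surjInv hsurj
        nnnorm := ⟨c⁻¹, by positivity⟩
        bound' := fun v => by
          have := hlow y (Function.surjInv hsurj v)
          rw [Function.surjInv_eq hsurj] at this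
          show _ ≤ c⁻¹ * ‖v‖
          rwa [← div_eq_inv_mul, le_div_iff₀' hc]
        right_inv' := Function.surjInv_eq hsurj }
    refine happ'.surjOn_closedBall_of_nonlinearRightInverse R hρ0.le subset_rfl
      (Metric.closedBall_subset_closedBall ?_ hz)
    show c / 2 * ρ ≤ ((c⁻¹)⁻¹ - c / 2) * ρ
    rw [inv_inv]
    exact le_of_eq (by ring)

end Hadamard

/-- Cramer's rule: `det M • w = adj M (M w)`, and bounded entries of `M` bound those of the
adjugate. The hypothesis on the determinant thus becomes a lower bound uniform over the family. -/
theorem exists_mul_norm_le_norm_mulVec (n : ℕ) (B : ℝ) {C₀ : ℝ} (hC₀ : 0 < C₀) :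
    ∃ c, 0 < c ∧ ∀ M : Matrix (Fin n) (Fin n) ℝ, (∀ i j, |M i j| ≤ B) → C₀ ≤ |M.det| →
      ∀ w : EuclideanSpace ℝ (Fin n), c * ‖w‖ ≤ ‖WithLp.toLp 2 (M.mulVec w.ofLp)‖ := by
  -- Entries of the adjugate are determinants in which one row is a unit vector, hence `max B 1`.
  -- The `+ 1` below keeps the denominator positive for `n = 0`.
  set A : ℝ := (n.factorial : ℝ) * (max B 1) ^ n with hA
  have hA0 : 0 ≤ A := by positivity
  refine ⟨C₀ / (n * (n * A) + 1), by positivity, fun M hM hdet w => ?_⟩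
  set v := WithLp.toLp 2 (M.mulVec w.ofLp) with hv
  have hadj : ∀ i j, |M.adjugate i j| ≤ A := fun i j => by
    rw [Matrix.adjugate_apply]
    have := Matrix.det_le (A := M.updateRow j (Pi.single i 1)) (abv := AbsoluteValue.abs)
      (x := max B 1) (fun k l => ?_)
    · simpa [hA] using this
    · rw [AbsoluteValue.abs_apply, Matrix.updateRow_apply]
      split_ifs
      · rcases eq_or_ne l i with rfl | h
        · simp
        · simp [h]
      · exact (hM k l).trans (le_max_left _ _)
  have hwi : ∀ i, C₀ * ‖w i‖ ≤ n * A * ‖v‖ := fun i => by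
    have h1 : M.det • w.ofLp = M.adjugate.mulVec (M.mulVec w.ofLp) := by
      rw [Matrix.mulVec_mulVec, Matrix.adjugate_mul, Matrix.smul_mulVec, Matrix.one_mulVec]
    have h2 := congrFun h1 i
    calc C₀ * ‖w i‖ ≤ |M.det| * ‖w i‖ := mul_le_mul_of_nonneg_right hdet (norm_nonneg _)
      _ = ‖∑ j, M.adjugate i j * v j‖ := by
        rw [← Real.norm_eq_abs, ← norm_mul]; exact congrArg norm h2
      _ ≤ ∑ _j : Fin n, A * ‖v‖ := (norm_sum_le _ _).trans (Finset.sum_le_sum fun j _ => by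
        rw [norm_mul]
        exact mul_le_mul (hadj i j) (PiLp.norm_apply_le v j) (norm_nonneg _) hA0)
      _ = n * A * ‖v‖ := by simp; ring
  have hw : ‖w‖ ≤ ∑ i, ‖w i‖ := by
    have := norm_sum_le Finset.univ fun i => w i • coordDir (κ := Fin n) i
    have h3 : ∑ i, w i • coordDir (κ := Fin n) i = w := by
      simpa [coordDir] using (EuclideanSpace.basisFun (Fin n) ℝ).sum_repr w
    rw [h3] at this
    simpa [norm_smul, coordDir] using this
  rw [div_mul_eq_mul_div, div_le_iff₀ (by positivity)]
  calc C₀ * ‖w‖ ≤ ∑ i, C₀ * ‖w i‖ := by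
        rw [← Finset.mul_sum]; exact mul_le_mul_of_nonneg_left hw hC₀.le
    _ ≤ ∑ _i : Fin n, n * A * ‖v‖ := Finset.sum_le_sum fun i _ => hwi i
    _ = n * (n * A) * ‖v‖ := by simp; ring
    _ ≤ ‖v‖ * (n * (n * A) + 1) := by nlinarith [norm_nonneg v]

/-! ### Unit cubes, the lattice weight and Schur's test. -/

section Lattice
variable {n : ℕ}

/-- The point of `ℝⁿ` with integer coordinates `k`. -/
noncomputable def latticePt (k : Fin n → ℤ) : EuclideanSpace ℝ (Fin n) :=
  WithLp.toLp 2 fun i => (k i : ℝ)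

/-- The half-open unit cube with lowest corner `k`. -/
def unitBox (k : Fin n → ℤ) : Set (EuclideanSpace ℝ (Fin n)) := {y | ∀ i, ⌊y i⌋ = k i}

theorem measurableSet_unitBox (k : Fin n → ℤ) : MeasurableSet (unitBox k) := by
  rw [unitBox, Set.ofPred_forall]
  refine MeasurableSet.iInter fun i => ?_
  have h : Measurable fun y : EuclideanSpace ℝ (Fin n) => ⌊y i⌋ := by fun_prop
  exact h (measurableSet_singleton (k i))

theorem iUnion_unitBox : ⋃ k, unitBox (n := n) k = Set.univ :=
  Set.eq_univ_of_forall fun y => Set.mem_iUnion.2 ⟨fun i => ⌊y i⌋, fun _ => rfl⟩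

theorem pairwise_disjoint_unitBox : Pairwise (Function.onFun Disjoint (unitBox (n := n))) := by
  intro k l hkl
  refine Set.disjoint_left.2 fun y hk hl => hkl (funext fun i => ?_)
  rw [← hk i, hl i]

theorem euclidean_norm_le_sum (w : EuclideanSpace ℝ (Fin n)) : ‖w‖ ≤ ∑ i, |w i| := by
  have := norm_sum_le Finset.univ fun i => w i • coordDir (κ := Fin n) i
  have h3 : ∑ i, w i • coordDir (κ := Fin n) i = w := by
    simpa [coordDir] using (EuclideanSpace.basisFun (Fin n) ℝ).sum_repr w
  rw [h3] at this
  simpa [norm_smul, coordDir] using this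

/-- The `ℓ¹` norm gives the crude bound `n` in place of `√n`; the radii of all later cutoffs are
built on it. -/
theorem norm_sub_latticePt_le {k : Fin n → ℤ} {y : EuclideanSpace ℝ (Fin n)} (hy : y ∈ unitBox k) :
    ‖y - latticePt k‖ ≤ n := by
  refine (euclidean_norm_le_sum _).trans ?_
  have : ∀ i ∈ Finset.univ, |(y - latticePt k) i| ≤ 1 := fun i _ => by
    have h1 := hy i
    have h2 := Int.floor_le (y i)
    have h3 := Int.lt_floor_add_one (y i)
    rw [h1] at h2 h3
    simp only [PiLp.sub_apply, latticePt, abs_le]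
    constructor <;> linarith
  simpa using Finset.sum_le_sum this

theorem one_le_norm_latticePt_sub {k l : Fin n → ℤ} (h : k ≠ l) :
    1 ≤ ‖latticePt k - latticePt l‖ := by
  obtain ⟨i, hi⟩ := Function.ne_iff.1 h
  refine le_trans ?_ (PiLp.norm_apply_le (latticePt k - latticePt l) i)
  simp only [PiLp.sub_apply, latticePt, Real.norm_eq_abs]
  have : 1 ≤ |k i - l i| := Int.one_le_abs (sub_ne_zero.2 hi)
  exact_mod_cast this

/-- A summable weight on the lattice. -/
noncomputable def latticeWeight (m : Fin n → ℤ) : ℝ := ∏ i, ((1 + |(m i : ℝ)|) ^ 2)⁻¹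

theorem latticeWeight_nonneg (m : Fin n → ℤ) : 0 ≤ latticeWeight m :=
  Finset.prod_nonneg fun i _ => by positivity

theorem latticeWeight_sub_comm (k l : Fin n → ℤ) :
    latticeWeight (k - l) = latticeWeight (l - k) := by
  refine Finset.prod_congr rfl fun i _ => ?_
  rw [Pi.sub_apply, Pi.sub_apply, Int.cast_sub, Int.cast_sub, abs_sub_comm]

/-- Each coordinate difference is at most the Euclidean distance, so `2n` powers of the latter pay
for two powers per coordinate. This is why `2n` integrations by parts suffice. -/
theorem inv_pow_le_latticeWeight (k l : Fin n → ℤ) :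
    ((1 + ‖latticePt k - latticePt l‖) ^ (2 * n))⁻¹ ≤ latticeWeight (k - l) := by
  rw [latticeWeight, Finset.prod_inv_distrib]
  refine inv_anti₀ (Finset.prod_pos fun i _ => by positivity) ?_
  calc ∏ i, (1 + |((k - l) i : ℝ)|) ^ 2
      ≤ ∏ _i : Fin n, (1 + ‖latticePt k - latticePt l‖) ^ 2 := by
        refine Finset.prod_le_prod (fun i _ => by positivity) fun i _ => ?_
        have h1 := PiLp.norm_apply_le (latticePt k - latticePt l) i
        simp only [PiLp.sub_apply, latticePt, Real.norm_eq_abs] at h1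
        have h2 : |((k - l) i : ℝ)| = |(k i : ℝ) - l i| := by simp
        rw [h2]
        gcongr
        exact h1
    _ = _ := by simp [pow_mul]

theorem summable_inv_one_add_abs_sq : Summable fun m : ℤ => ((1 + |(m : ℝ)|) ^ 2)⁻¹ := by
  have h1 : Summable fun m : ℕ => (((m : ℝ) + 1) ^ 2)⁻¹ := by
    have := (summable_nat_add_iff 1).2 (Real.summable_nat_pow_inv.2 (by norm_num : 1 < 2))
    simpa using this
  refine Summable.of_nat_of_neg (h1.congr fun m => ?_) (h1.congr fun m => ?_)
  · rw [Int.cast_natCast, Nat.abs_cast, add_comm]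
  · rw [Int.cast_neg, Int.cast_natCast, abs_neg, Nat.abs_cast, add_comm]

/-- A finite set of lattice points lies in the product of its coordinate projections, over which the
sum factors. -/
theorem sum_prod_le_tsum_pow {g : ℤ → ℝ} (hg : Summable g) (hg0 : ∀ m, 0 ≤ g m)
    (K : Finset (Fin n → ℤ)) : ∑ m ∈ K, ∏ i, g (m i) ≤ (∑' m, g m) ^ n := by
  classical
  calc ∑ m ∈ K, ∏ i, g (m i)
      ≤ ∑ m ∈ Fintype.piFinset fun i => K.image fun m => m i, ∏ i, g (m i) := by
        refine Finset.sum_le_sum_of_subset_of_nonneg (fun m hm => ?_)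
          fun m _ _ => Finset.prod_nonneg fun i _ => hg0 _
        exact Fintype.mem_piFinset.2 fun i => Finset.mem_image_of_mem _ hm
    _ = ∏ i, ∑ m ∈ K.image fun m => m i, g m := (Finset.prod_univ_sum _ _).symm
    _ ≤ ∏ _i : Fin n, ∑' m : ℤ, g m :=
        Finset.prod_le_prod (fun i _ => Finset.sum_nonneg fun m _ => hg0 m)
          fun i _ => hg.sum_le_tsum _ fun m _ => hg0 m
    _ = _ := by rw [Finset.prod_const, Finset.card_univ, Fintype.card_fin]

theorem exists_sum_latticeWeight_le (n : ℕ) :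
    ∃ C : ℝ, ∀ (k : Fin n → ℤ) (K : Finset (Fin n → ℤ)),
      ∑ l ∈ K, latticeWeight (k - l) ≤ C := by
  classical
  refine ⟨(∑' m : ℤ, ((1 + |(m : ℝ)|) ^ 2)⁻¹) ^ n, fun k K => ?_⟩
  have h2 : ∑ l ∈ K, latticeWeight (k - l) =
      ∑ m ∈ K.image fun l => k - l, ∏ i, ((1 + |(m i : ℝ)|) ^ 2)⁻¹ := by
    rw [Finset.sum_image fun a _ b _ h => sub_right_injective h]
    rfl
  rw [h2]
  exact sum_prod_le_tsum_pow summable_inv_one_add_abs_sq (fun m => by positivity) _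

/-- Schur's test for a kernel dominated by the lattice weight. -/
theorem exists_schur_le (n : ℕ) : ∃ C : ℝ, ∀ (K : Finset (Fin n → ℤ))
    (b : (Fin n → ℤ) → ℝ),
      ∑ k ∈ K, ∑ l ∈ K, b k * b l * latticeWeight (k - l) ≤ C * ∑ k ∈ K, b k ^ 2 := by
  obtain ⟨C, hC⟩ := exists_sum_latticeWeight_le n
  refine ⟨C, fun K b => ?_⟩
  have h1 : ∑ k ∈ K, ∑ l ∈ K, b k ^ 2 * latticeWeight (k - l) ≤ C * ∑ k ∈ K, b k ^ 2 := by
    rw [Finset.mul_sum]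
    refine Finset.sum_le_sum fun k _ => ?_
    rw [← Finset.mul_sum, mul_comm]
    exact mul_le_mul_of_nonneg_right (hC k K) (sq_nonneg _)
  have h2 : ∑ k ∈ K, ∑ l ∈ K, b l ^ 2 * latticeWeight (k - l) =
      ∑ k ∈ K, ∑ l ∈ K, b k ^ 2 * latticeWeight (k - l) := by
    rw [Finset.sum_comm]
    exact Finset.sum_congr rfl fun k _ => Finset.sum_congr rfl fun l _ => by
      rw [latticeWeight_sub_comm]
  calc _ ≤ ∑ k ∈ K, ∑ l ∈ K, (1 / 2 * (b k ^ 2 * latticeWeight (k - l)) +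
        1 / 2 * (b l ^ 2 * latticeWeight (k - l))) := by
        refine Finset.sum_le_sum fun k _ => Finset.sum_le_sum fun l _ => ?_
        have := mul_le_mul_of_nonneg_right (two_mul_le_add_sq (b k) (b l))
          (latticeWeight_nonneg (k - l))
        linarith
    _ = ∑ k ∈ K, ∑ l ∈ K, b k ^ 2 * latticeWeight (k - l) := by
        have h3 : ∀ f : (Fin n → ℤ) → (Fin n → ℤ) → ℝ, ∑ k ∈ K, ∑ l ∈ K, 1 / 2 * f k l =
            1 / 2 * ∑ k ∈ K, ∑ l ∈ K, f k l := fun f => by simp only [Finset.mul_sum]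
        simp only [Finset.sum_add_distrib, h3, h2]
        ring
    _ ≤ _ := h1

end Lattice

/-! ### Phases with bounded mixed derivatives. -/

/-- The phases `Φ i` have mixed derivatives in both variables bounded uniformly in `i`, up to
`N` derivatives of `∂_y ∂_η Φ`. -/
def MixedBdd {ι : Type*} {n : ℕ} (N : ℕ)
    (Φ : ι → EuclideanSpace ℝ (Fin n) × EuclideanSpace ℝ (Fin n) → ℝ) : Prop :=
  (∀ i, ContDiff ℝ (N + 2 : ℕ) (Φ i)) ∧ ∀ j l, BddDeriv pairDir Set.univ N
    (fun i z => fderiv ℝ (fun z => fderiv ℝ (Φ i) z (pairDir (.inl j))) z (pairDir (.inr l)))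

section
variable {ι : Type*} {n N : ℕ}
  {Φ : ι → EuclideanSpace ℝ (Fin n) × EuclideanSpace ℝ (Fin n) → ℝ}

theorem fderiv_comp_swap {f : EuclideanSpace ℝ (Fin n) × EuclideanSpace ℝ (Fin n) → ℝ}
    (hf : Differentiable ℝ f) (e : Fin n ⊕ Fin n)
    (z : EuclideanSpace ℝ (Fin n) × EuclideanSpace ℝ (Fin n)) :
    fderiv ℝ (fun z => f z.swap) z (pairDir e) = fderiv ℝ f z.swap (pairDir e.swap) := by
  have h1 : HasFDerivAt (fun z : EuclideanSpace ℝ (Fin n) × EuclideanSpace ℝ (Fin n) => z.swap)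
      ((ContinuousLinearMap.snd ℝ _ _).prod (ContinuousLinearMap.fst ℝ _ _)) z :=
    HasFDerivAt.prodMk hasFDerivAt_snd hasFDerivAt_fst
  have h2 := ((hf z.swap).hasFDerivAt.comp z h1).fderiv
  simp only [Function.comp_def] at h2
  rw [h2]
  rcases e with e | e <;> simp [pairDir]

theorem fderiv_fderiv_comp_swap {f : EuclideanSpace ℝ (Fin n) × EuclideanSpace ℝ (Fin n) → ℝ}
    (hf : ContDiff ℝ 2 f) (j l : Fin n)
    (z : EuclideanSpace ℝ (Fin n) × EuclideanSpace ℝ (Fin n)) :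
    fderiv ℝ (fun z => fderiv ℝ (fun z => f z.swap) z (pairDir (.inl j))) z (pairDir (.inr l)) =
      fderiv ℝ (fun z => fderiv ℝ f z (pairDir (.inl l))) z.swap (pairDir (.inr j)) := by
  have hd : Differentiable ℝ fun z => fderiv ℝ f z (pairDir (.inr j)) :=
    ((hf.fderiv_right (m := 1) (by norm_num)).clm_apply contDiff_const).differentiable
      (by norm_num)
  simp only [fderiv_comp_swap (hf.differentiable (by norm_num))]
  have := fderiv_comp_swap hd (.inr l) z
  simp only [Sum.swap_inl, Sum.swap_inr] at this ⊢
  rw [this, fderiv_fderiv_apply_comm hf.contDiffAt]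

/-- Mixed derivatives treat both variables alike, so every estimate in `y` at frozen `η` has a
counterpart with the roles exchanged. -/
theorem MixedBdd.swap (h : MixedBdd N Φ) : MixedBdd N (fun i z => Φ i z.swap) := by
  refine ⟨fun i => (h.1 i).comp (contDiff_snd.prodMk contDiff_fst), fun j l => ?_⟩
  have h3 := (h.2 l j).comp_affine (U' := Set.univ) isOpen_univ isOpen_univ
    ((ContinuousLinearMap.snd ℝ _ _).prod (ContinuousLinearMap.fst ℝ _ _)) (fun _ => 0) id
    (d' := pairDir) Sum.swap (fun e => by rcases e with e | e <;> simp [pairDir])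
    (fun _ _ _ => trivial)
  refine h3.congr isOpen_univ fun i z _ => ?_
  rw [fderiv_fderiv_comp_swap ((h.1 i).of_le (by norm_cast; omega))]
  simp only [add_zero, id]
  rfl

end

theorem lintegral_mul_sq_le {α : Type*} [MeasurableSpace α] {μ : Measure α} {f g : α → ENNReal}
    (hf : AEMeasurable f μ) (hg : AEMeasurable g μ) :
    (∫⁻ x, f x * g x ∂μ) ^ 2 ≤ (∫⁻ x, f x ^ 2 ∂μ) * ∫⁻ x, g x ^ 2 ∂μ := by
  have h := ENNReal.lintegral_mul_le_Lp_mul_Lq μ Real.HolderConjugate.two_two hf hg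
  simp only [ENNReal.rpow_two, Pi.mul_apply] at h
  calc _ ≤ ((∫⁻ x, f x ^ 2 ∂μ) ^ (1 / 2 : ℝ) * (∫⁻ x, g x ^ 2 ∂μ) ^ (1 / 2 : ℝ)) ^ 2 := by gcongr
    _ = _ := by
      rw [mul_pow, ← ENNReal.rpow_two, ← ENNReal.rpow_two, ← ENNReal.rpow_mul, ← ENNReal.rpow_mul]
      norm_num

/-! ### Almost orthogonality of `e^{iΦ(y,k)}` on a unit cube. -/

section
variable {ι : Type*} {n : ℕ}
  {Φ : ι → EuclideanSpace ℝ (Fin n) × EuclideanSpace ℝ (Fin n) → ℝ}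

/-- A smooth cutoff equal to `1` on the ball of radius `n + r` and supported in the ball of radius
`n + r + 1`. -/
noncomputable def latticeBump (n : ℕ) (r : ℝ) (hr : 0 < r) :
    ContDiffBump (0 : EuclideanSpace ℝ (Fin n)) where
  rIn := n + r
  rOut := n + r + 1
  rIn_pos := by positivity
  rIn_lt_rOut := by linarith

theorem BddDeriv.bump {V κ ι : Type*} [NormedAddCommGroup V] [InnerProductSpace ℝ V]
    [FiniteDimensional ℝ V] (d : κ → V) (h : ContDiffBump (0 : V)) (x₀ : ι → V) (N : ℕ) :
    BddDeriv d Set.univ N (fun i x => h (x - x₀ i)) := by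
  have h1 : BddDeriv d Set.univ N (fun _ : Unit => (h : V → ℝ)) :=
    BddDeriv.of_hasCompactSupport h.contDiff h.hasCompactSupport
  have h2 := h1.comp_affine (U' := Set.univ) isOpen_univ isOpen_univ (ContinuousLinearMap.id ℝ V)
    (fun i => -x₀ i) (fun _ => ()) (d' := d) id (fun e => rfl) (fun _ _ _ => trivial)
  simpa [sub_eq_add_neg] using h2

/-- Separation of the gradients `∂_y Φ(y, k)`. -/
def FstSeparated (Φ : EuclideanSpace ℝ (Fin n) × EuclideanSpace ℝ (Fin n) → ℝ) (c : ℝ)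
    (y k l : EuclideanSpace ℝ (Fin n)) : Prop :=
  (c * ‖k - l‖) ^ 2 ≤
    ∑ e, (fderiv ℝ Φ (y, k) (pairDir (.inl e)) - fderiv ℝ Φ (y, l) (pairDir (.inl e))) ^ 2

/-- Off-diagonal decay of the Gram matrix of the functions `e^{iΦ(y, k)}` localized near a
lattice point. -/
theorem exists_norm_gram_le {N : ℕ} (hΦ : MixedBdd N Φ) {c : ℝ} (hc : 0 < c) :
    ∃ C, ∀ i (j k l : Fin n → ℤ), k ≠ l →
      (∀ y, ‖y - latticePt j‖ ≤ n + 3 → FstSeparated (Φ i) c y (latticePt k) (latticePt l)) →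
      ‖∫ y, Complex.exp (Complex.I * (Φ i (y, latticePt k) - Φ i (y, latticePt l) : ℝ)) *
        (latticeBump n 1 one_pos (y - latticePt j) : ℂ)‖ ≤
        C * (‖latticePt k - latticePt l‖ ^ N)⁻¹ := by
  -- All admissible `(i, j, k, l)` form one index type, so that the uniform nonstationary phase
  -- estimate yields a single constant.
  let α := {q : ι × (Fin n → ℤ) × (Fin n → ℤ) × (Fin n → ℤ) // q.2.2.1 ≠ q.2.2.2 ∧
    ∀ y, ‖y - latticePt q.2.1‖ ≤ n + 3 →
      FstSeparated (Φ q.1) c y (latticePt q.2.2.1) (latticePt q.2.2.2)}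
  let J : α → EuclideanSpace ℝ (Fin n) := fun q => latticePt q.1.2.1
  let k : α → EuclideanSpace ℝ (Fin n) := fun q => latticePt q.1.2.2.1
  let l : α → EuclideanSpace ℝ (Fin n) := fun q => latticePt q.1.2.2.2
  have hkl : ∀ q, 1 ≤ ‖k q - l q‖ := fun q => one_le_norm_latticePt_sub q.2.1
  -- Normalized by `‖k - l‖`, the phase difference has a gradient bounded with its derivatives, and
  -- `‖k - l‖` plays the large parameter.
  let θ : α → EuclideanSpace ℝ (Fin n) → ℝ := fun q y =>
    ‖k q - l q‖⁻¹ * (Φ q.1.1 (y, k q) - Φ q.1.1 (y, l q))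
  let A : α → EuclideanSpace ℝ (Fin n) → ℂ := fun q y => (latticeBump n 1 one_pos (y - J q) : ℂ)
  have hθd : ∀ e q y, fderiv ℝ (θ q) y (coordDir e) = ‖k q - l q‖⁻¹ *
      (fderiv ℝ (Φ q.1.1) (y, k q) (pairDir (.inl e)) -
        fderiv ℝ (Φ q.1.1) (y, l q) (pairDir (.inl e))) := fun e q y => by
    have hk : ∀ k, HasFDerivAt (fun y => Φ q.1.1 (y, k))
        ((fderiv ℝ (Φ q.1.1) (y, k)).comp (ContinuousLinearMap.inl ℝ _ _)) y := fun k =>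
      ((hΦ.1 q.1.1).differentiable (by norm_cast) _).hasFDerivAt.comp y
        (hasFDerivAt_prodMk_left y k)
    have h3 : HasFDerivAt (θ q) _ y := ((hk (k q)).fun_sub (hk (l q))).const_mul _
    rw [h3.fderiv]
    simp [pairDir]
  have hθ' : ∀ e, BddDeriv coordDir Set.univ N (fun q y => fderiv ℝ (θ q) y (coordDir e)) := by
    intro e
    have hS : ∀ i, ContDiff ℝ (N + 1 : ℕ) fun z => fderiv ℝ (Φ i) z (pairDir (.inl e)) :=
      BddDeriv.contDiff_fderiv_apply (N := N + 1) hΦ.1 _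
    have h1 := BddDeriv.diffQuotient hS (hΦ.2 e)
    have h2 := h1.comp_param (fun q : α => (q.1.1, k q, l q))
    exact h2.congr isOpen_univ fun q y _ => hθd e q y
  have hθ : ∀ q, ContDiff ℝ (N + 1 : ℕ) (θ q) := fun q =>
    (contDiff_const.mul (((hΦ.1 _).comp (contDiff_prodMk_left _)).sub
      ((hΦ.1 _).comp (contDiff_prodMk_left _)))).of_le (by norm_cast; omega)
  have hA : BddDeriv coordDir Set.univ N A :=
    (BddDeriv.bump coordDir (latticeBump n 1 one_pos) J N).ofReal isOpen_univ
  -- The added term vanishes on the support of `A`, so `w` inverts the squared gradient there. It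
  -- equals 1 beyond radius `n + 3`, where no separation is available, and keeps the denominator
  -- bounded below everywhere.
  let w : α → EuclideanSpace ℝ (Fin n) → ℝ := fun q y =>
    (∑ e, fderiv ℝ (θ q) y (coordDir e) ^ 2 +
      (1 - latticeBump n 2 two_pos (y - J q)))⁻¹
  have hw : BddDeriv coordDir Set.univ N w := by
    refine BddDeriv.inv isOpen_univ (δ := min (c ^ 2) 1) ?_ (by positivity) ?_
    · refine BddDeriv.add isOpen_univ (BddDeriv.sum isOpen_univ _ fun e _ => ?_)
        (BddDeriv.sub isOpen_univ (BddDeriv.const (C := 1) (by simp))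
          (BddDeriv.bump coordDir _ J N))
      simpa only [sq] using (hθ' e).mul isOpen_univ (hθ' e)
    · intro q y _
      by_cases hy : ‖y - J q‖ ≤ n + 3
      · have h1 := q.2.2 y hy
        have h2 : c ^ 2 ≤ ∑ e, fderiv ℝ (θ q) y (coordDir e) ^ 2 := by
          have hpos : 0 < ‖k q - l q‖ := zero_lt_one.trans_le (hkl q)
          simp only [hθd, mul_pow, ← Finset.mul_sum]
          rw [inv_pow, ← div_eq_inv_mul, le_div_iff₀ (by positivity), ← mul_pow]
          exact h1
        have h3 : latticeBump n 2 two_pos (y - J q) ≤ 1 := ContDiffBump.le_one _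
        exact (min_le_left _ _).trans (by linarith)
      · have h3 : latticeBump n 2 two_pos (y - J q) = 0 := by
          refine ContDiffBump.zero_of_le_dist _ ?_
          rw [dist_zero_right]
          simp only [latticeBump]
          linarith
        rw [h3]
        refine (min_le_right _ _).trans ?_
        have : 0 ≤ ∑ e, fderiv ℝ (θ q) y (coordDir e) ^ 2 :=
          Finset.sum_nonneg fun e _ => sq_nonneg _
        linarith
  have hs : ∀ q, tsupport (A q) ⊆ Metric.closedBall (J q) (n + 2) := by
    refine fun q => closure_minimal (fun y hy => ?_) Metric.isClosed_closedBall
    by_contra hy'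
    refine hy ?_
    simp only [A, Complex.ofReal_eq_zero]
    refine ContDiffBump.zero_of_le_dist _ ?_
    rw [mem_closedBall_iff_norm, not_le] at hy'
    rw [dist_zero_right]
    simp only [latticeBump]
    linarith
  have h1 : ∀ q, ∀ y ∈ tsupport (A q),
      w q y * ∑ e, (fderiv ℝ (θ q) y (coordDir e)) ^ 2 = 1 := by
    intro q y hy
    have hy2 := mem_closedBall_iff_norm.1 (hs q hy)
    have h3 : latticeBump n 2 two_pos (y - J q) = 1 := by
      refine ContDiffBump.one_of_mem_closedBall _ ?_
      rw [mem_closedBall_zero_iff]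
      exact hy2
    have h2 := q.2.2 y (hy2.trans (by linarith))
    have hpos : 0 < ‖k q - l q‖ := zero_lt_one.trans_le (hkl q)
    have h4 : 0 < ∑ e, fderiv ℝ (θ q) y (coordDir e) ^ 2 := by
      simp only [hθd, mul_pow, ← Finset.mul_sum]
      refine mul_pos (by positivity) (lt_of_lt_of_le ?_ h2)
      have : 0 < c * ‖k q - l q‖ := mul_pos hc hpos
      positivity
    simp only [w, h3, sub_self, add_zero]
    exact inv_mul_cancel₀ h4.ne'
  obtain ⟨C, hC⟩ := exists_norm_integral_cexp_le volume hθ hθ' hw hA hs h1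
  refine ⟨C, fun i j k' l' hne hsep => ?_⟩
  have := hC ⟨(i, j, k', l'), hne, hsep⟩ ‖latticePt k' - latticePt l'‖
    (zero_lt_one.trans_le (one_le_norm_latticePt_sub hne))
  refine Eq.trans_le ?_ this
  congr 2
  ext y
  simp only [θ, A, k, l, J]
  rw [mul_inv_cancel_left₀ (zero_lt_one.trans_le (one_le_norm_latticePt_sub hne)).ne']

/-- Distinct lattice points are at distance at least 1, so `1 + ‖k - l‖ ≤ 2‖k - l‖` and the loss is
`2 ^ (2 * n)`. On the diagonal the integral is the mass of the cutoff. -/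
theorem exists_norm_gram_le_latticeWeight (hΦ : MixedBdd (2 * n) Φ) {c : ℝ} (hc : 0 < c) :
    ∃ C, ∀ i (j k l : Fin n → ℤ),
      (∀ y, ‖y - latticePt j‖ ≤ n + 3 → FstSeparated (Φ i) c y (latticePt k) (latticePt l)) →
      ‖∫ y, Complex.exp (Complex.I * (Φ i (y, latticePt k) - Φ i (y, latticePt l) : ℝ)) *
        (latticeBump n 1 one_pos (y - latticePt j) : ℂ)‖ ≤ C * latticeWeight (k - l) := by
  obtain ⟨C, hC⟩ := exists_norm_gram_le hΦ hc
  set D : ℝ := ∫ y, latticeBump n 1 one_pos y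
  refine ⟨max D (|C| * 2 ^ (2 * n)), fun i j k l hsep => ?_⟩
  rcases eq_or_ne k l with rfl | hne
  · have h1 : latticeWeight (k - k) = 1 := by simp [latticeWeight]
    rw [h1, mul_one]
    simp only [sub_self, Complex.ofReal_zero, mul_zero, Complex.exp_zero, one_mul]
    rw [integral_complex_ofReal, Complex.norm_real,
      integral_sub_right_eq_self (fun y => latticeBump n 1 one_pos y) (latticePt j),
      Real.norm_of_nonneg (integral_nonneg fun y => ContDiffBump.nonneg _)]
    exact le_max_left _ _
  · refine (hC i j k l hne hsep).trans ?_
    have h1 := one_le_norm_latticePt_sub hne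
    have h2 := inv_pow_le_latticeWeight k l
    have h3 : (‖latticePt k - latticePt l‖ ^ (2 * n))⁻¹ ≤
        2 ^ (2 * n) * ((1 + ‖latticePt k - latticePt l‖) ^ (2 * n))⁻¹ := by
      rw [← div_eq_mul_inv, inv_eq_one_div, div_le_div_iff₀ (by positivity) (by positivity),
        one_mul, ← mul_pow]
      exact pow_le_pow_left₀ (by positivity) (by linarith) _
    calc C * (‖latticePt k - latticePt l‖ ^ (2 * n))⁻¹
        ≤ |C| * (2 ^ (2 * n) * latticeWeight (k - l)) := by
          refine mul_le_mul (le_abs_self C) (h3.trans ?_) (by positivity) (abs_nonneg C)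
          exact mul_le_mul_of_nonneg_left h2 (by positivity)
      _ = |C| * 2 ^ (2 * n) * latticeWeight (k - l) := by ring
      _ ≤ _ := mul_le_mul_of_nonneg_right (le_max_right _ _) (latticeWeight_nonneg _)

/-- Bessel's inequality for the oscillating functions `e^{iΦ(y, k)}` on a unit cube. -/
theorem exists_bessel (hΦ : MixedBdd (2 * n) Φ) {c : ℝ} (hc : 0 < c) :
    ∃ C : ℝ≥0, ∀ i (j : Fin n → ℤ) (K : Finset (Fin n → ℤ)),
      (∀ y, ‖y - latticePt j‖ ≤ n + 3 → ∀ k ∈ K, ∀ l ∈ K,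
        FstSeparated (Φ i) c y (latticePt k) (latticePt l)) → ∀ a : (Fin n → ℤ) → ℂ,
      ∫⁻ y in unitBox j, ‖∑ k ∈ K, a k * Complex.exp (Complex.I * Φ i (y, latticePt k))‖ₑ ^ 2 ≤
        C * ∑ k ∈ K, ‖a k‖ₑ ^ 2 := by
  obtain ⟨C, hC⟩ := exists_norm_gram_le_latticeWeight hΦ hc
  obtain ⟨S, hS⟩ := exists_schur_le n
  refine ⟨(|C| * |S|).toNNReal, fun i j K hsep a => ?_⟩
  -- The indicator of the cube is majorized by a smooth cutoff; expanding the square then produces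
  -- the Gram matrix that Schur's test controls.
  set h : EuclideanSpace ℝ (Fin n) → ℝ := fun y => latticeBump n 1 one_pos (y - latticePt j)
  have hhc : Continuous h := (ContDiffBump.continuous _).comp (continuous_id.sub continuous_const)
  have hh0 : ∀ y, 0 ≤ h y := fun y => ContDiffBump.nonneg _
  have hhs : HasCompactSupport h :=
    (ContDiffBump.hasCompactSupport _).comp_homeomorph (Homeomorph.subRight (latticePt j))
  set E : (Fin n → ℤ) → EuclideanSpace ℝ (Fin n) → ℂ := fun k y =>
    Complex.exp (Complex.I * Φ i (y, latticePt k))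
  have hEc : ∀ k, Continuous (E k) := fun k => by
    have : Continuous fun y => Φ i (y, latticePt k) :=
      (hΦ.1 i).continuous.comp (by fun_prop)
    exact Complex.continuous_exp.comp
      (continuous_const.mul (Complex.continuous_ofReal.comp this))
  set F : EuclideanSpace ℝ (Fin n) → ℂ := fun y => ∑ k ∈ K, a k * E k y
  have hFc : Continuous F := continuous_finsetSum _ fun k _ => continuous_const.mul (hEc k)
  have hint : Integrable fun y => h y * ‖F y‖ ^ 2 :=
    (hhc.mul (hFc.norm.pow 2)).integrable_of_hasCompactSupport hhs.mul_right
  have hEE : ∀ k l y, E k y * (starRingEnd ℂ) (E l y) =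
      Complex.exp (Complex.I * (Φ i (y, latticePt k) - Φ i (y, latticePt l) : ℝ)) := by
    intro k l y
    simp only [E]
    rw [← Complex.exp_conj, ← Complex.exp_add]
    congr 1
    simp
    ring
  have hexp : ∀ y, ((h y * ‖F y‖ ^ 2 : ℝ) : ℂ) = ∑ k ∈ K, ∑ l ∈ K,
      a k * (starRingEnd ℂ) (a l) * (Complex.exp (Complex.I *
        (Φ i (y, latticePt k) - Φ i (y, latticePt l) : ℝ)) * (h y : ℂ)) := by
    intro y
    push_cast
    rw [← Complex.mul_conj']
    simp only [F, map_sum]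
    rw [Finset.sum_mul_sum]
    simp only [Finset.mul_sum, map_mul]
    refine Finset.sum_congr rfl fun k _ => Finset.sum_congr rfl fun l _ => ?_
    have := hEE k l y
    push_cast at this
    rw [← this]; ring
  have hGi : ∀ k l, Integrable fun y => a k * (starRingEnd ℂ) (a l) * (Complex.exp (Complex.I *
        (Φ i (y, latticePt k) - Φ i (y, latticePt l) : ℝ)) * (h y : ℂ)) := by
    intro k l
    simp only [← hEE]
    refine Continuous.integrable_of_hasCompactSupport ?_ ?_
    · have h1 := hEc k
      have h2 := Complex.continuous_conj.comp (hEc l)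
      simp only [Function.comp_def] at h2
      fun_prop
    · refine HasCompactSupport.mul_left (HasCompactSupport.mul_left ?_)
      exact hhs.comp_left (g := fun s : ℝ => (s : ℂ)) (by simp)
  have hreal : ∫ y, h y * ‖F y‖ ^ 2 ≤ |C| * |S| * ∑ k ∈ K, ‖a k‖ ^ 2 := by
    have h1 : ((∫ y, h y * ‖F y‖ ^ 2 : ℝ) : ℂ) = ∑ k ∈ K, ∑ l ∈ K, a k * (starRingEnd ℂ) (a l) *
        ∫ y, (Complex.exp (Complex.I *
        (Φ i (y, latticePt k) - Φ i (y, latticePt l) : ℝ)) * (h y : ℂ)) := by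
      rw [← integral_complex_ofReal]
      simp only [hexp]
      rw [integral_finsetSum _ fun k _ => integrable_finsetSum _ fun l _ => hGi k l]
      refine Finset.sum_congr rfl fun k _ => ?_
      rw [integral_finsetSum _ fun l _ => hGi k l]
      exact Finset.sum_congr rfl fun l _ => integral_const_mul _ _
    have h2 : ∫ y, h y * ‖F y‖ ^ 2 ≤ ‖((∫ y, h y * ‖F y‖ ^ 2 : ℝ) : ℂ)‖ := by
      rw [Complex.norm_real]; exact le_abs_self _
    refine h2.trans ?_
    rw [h1]
    calc _ ≤ ∑ k ∈ K, ∑ l ∈ K, |C| * (‖a k‖ * ‖a l‖ * latticeWeight (k - l)) := by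
          refine (norm_sum_le _ _).trans (Finset.sum_le_sum fun k hk =>
            (norm_sum_le _ _).trans (Finset.sum_le_sum fun l hl => ?_))
          rw [norm_mul, norm_mul, RCLike.norm_conj]
          have := (hC i j k l fun y hy => hsep y hy k hk l hl).trans
            (mul_le_mul_of_nonneg_right (le_abs_self C) (latticeWeight_nonneg _))
          calc _ ≤ ‖a k‖ * ‖a l‖ * (|C| * latticeWeight (k - l)) :=
                mul_le_mul_of_nonneg_left this (by positivity)
            _ = _ := by ring
      _ = |C| * ∑ k ∈ K, ∑ l ∈ K, ‖a k‖ * ‖a l‖ * latticeWeight (k - l) := by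
          simp only [Finset.mul_sum]
      _ ≤ |C| * (|S| * ∑ k ∈ K, ‖a k‖ ^ 2) := by
          refine mul_le_mul_of_nonneg_left ((hS K fun k => ‖a k‖).trans ?_) (abs_nonneg _)
          exact mul_le_mul_of_nonneg_right (le_abs_self S) (by positivity)
      _ = _ := by ring
  calc ∫⁻ y in unitBox j, ‖F y‖ₑ ^ 2 ≤ ∫⁻ y in unitBox j, ENNReal.ofReal (h y * ‖F y‖ ^ 2) := by
        refine setLIntegral_mono' (measurableSet_unitBox j) fun y hy => ?_
        have h1 : h y = 1 := by
          refine ContDiffBump.one_of_mem_closedBall _ ?_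
          rw [mem_closedBall_zero_iff]
          exact (norm_sub_latticePt_le hy).trans (by simp only [latticeBump]; linarith)
        rw [h1, one_mul, ENNReal.ofReal_pow (norm_nonneg _), ofReal_norm]
    _ ≤ ∫⁻ y, ENNReal.ofReal (h y * ‖F y‖ ^ 2) := setLIntegral_le_lintegral _ _
    _ = ENNReal.ofReal (∫ y, h y * ‖F y‖ ^ 2) :=
        (ofReal_integral_eq_lintegral_ofReal hint
          (Filter.Eventually.of_forall fun y => mul_nonneg (hh0 y) (sq_nonneg _))).symm
    _ ≤ ENNReal.ofReal (|C| * |S| * ∑ k ∈ K, ‖a k‖ ^ 2) := ENNReal.ofReal_le_ofReal hreal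
    _ = _ := by
        rw [ENNReal.ofReal_mul (by positivity), ENNReal.ofReal_sum_of_nonneg fun k _ => by positivity]
        congr 1
        refine Finset.sum_congr rfl fun k _ => ?_
        rw [ENNReal.ofReal_pow (norm_nonneg _), ofReal_norm]

end

section
variable {ι : Type*} {n : ℕ}
  {Φ : ι → EuclideanSpace ℝ (Fin n) × EuclideanSpace ℝ (Fin n) → ℝ}

theorem integrableOn_unitBox {F : Type*} [NormedAddCommGroup F]
    {f : EuclideanSpace ℝ (Fin n) → F} (hf : Continuous f) (k : Fin n → ℤ) :
    IntegrableOn f (unitBox k) :=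
  (hf.continuousOn.integrableOn_compact (isCompact_closedBall (latticePt k) n)).mono_set
    fun _ hy => mem_closedBall_iff_norm.2 (norm_sub_latticePt_le hy)

/-- The inequality dual to `exists_bessel`. -/
theorem exists_dual_bessel (hΦ : MixedBdd (2 * n) Φ) {c : ℝ} (hc : 0 < c) :
    ∃ C : ℝ≥0, ∀ i (k : Fin n → ℤ) (J : Finset (Fin n → ℤ)),
      (∀ η, ‖η - latticePt k‖ ≤ n + 3 → ∀ j ∈ J, ∀ j' ∈ J,
        FstSeparated (fun z => Φ i z.swap) c η (latticePt j) (latticePt j')) →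
      ∀ v : EuclideanSpace ℝ (Fin n) → ℂ, Continuous v →
      ∑ j ∈ J, ‖∫ η in unitBox k, v η * Complex.exp (Complex.I * Φ i (latticePt j, η))‖ₑ ^ 2 ≤
        C * ∫⁻ η in unitBox k, ‖v η‖ₑ ^ 2 := by
  obtain ⟨C, hC⟩ := exists_bessel hΦ.swap hc
  refine ⟨C, fun i k J hsep v hv => ?_⟩
  set E : (Fin n → ℤ) → EuclideanSpace ℝ (Fin n) → ℂ := fun j η =>
    Complex.exp (Complex.I * Φ i (latticePt j, η)) with hE
  have hEc : ∀ j, Continuous (E j) := fun j => by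
    have : Continuous fun η => Φ i (latticePt j, η) := (hΦ.1 i).continuous.comp (by fun_prop)
    exact Complex.continuous_exp.comp
      (continuous_const.mul (Complex.continuous_ofReal.comp this))
  set W : (Fin n → ℤ) → ℂ := fun j => ∫ η in unitBox k, v η * E j η
  -- Duality: `X = ∑ |W j|²` is the integral of `v F`, while Bessel's inequality bounds the squared
  -- norm of `F` by `C X`. Cauchy–Schwarz gives `X² ≤ C ‖v‖² X`, and the finite `X` cancels unless
  -- it is zero.
  set F : EuclideanSpace ℝ (Fin n) → ℂ := fun η => ∑ j ∈ J, (starRingEnd ℂ) (W j) * E j η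
  have hFc : Continuous F := continuous_finsetSum _ fun j _ => continuous_const.mul (hEc j)
  set X : ENNReal := ∑ j ∈ J, ‖W j‖ₑ ^ 2 with hX
  have hXW : ∑ j ∈ J, ‖(starRingEnd ℂ) (W j)‖ₑ ^ 2 = X :=
    Finset.sum_congr rfl fun j _ => by rw [← ofReal_norm, RCLike.norm_conj, ofReal_norm]
  have hF : ∫⁻ η in unitBox k, ‖F η‖ₑ ^ 2 ≤ C * X := by
    have := hC i k J hsep fun j => (starRingEnd ℂ) (W j)
    rw [hXW] at this
    exact this
  have h1 : ∑ j ∈ J, (starRingEnd ℂ) (W j) * W j = ∫ η in unitBox k, v η * F η := by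
    simp only [F, Finset.mul_sum]
    rw [integral_finsetSum]
    · refine Finset.sum_congr rfl fun j _ => ?_
      rw [← integral_const_mul]
      congr 1; ext η; ring
    · exact fun j _ => integrableOn_unitBox (hv.mul (continuous_const.mul (hEc j))) k
  have h2 : X = ‖∑ j ∈ J, (starRingEnd ℂ) (W j) * W j‖ₑ := by
    have h3 : ∑ j ∈ J, (starRingEnd ℂ) (W j) * W j = ((∑ j ∈ J, ‖W j‖ ^ 2 : ℝ) : ℂ) := by
      push_cast
      exact Finset.sum_congr rfl fun j _ => Complex.conj_mul' _
    rw [h3, ← ofReal_norm, Complex.norm_real, Real.norm_of_nonneg (by positivity),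
      ENNReal.ofReal_sum_of_nonneg fun j _ => by positivity]
    refine Finset.sum_congr rfl fun j _ => ?_
    rw [ENNReal.ofReal_pow (norm_nonneg _), ofReal_norm]
  have h3 : X ≤ ∫⁻ η in unitBox k, ‖v η‖ₑ * ‖F η‖ₑ := by
    rw [h2, h1]
    refine (enorm_integral_le_lintegral_enorm _).trans_eq ?_
    simp only [enorm_mul]
  have h4 : X * X ≤ (C * ∫⁻ η in unitBox k, ‖v η‖ₑ ^ 2) * X := by
    calc X * X = X ^ 2 := (sq X).symm
      _ ≤ (∫⁻ η in unitBox k, ‖v η‖ₑ * ‖F η‖ₑ) ^ 2 := by gcongr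
      _ ≤ (∫⁻ η in unitBox k, ‖v η‖ₑ ^ 2) * ∫⁻ η in unitBox k, ‖F η‖ₑ ^ 2 :=
        lintegral_mul_sq_le hv.enorm.measurable.aemeasurable hFc.enorm.measurable.aemeasurable
      _ ≤ (∫⁻ η in unitBox k, ‖v η‖ₑ ^ 2) * (C * X) := by gcongr
      _ = _ := by ring
  rcases eq_or_ne X 0 with h0 | h0
  · rw [h0]; exact zero_le
  · have hX' : X ≠ ⊤ := by
      rw [hX]
      exact ENNReal.sum_ne_top.2 fun j _ => ENNReal.pow_ne_top enorm_ne_top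
    exact (ENNReal.mul_le_mul_iff_left h0 hX').1 h4

/-! ### The second difference of the phase and the local amplitudes. -/

/-- The product carries the sup norm, whereas the Fourier transform asks for an inner product; this
identification passes between the two. -/
theorem sumEquivProd_coordDir (e : Fin n ⊕ Fin n) :
    (EuclideanSpace.sumEquivProd (𝕜 := ℝ) (ι := Fin n) (κ := Fin n)) (coordDir e) =
      pairDir e := by
  rcases e with e | e <;> refine Prod.ext ?_ ?_ <;> ext i <;>
    simp [pairDir, coordDir]

theorem norm_sumEquivProd_sq (x : EuclideanSpace ℝ (Fin n ⊕ Fin n)) :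
    ‖x‖ ^ 2 = ‖(EuclideanSpace.sumEquivProd x).1‖ ^ 2 + ‖(EuclideanSpace.sumEquivProd x).2‖ ^ 2 := by
  simp [EuclideanSpace.norm_sq_eq]

theorem norm_sumEquivProd_symm_le (y η : EuclideanSpace ℝ (Fin n)) :
    ‖(EuclideanSpace.sumEquivProd (𝕜 := ℝ)).symm (y, η)‖ ≤ ‖y‖ + ‖η‖ := by
  have h := norm_sumEquivProd_sq ((EuclideanSpace.sumEquivProd (𝕜 := ℝ)).symm (y, η))
  rw [ContinuousLinearEquiv.apply_symm_apply] at h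
  refine le_of_sq_le_sq ?_ (by positivity)
  rw [h]
  nlinarith [norm_nonneg y, norm_nonneg η]

/-- The second difference of the phase, based at `p`. -/
noncomputable def phaseRemainder
    (Φ : EuclideanSpace ℝ (Fin n) × EuclideanSpace ℝ (Fin n) → ℝ)
    (p : EuclideanSpace ℝ (Fin n) × EuclideanSpace ℝ (Fin n))
    (x : EuclideanSpace ℝ (Fin n ⊕ Fin n)) : ℝ :=
  Φ (EuclideanSpace.sumEquivProd x + p) - Φ ((EuclideanSpace.sumEquivProd x).1 + p.1, p.2) -
    (Φ (p.1, (EuclideanSpace.sumEquivProd x).2 + p.2) - Φ p)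

/-- A `y`-derivative of the second difference is a difference in `η`, over a bounded distance, of
`∂_y Φ`; an `η`-derivative is a difference in `y` of `∂_η Φ`. Only mixed derivatives of `Φ` enter,
although the pure ones may be unbounded. -/
theorem BddDeriv.phaseRemainder {N : ℕ} (hΦ : MixedBdd N Φ) (r : ℝ) (e : Fin n ⊕ Fin n) :
    BddDeriv coordDir (Metric.ball 0 r) N
      (fun (q : ι × EuclideanSpace ℝ (Fin n) × EuclideanSpace ℝ (Fin n)) x =>
        fderiv ℝ (phaseRemainder (Φ q.1) q.2) x (coordDir e)) := by
  set Q : EuclideanSpace ℝ (Fin n ⊕ Fin n) →L[ℝ]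
    EuclideanSpace ℝ (Fin n) × EuclideanSpace ℝ (Fin n) :=
    (EuclideanSpace.sumEquivProd (𝕜 := ℝ) (ι := Fin n) (κ := Fin n)).toContinuousLinearMap with hQ
  set Q₁ : EuclideanSpace ℝ (Fin n ⊕ Fin n) →L[ℝ]
    EuclideanSpace ℝ (Fin n) × EuclideanSpace ℝ (Fin n) :=
    (ContinuousLinearMap.inl ℝ _ _).comp ((ContinuousLinearMap.fst ℝ _ _).comp Q) with hQ₁
  set Q₂ : EuclideanSpace ℝ (Fin n ⊕ Fin n) →L[ℝ]
    EuclideanSpace ℝ (Fin n) × EuclideanSpace ℝ (Fin n) :=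
    (ContinuousLinearMap.inr ℝ _ _).comp ((ContinuousLinearMap.snd ℝ _ _).comp Q) with hQ₂
  have hQe : ∀ e, Q (coordDir e) = pairDir e := sumEquivProd_coordDir
  have hr1 : ∀ x ∈ Metric.ball (0 : EuclideanSpace ℝ (Fin n ⊕ Fin n)) r, ‖(Q x).1‖ ≤ r := by
    intro x hx
    rw [mem_ball_zero_iff] at hx
    refine le_trans (le_of_sq_le_sq ?_ (norm_nonneg x)) hx.le
    rw [norm_sumEquivProd_sq x]
    exact le_add_of_nonneg_right (sq_nonneg _)
  have hr2 : ∀ x ∈ Metric.ball (0 : EuclideanSpace ℝ (Fin n ⊕ Fin n)) r, ‖(Q x).2‖ ≤ r := by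
    intro x hx
    rw [mem_ball_zero_iff] at hx
    refine le_trans (le_of_sq_le_sq ?_ (norm_nonneg x)) hx.le
    rw [norm_sumEquivProd_sq x]
    exact le_add_of_nonneg_left (sq_nonneg _)
  have hd : ∀ (q : ι × EuclideanSpace ℝ (Fin n) × EuclideanSpace ℝ (Fin n)) x v,
      fderiv ℝ (_root_.phaseRemainder (Φ q.1) q.2) x v =
        fderiv ℝ (Φ q.1) (Q x + q.2) (Q v) - fderiv ℝ (Φ q.1) (Q₁ x + q.2) (Q₁ v) -
          fderiv ℝ (Φ q.1) (Q₂ x + q.2) (Q₂ v) := by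
    intro q x v
    have hk : ∀ T : EuclideanSpace ℝ (Fin n ⊕ Fin n) →L[ℝ]
        EuclideanSpace ℝ (Fin n) × EuclideanSpace ℝ (Fin n),
        HasFDerivAt (fun x => Φ q.1 (T x + q.2)) ((fderiv ℝ (Φ q.1) (T x + q.2)).comp T) x :=
      fun T => ((hΦ.1 q.1).differentiable (by norm_cast) _).hasFDerivAt.comp x
        (T.hasFDerivAt.add_const _)
    have h1 : _root_.phaseRemainder (Φ q.1) q.2 = fun x => Φ q.1 (Q x + q.2) - Φ q.1 (Q₁ x + q.2) -
        (Φ q.1 (Q₂ x + q.2) - Φ q.1 q.2) := by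
      ext x
      have e1 : ((Q x).1 + q.2.1, q.2.2) = Q₁ x + q.2 := by ext <;> simp [Q₁]
      have e2 : (q.2.1, (Q x).2 + q.2.2) = Q₂ x + q.2 := by ext <;> simp [Q₂]
      rw [← e1, ← e2]
      rfl
    rw [h1, (((hk Q).fun_sub (hk Q₁)).fun_sub ((hk Q₂).sub_const _)).fderiv]
    simp
  rcases e with m | m
  · have h1 := BddDeriv.diffAffine Q id hQe Metric.isOpen_ball hr2
      (BddDeriv.contDiff_fderiv_apply (N := N + 1) hΦ.1 (pairDir (.inl m))) (hΦ.2 m)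
    refine h1.congr Metric.isOpen_ball fun q x _ => ?_
    have e1 : Q₁ (coordDir (.inl m)) = pairDir (.inl m) := by simp [Q₁, hQe, pairDir]
    have e2 : Q₂ (coordDir (.inl m)) = 0 := by simp [Q₂, hQe, pairDir]
    have e3 : ((Q x).1 + q.2.1, q.2.2) = Q₁ x + q.2 := by ext <;> simp [Q₁]
    rw [hd, hQe, e1, e2, e3, map_zero, sub_zero]
  · have hs := hΦ.swap
    have h0 := BddDeriv.diffAffine (d := coordDir) (((ContinuousLinearMap.snd ℝ _ _).prod
      (ContinuousLinearMap.fst ℝ _ _)).comp Q) Sum.swap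
      (fun e => by rw [ContinuousLinearMap.comp_apply, hQe]; rcases e with e | e <;> simp [pairDir])
      Metric.isOpen_ball hr1
      (BddDeriv.contDiff_fderiv_apply (N := N + 1) hs.1 (pairDir (.inl m))) (hs.2 m)
    have h1 := h0.comp_param
      (fun q : ι × EuclideanSpace ℝ (Fin n) × EuclideanSpace ℝ (Fin n) => (q.1, q.2.swap))
    refine h1.congr Metric.isOpen_ball fun q x _ => ?_
    have e1 : Q₁ (coordDir (.inr m)) = 0 := by simp [Q₁, hQe, pairDir]
    have e2 : Q₂ (coordDir (.inr m)) = pairDir (.inr m) := by simp [Q₂, hQe, pairDir]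
    rw [hd, hQe, e1, e2, map_zero, sub_zero]
    have hsw : ∀ z, fderiv ℝ (fun z => Φ q.1 z.swap) z (pairDir (.inl m)) =
        fderiv ℝ (Φ q.1) z.swap (pairDir (.inr m)) := fun z => by
      have h1 : HasFDerivAt
          (fun z : EuclideanSpace ℝ (Fin n) × EuclideanSpace ℝ (Fin n) => z.swap)
          ((ContinuousLinearMap.snd ℝ _ _).prod (ContinuousLinearMap.fst ℝ _ _)) z :=
        HasFDerivAt.prodMk hasFDerivAt_snd hasFDerivAt_fst
      have h2 := ((((hΦ.1 q.1).differentiable (by norm_cast)) z.swap).hasFDerivAt.comp z h1).fderiv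
      simp only [Function.comp_def] at h2
      rw [h2]
      simp [pairDir]
    simp only [hsw]
    have e3 : Q₂ x + q.2 = (q.2.1, (Q x).2 + q.2.2) := by ext <;> simp [Q₂]
    rw [e3]
    rfl

end

section
open scoped FourierTransform

variable {ι : Type*} {n : ℕ}
  {Φ : ι → EuclideanSpace ℝ (Fin n) × EuclideanSpace ℝ (Fin n) → ℝ}
  {b : ι → EuclideanSpace ℝ (Fin n) × EuclideanSpace ℝ (Fin n) → ℂ}

/-- Uniform decay of Fourier transforms of a bounded family supported in a fixed ball. -/
theorem exists_norm_fourier_le {κ : Type*} [Fintype κ] [DecidableEq κ] {N : ℕ}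
    {m : ι → EuclideanSpace ℝ κ → ℂ}
    (hm : BddDeriv coordDir Set.univ N m) {r : ℝ}
    (hs : ∀ i, tsupport (m i) ⊆ Metric.closedBall 0 r) :
    ∃ C, ∀ i w, ‖𝓕 (m i) w‖ ≤ C * ((1 + ‖w‖) ^ N)⁻¹ := by
  obtain ⟨C₀, hC₀0, hC₀⟩ := hm.bound_nonneg
  set D := C₀ * (volume : Measure (EuclideanSpace ℝ κ)).real (Metric.closedBall 0 r)
  have hD0 : 0 ≤ D := by positivity
  have hD : ∀ i w, ‖𝓕 (m i) w‖ ≤ D := fun i w => by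
    rw [Real.fourier_eq']
    refine norm_integral_le_of_tsupport_subset ((tsupport_smul_subset_right _ _).trans (hs i))
      fun x => ?_
    rw [norm_smul, Complex.norm_exp_ofReal_mul_I, one_mul]
    exact hC₀ i x trivial
  let α := ι × {w : EuclideanSpace ℝ κ // w ≠ 0}
  -- The phase is linear with normalized frequency: `‖w‖` is the large parameter and the squared
  -- gradient is the constant `(2π)²`.
  let θ : α → EuclideanSpace ℝ κ → ℝ := fun q x =>
    -2 * Real.pi * innerSL ℝ (‖q.2.1‖⁻¹ • q.2.1) x
  have hθd : ∀ e q x, fderiv ℝ (θ q) x (coordDir e) = -2 * Real.pi * (‖q.2.1‖⁻¹ * q.2.1 e) := by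
    intro e q x
    have h1 : HasFDerivAt (θ q) _ x :=
      (innerSL ℝ (‖q.2.1‖⁻¹ • q.2.1)).hasFDerivAt.const_mul (-2 * Real.pi)
    rw [h1.fderiv]
    simp [coordDir, EuclideanSpace.inner_single_right]
  have hsum : ∀ q x, ∑ e, (fderiv ℝ (θ q) x (coordDir e)) ^ 2 = (2 * Real.pi) ^ 2 := by
    intro q x
    have h0 : ‖q.2.1‖ ≠ 0 := norm_ne_zero_iff.2 q.2.2
    simp only [hθd, mul_pow, ← Finset.mul_sum]
    have h1 := EuclideanSpace.real_norm_sq_eq q.2.1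
    rw [← h1, ← mul_pow ‖q.2.1‖⁻¹, inv_mul_cancel₀ h0]
    ring
  have hθ' : ∀ e, BddDeriv coordDir Set.univ N
      (fun q x => fderiv ℝ (θ q) x (coordDir e)) := by
    intro e
    simp only [hθd]
    refine BddDeriv.const (C := 2 * Real.pi) fun q => ?_
    rw [norm_mul, norm_mul, norm_mul, norm_neg, norm_inv, norm_norm]
    have h0 : 0 < ‖q.2.1‖ := norm_pos_iff.2 q.2.2
    have h1 : ‖q.2.1‖⁻¹ * ‖q.2.1 e‖ ≤ 1 := by
      rw [← div_eq_inv_mul, div_le_one h0]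
      exact PiLp.norm_apply_le _ _
    have h2 : ‖(2 : ℝ)‖ * ‖Real.pi‖ = 2 * Real.pi := by
      rw [Real.norm_of_nonneg Real.pi_nonneg, Real.norm_of_nonneg zero_le_two]
    rw [h2]
    exact mul_le_of_le_one_right (by positivity) h1
  have hθ : ∀ q, ContDiff ℝ (N + 1 : ℕ) (θ q) := fun q =>
    contDiff_const.mul (innerSL ℝ (‖q.2.1‖⁻¹ • q.2.1)).contDiff
  obtain ⟨C, hC⟩ := exists_norm_integral_cexp_le volume (w := fun _ _ => ((2 * Real.pi) ^ 2)⁻¹)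
    hθ hθ' (BddDeriv.const (C := ((2 * Real.pi) ^ 2)⁻¹) (by
      intro i; rw [Real.norm_of_nonneg (by positivity)])) (hm.comp_param Prod.fst)
    (x₀ := fun _ => 0) (r := r) (fun q => hs q.1) (fun q x _ => by
      rw [hsum]; exact inv_mul_cancel₀ (by positivity))
  refine ⟨2 ^ N * max D |C|, fun i w => ?_⟩
  have hpos : 0 < (1 + ‖w‖) ^ N := by positivity
  rw [← div_eq_mul_inv, le_div_iff₀ hpos]
  -- Low frequencies use the trivial bound `D`; for the others `1 + ‖w‖ ≤ 2‖w‖`.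
  by_cases hw : ‖w‖ ≤ 1
  · rw [mul_comm]
    exact mul_le_mul (pow_le_pow_left₀ (by positivity) (by linarith) _)
      ((hD i w).trans (le_max_left _ _)) (norm_nonneg _) (by positivity)
  · have hw0 : 0 < ‖w‖ := by linarith
    have h1 := hC (i, ⟨w, norm_pos_iff.1 hw0⟩) ‖w‖ hw0
    have h2 : 𝓕 (m i) w = ∫ x, Complex.exp (Complex.I * (‖w‖ *
        θ (i, ⟨w, norm_pos_iff.1 hw0⟩) x : ℝ)) * m i x := by
      rw [Real.fourier_eq']
      congr 1; ext x
      simp only [θ, innerSL_apply_apply, real_inner_smul_left, smul_eq_mul, real_inner_comm x w]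
      rw [mul_comm Complex.I]
      congr 4
      field_simp
    rw [← h2] at h1
    calc ‖𝓕 (m i) w‖ * (1 + ‖w‖) ^ N
        ≤ (|C| * (‖w‖ ^ N)⁻¹) * (2 * ‖w‖) ^ N := by
          refine mul_le_mul (h1.trans (mul_le_mul_of_nonneg_right (le_abs_self C)
            (by positivity))) (pow_le_pow_left₀ (by positivity) (by linarith) _) hpos.le
            (by positivity)
      _ = 2 ^ N * |C| := by
          rw [mul_pow]; field_simp
      _ ≤ _ := by gcongr; exact le_max_right _ _

/-- A cutoff on `ℝ²ⁿ` that equals one on the difference of unit cubes. -/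
noncomputable def pairBump (n : ℕ) : ContDiffBump (0 : EuclideanSpace ℝ (Fin n ⊕ Fin n)) where
  rIn := 2 * n + 1
  rOut := 2 * n + 2
  rIn_pos := by positivity
  rIn_lt_rOut := by linarith

/-- The amplitude near `p`, with the nonlinear remainder of the phase included. -/
noncomputable def localAmplitude
    (Φ : EuclideanSpace ℝ (Fin n) × EuclideanSpace ℝ (Fin n) → ℝ)
    (b : EuclideanSpace ℝ (Fin n) × EuclideanSpace ℝ (Fin n) → ℂ)
    (p : EuclideanSpace ℝ (Fin n) × EuclideanSpace ℝ (Fin n))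
    (x : EuclideanSpace ℝ (Fin n ⊕ Fin n)) : ℂ :=
  pairBump n x * (b (EuclideanSpace.sumEquivProd x + p) *
    Complex.exp (Complex.I * phaseRemainder Φ p x))

theorem tsupport_localAmplitude_subset
    (Φ : EuclideanSpace ℝ (Fin n) × EuclideanSpace ℝ (Fin n) → ℝ)
    (b : EuclideanSpace ℝ (Fin n) × EuclideanSpace ℝ (Fin n) → ℂ)
    (p : EuclideanSpace ℝ (Fin n) × EuclideanSpace ℝ (Fin n)) :
    tsupport (localAmplitude Φ b p) ⊆ Metric.closedBall 0 (2 * n + 2) := by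
  refine closure_minimal (fun x hx => ?_) Metric.isClosed_closedBall
  by_contra hx'
  refine hx ?_
  have : pairBump n x = 0 := by
    refine ContDiffBump.zero_of_le_dist _ ?_
    rw [Metric.mem_closedBall, not_le] at hx'
    exact hx'.le
  simp [localAmplitude, this]

/-- The remainder is controlled on balls only. The product is therefore estimated on the ball of
radius `2n + 3` and extended by zero, the cutoff being supported in radius `2n + 2`. -/
theorem BddDeriv.localAmplitude {N : ℕ} (hΦ : MixedBdd N Φ) (hb : BddDeriv pairDir Set.univ N b) :
    BddDeriv coordDir Set.univ N
      (fun (q : ι × EuclideanSpace ℝ (Fin n) × EuclideanSpace ℝ (Fin n)) =>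
        localAmplitude (Φ q.1) (b q.1) q.2) := by
  have hU : IsOpen (Metric.ball (0 : EuclideanSpace ℝ (Fin n ⊕ Fin n)) (2 * n + 3)) :=
    Metric.isOpen_ball
  have h1 : BddDeriv coordDir (Metric.ball 0 (2 * n + 3)) N
      (fun (q : ι × EuclideanSpace ℝ (Fin n) × EuclideanSpace ℝ (Fin n)) x =>
        ((pairBump n x : ℝ) : ℂ)) := by
    have h := (BddDeriv.bump (ι := ι × EuclideanSpace ℝ (Fin n) × EuclideanSpace ℝ (Fin n))
      coordDir (pairBump n) (fun _ => 0) N).ofReal isOpen_univ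
    simp only [sub_zero] at h
    exact h.mono_set (Set.subset_univ _)
  have h2 : BddDeriv coordDir (Metric.ball 0 (2 * n + 3)) N
      (fun (q : ι × EuclideanSpace ℝ (Fin n) × EuclideanSpace ℝ (Fin n)) x =>
        b q.1 (EuclideanSpace.sumEquivProd x + q.2)) :=
    hb.comp_affine isOpen_univ hU
      (EuclideanSpace.sumEquivProd (𝕜 := ℝ) (ι := Fin n) (κ := Fin n)).toContinuousLinearMap
      (fun q => q.2) Prod.fst id sumEquivProd_coordDir (fun _ _ _ => trivial)
  have hRc : ∀ q : ι × EuclideanSpace ℝ (Fin n) × EuclideanSpace ℝ (Fin n),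
      ContDiff ℝ (N + 2 : ℕ) (_root_.phaseRemainder (Φ q.1) q.2) := fun q => by
    have hQ := (EuclideanSpace.sumEquivProd (𝕜 := ℝ) (ι := Fin n) (κ := Fin n)).contDiff
      (n := (N + 2 : ℕ))
    have hc := hΦ.1 q.1
    exact ((hc.comp (hQ.add contDiff_const)).sub
      (hc.comp ((hQ.fst.add contDiff_const).prodMk contDiff_const))).sub
      ((hc.comp (contDiff_const.prodMk (hQ.snd.add contDiff_const))).sub contDiff_const)
  have h3 : BddDeriv coordDir (Metric.ball 0 (2 * n + 3)) N
      (fun (q : ι × EuclideanSpace ℝ (Fin n) × EuclideanSpace ℝ (Fin n)) x =>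
        Complex.exp (Complex.I * _root_.phaseRemainder (Φ q.1) q.2 x)) := by
    refine BddDeriv.exp hU (fun q => ?_) (fun e => ?_) (C := 0) (fun q x _ => by simp)
    · exact (contDiff_const.mul (Complex.ofRealCLM.contDiff.comp ((hRc q).of_le
        (by norm_cast; omega)))).contDiffOn
    · have h4 := ((BddDeriv.phaseRemainder hΦ (2 * n + 3) e).ofReal hU).const_mul hU
        (c := fun _ => Complex.I) (C := 1) (by simp)
      refine (h4.mono (Nat.sub_le N 1)).congr hU fun q x _ => ?_
      have h5 : HasFDerivAt (_root_.phaseRemainder (Φ q.1) q.2) _ x :=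
        ((hRc q).differentiable (by norm_cast) x).hasFDerivAt
      have h6 := ((Complex.ofRealCLM.hasFDerivAt.comp x h5).const_mul Complex.I).fderiv
      simp only [Function.comp_def, Complex.ofRealCLM_apply] at h6
      rw [h6]
      simp
  refine (h1.mul hU (h2.mul hU h3)).of_eq_zero (W := (Metric.closedBall 0 (2 * n + 2))ᶜ) hU
    Metric.isClosed_closedBall.isOpen_compl (fun q x hx => ?_) fun x => ?_
  · by_contra h
    exact hx (tsupport_localAmplitude_subset (Φ q.1) (b q.1) q.2 (subset_tsupport _ h))
  · rw [mem_ball_zero_iff, Set.mem_compl_iff, mem_closedBall_zero_iff, not_le]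
    rcases lt_or_ge ‖x‖ (2 * n + 3) with h | h
    · exact Or.inl h
    · exact Or.inr (by linarith)

/-- This is `Φ(y,η) = Φ(y,k) + Φ(j,η) - Φ(j,k) + r` in exponential form. The cutoff equals 1 because
`y - j` and `η - k` have norm at most `n`. -/
theorem cexp_mul_eq_localAmplitude
    (Φ : EuclideanSpace ℝ (Fin n) × EuclideanSpace ℝ (Fin n) → ℝ)
    (b : EuclideanSpace ℝ (Fin n) × EuclideanSpace ℝ (Fin n) → ℂ) {j k : Fin n → ℤ}
    {y η : EuclideanSpace ℝ (Fin n)} (hy : y ∈ unitBox j) (hη : η ∈ unitBox k) :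
    Complex.exp (Complex.I * Φ (y, η)) * b (y, η) =
      Complex.exp (Complex.I * Φ (y, latticePt k)) *
        (Complex.exp (-(Complex.I * Φ (latticePt j, latticePt k))) *
          Complex.exp (Complex.I * Φ (latticePt j, η))) *
        localAmplitude Φ b (latticePt j, latticePt k)
          (EuclideanSpace.sumEquivProd.symm (y - latticePt j, η - latticePt k)) := by
  have h1 : pairBump n (EuclideanSpace.sumEquivProd.symm (y - latticePt j, η - latticePt k)) =
      1 := by
    refine ContDiffBump.one_of_mem_closedBall _ ?_
    rw [mem_closedBall_zero_iff]
    refine (norm_sumEquivProd_symm_le _ _).trans ?_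
    have := norm_sub_latticePt_le hy
    have := norm_sub_latticePt_le hη
    simp only [pairBump]
    linarith
  simp only [localAmplitude, phaseRemainder, h1, ContinuousLinearEquiv.apply_symm_apply,
    Prod.mk_add_mk, sub_add_cancel, Complex.ofReal_one, one_mul]
  rw [mul_left_comm, mul_comm _ (b (y, η)), ← Complex.exp_add, ← Complex.exp_add,
    ← Complex.exp_add]
  congr 2
  push_cast
  ring

end

/-! ### Separation of variables and the estimate on finitely many cubes. -/

section
open scoped FourierTransform

variable {ι : Type*} {n : ℕ}

/-- The character `e^{2πi⟨w, z⟩}` of `ℝⁿ × ℝⁿ`. -/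
noncomputable def pairChar (w : EuclideanSpace ℝ (Fin n ⊕ Fin n))
    (z : EuclideanSpace ℝ (Fin n) × EuclideanSpace ℝ (Fin n)) : ℂ :=
  Complex.exp ((2 * Real.pi * inner ℝ w ((EuclideanSpace.sumEquivProd (𝕜 := ℝ)).symm z) : ℝ) *
    Complex.I)

theorem norm_pairChar (w : EuclideanSpace ℝ (Fin n ⊕ Fin n))
    (z : EuclideanSpace ℝ (Fin n) × EuclideanSpace ℝ (Fin n)) : ‖pairChar w z‖ = 1 :=
  Complex.norm_exp_ofReal_mul_I _

theorem pairChar_add (w : EuclideanSpace ℝ (Fin n ⊕ Fin n))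
    (z z' : EuclideanSpace ℝ (Fin n) × EuclideanSpace ℝ (Fin n)) :
    pairChar w (z + z') = pairChar w z * pairChar w z' := by
  rw [pairChar, pairChar, pairChar, ← Complex.exp_add, map_add, inner_add_right]
  congr 1
  push_cast
  ring

theorem continuous_pairChar {X : Type*} [TopologicalSpace X]
    {f : X → EuclideanSpace ℝ (Fin n ⊕ Fin n)}
    {g : X → EuclideanSpace ℝ (Fin n) × EuclideanSpace ℝ (Fin n)}
    (hf : Continuous f) (hg : Continuous g) : Continuous fun x => pairChar (f x) (g x) := by
  have h1 : Continuous fun x => (EuclideanSpace.sumEquivProd (𝕜 := ℝ)).symm (g x) :=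
    (EuclideanSpace.sumEquivProd (𝕜 := ℝ)).symm.continuous.comp hg
  have h2 : Continuous fun x => (inner ℝ (f x)
    ((EuclideanSpace.sumEquivProd (𝕜 := ℝ)).symm (g x)) : ℝ) := hf.inner h1
  exact Complex.continuous_exp.comp ((Complex.continuous_ofReal.comp
    (continuous_const.mul h2)).mul continuous_const)

theorem Continuous.cexp_phase {X : Type*} [TopologicalSpace X]
    {Φ : EuclideanSpace ℝ (Fin n) × EuclideanSpace ℝ (Fin n) → ℝ} (hΦ : Continuous Φ)
    {g : X → EuclideanSpace ℝ (Fin n) × EuclideanSpace ℝ (Fin n)} (hg : Continuous g) :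
    Continuous fun x => Complex.exp (Complex.I * Φ (g x)) :=
  Complex.continuous_exp.comp
    (continuous_const.mul (Complex.continuous_ofReal.comp (hΦ.comp hg)))

/-- The part of the operator acting on functions on the unit cube at `k`, after the amplitude has
been expanded into characters. -/
noncomputable def localTransform
    (Φ : EuclideanSpace ℝ (Fin n) × EuclideanSpace ℝ (Fin n) → ℝ)
    (v : EuclideanSpace ℝ (Fin n) → ℂ) (j k : Fin n → ℤ)
    (w : EuclideanSpace ℝ (Fin n ⊕ Fin n)) : ℂ :=
  ∫ η in unitBox k, v η * pairChar w (0, η - latticePt k) *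
    Complex.exp (Complex.I * Φ (latticePt j, η))

variable {Φ : EuclideanSpace ℝ (Fin n) × EuclideanSpace ℝ (Fin n) → ℝ}
  {b : EuclideanSpace ℝ (Fin n) × EuclideanSpace ℝ (Fin n) → ℂ}
  {v : EuclideanSpace ℝ (Fin n) → ℂ}

theorem norm_cexp_I_mul (s : ℝ) : ‖Complex.exp (Complex.I * s)‖ = 1 := by
  rw [mul_comm]; exact Complex.norm_exp_ofReal_mul_I _

/-- Fourier inversion writes the local amplitude as a superposition of characters, each the product
of a function of `y` and a function of `η`. After Fubini, the `η`-integral for given `w` no longer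
involves `y`. -/
theorem integral_unitBox_eq (hΦ : Continuous Φ) (hv : Continuous v) {j k : Fin n → ℤ}
    (hm : Continuous (localAmplitude Φ b (latticePt j, latticePt k)))
    (hmi : Integrable (𝓕 (localAmplitude Φ b (latticePt j, latticePt k))))
    {y : EuclideanSpace ℝ (Fin n)} (hy : y ∈ unitBox j) :
    ∫ η in unitBox k, Complex.exp (Complex.I * Φ (y, η)) * b (y, η) * v η =
      ∫ w, pairChar w (y - latticePt j, 0) *
        ((Complex.exp (-(Complex.I * Φ (latticePt j, latticePt k))) *
          𝓕 (localAmplitude Φ b (latticePt j, latticePt k)) w * localTransform Φ v j k w) *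
          Complex.exp (Complex.I * Φ (y, latticePt k))) := by
  set m := localAmplitude Φ b (latticePt j, latticePt k) with hmdef
  set A : ℂ := Complex.exp (Complex.I * Φ (y, latticePt k)) *
    Complex.exp (-(Complex.I * Φ (latticePt j, latticePt k))) with hA
  have hms : HasCompactSupport m :=
    (isCompact_closedBall _ _).of_isClosed_subset (isClosed_tsupport _)
      (tsupport_localAmplitude_subset Φ b _)
  have hinv := hm.fourierInv_fourier_eq (hm.integrable_of_hasCompactSupport hms) hmi
  have hinv' : ∀ z, m (EuclideanSpace.sumEquivProd.symm z) = ∫ w, pairChar w z * 𝓕 m w := by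
    intro z
    conv_lhs => rw [← hinv]
    rw [Real.fourierInv_eq']
    rfl
  have hG : Integrable (Function.uncurry fun η w =>
      A * (v η * 𝓕 m w * (pairChar w (y - latticePt j, η - latticePt k) *
        Complex.exp (Complex.I * Φ (latticePt j, η)))))
      ((volume.restrict (unitBox k)).prod volume) := by
    refine Integrable.const_mul ?_ A
    refine Integrable.mul_bdd (c := 1) ((integrableOn_unitBox hv k).mul_prod hmi) ?_ ?_
    · refine Continuous.aestronglyMeasurable (Continuous.mul ?_ ?_)
      · exact continuous_pairChar continuous_snd
          (continuous_const.prodMk (continuous_fst.sub continuous_const))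
      · exact hΦ.cexp_phase (continuous_const.prodMk continuous_fst)
    · refine Filter.Eventually.of_forall fun z => ?_
      rw [norm_mul, norm_pairChar, norm_cexp_I_mul, one_mul]
  calc _ = ∫ η in unitBox k, ∫ w, A * (v η * 𝓕 m w *
        (pairChar w (y - latticePt j, η - latticePt k) *
          Complex.exp (Complex.I * Φ (latticePt j, η)))) := by
        refine setIntegral_congr_fun (measurableSet_unitBox k) fun η hη => ?_
        beta_reduce
        rw [cexp_mul_eq_localAmplitude Φ b hy hη, ← hmdef, hinv', ← integral_const_mul,
          ← integral_mul_const]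
        congr 1; ext w
        rw [hA]; ring
    _ = ∫ w, ∫ η in unitBox k, A * (v η * 𝓕 m w *
        (pairChar w (y - latticePt j, η - latticePt k) *
          Complex.exp (Complex.I * Φ (latticePt j, η)))) := integral_integral_swap hG
    _ = _ := by
        congr 1; ext w
        have h1 : ∀ η, A * (v η * 𝓕 m w * (pairChar w (y - latticePt j, η - latticePt k) *
          Complex.exp (Complex.I * Φ (latticePt j, η)))) =
          (A * 𝓕 m w * pairChar w (y - latticePt j, 0)) *
            (v η * pairChar w (0, η - latticePt k) *
              Complex.exp (Complex.I * Φ (latticePt j, η))) := fun η => by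
          have h2 : ((y - latticePt j, η - latticePt k) : EuclideanSpace ℝ (Fin n) × _) =
            (y - latticePt j, 0) + (0, η - latticePt k) := by simp
          rw [h2, pairChar_add]; ring
        simp only [h1]
        rw [integral_const_mul, localTransform, hA]
        ring

theorem measurable_localTransform (hΦ : Continuous Φ) (hv : Continuous v) (j k : Fin n → ℤ) :
    Measurable (localTransform Φ v j k) := by
  refine (StronglyMeasurable.integral_prod_right
    (f := fun w η => v η * pairChar w (0, η - latticePt k) *
      Complex.exp (Complex.I * Φ (latticePt j, η))) ?_).measurable
  refine Continuous.stronglyMeasurable (Continuous.mul (Continuous.mul ?_ ?_) ?_)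
  · exact hv.comp continuous_snd
  · exact continuous_pairChar continuous_fst
      (continuous_const.prodMk (continuous_snd.sub continuous_const))
  · exact hΦ.cexp_phase (continuous_const.prodMk continuous_snd)

/-- The integrable weight that dominates the Fourier transforms of the amplitudes. -/
noncomputable def decayWeight (w : EuclideanSpace ℝ (Fin n ⊕ Fin n)) : ℝ :=
  ((1 + ‖w‖) ^ (2 * n + 1))⁻¹

theorem decayWeight_pos (w : EuclideanSpace ℝ (Fin n ⊕ Fin n)) : 0 < decayWeight w := by
  unfold decayWeight; positivity

theorem continuous_decayWeight : Continuous (decayWeight (n := n)) := by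
  unfold decayWeight
  exact Continuous.inv₀ (by fun_prop) fun w => by positivity

/-- The exponent `2n + 1` exceeds the dimension `2n`; this dictates the `2n + 1` bounded derivatives
asked of the amplitude. -/
theorem integrable_decayWeight : Integrable (decayWeight (n := n)) := by
  have h := integrable_one_add_norm (E := EuclideanSpace ℝ (Fin n ⊕ Fin n)) (μ := volume)
    (r := (2 * n + 1 : ℕ)) (by
      rw [finrank_euclideanSpace, Fintype.card_sum, Fintype.card_fin]; norm_cast; omega)
  refine h.congr (Filter.Eventually.of_forall fun w => ?_)
  simp only [decayWeight]
  rw [Real.rpow_neg (by positivity), Real.rpow_natCast]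

end

section
open scoped FourierTransform

variable {ι : Type*} {n : ℕ}
  {Φ : ι → EuclideanSpace ℝ (Fin n) × EuclideanSpace ℝ (Fin n) → ℝ}
  {b : ι → EuclideanSpace ℝ (Fin n) × EuclideanSpace ℝ (Fin n) → ℂ}

theorem BddDeriv.localAmplitude_continuous {N : ℕ} (hΦ : MixedBdd N Φ)
    (hb : BddDeriv pairDir Set.univ N b) (i : ι)
    (p : EuclideanSpace ℝ (Fin n) × EuclideanSpace ℝ (Fin n)) :
    Continuous (_root_.localAmplitude (Φ i) (b i) p) :=
  ((BddDeriv.localAmplitude hΦ hb).contDiff (i, p)).continuous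

theorem continuous_fourier_of_integrable {κ : Type*} [Fintype κ] {f : EuclideanSpace ℝ κ → ℂ}
    (hf : Integrable f) : Continuous (𝓕 f) :=
  VectorFourier.fourierIntegral_continuous Real.continuous_fourierChar
    (by exact continuous_inner) hf

theorem integrable_localAmplitude {N : ℕ} (hΦ : MixedBdd N Φ)
    (hb : BddDeriv pairDir Set.univ N b) (i : ι)
    (p : EuclideanSpace ℝ (Fin n) × EuclideanSpace ℝ (Fin n)) :
    Integrable (localAmplitude (Φ i) (b i) p) :=
  (BddDeriv.localAmplitude_continuous hΦ hb i p).integrable_of_hasCompactSupport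
    ((isCompact_closedBall _ _).of_isClosed_subset (isClosed_tsupport _)
      (tsupport_localAmplitude_subset (Φ i) (b i) p))

/-- The `L²` estimate on one unit cube in `y`. -/
theorem exists_lintegral_unitBox_le (hΦ : MixedBdd (2 * n + 1) Φ)
    (hb : BddDeriv pairDir Set.univ (2 * n + 1) b) {c : ℝ} (hc : 0 < c) :
    ∃ C : ℝ≥0, ∀ i (j : Fin n → ℤ) (K : Finset (Fin n → ℤ)),
      (∀ y, ∀ k ∈ K, ∀ l ∈ K, FstSeparated (Φ i) c y (latticePt k) (latticePt l)) →
      ∀ v : EuclideanSpace ℝ (Fin n) → ℂ, Continuous v →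
      ∫⁻ y in unitBox j, ‖∑ k ∈ K, ∫ η in unitBox k,
        Complex.exp (Complex.I * Φ i (y, η)) * b i (y, η) * v η‖ₑ ^ 2 ≤
        C * ∫⁻ w, ENNReal.ofReal (decayWeight w) *
          ∑ k ∈ K, ‖localTransform (Φ i) v j k w‖ₑ ^ 2 := by
  have hΦ' : MixedBdd (2 * n) Φ :=
    ⟨fun i => (hΦ.1 i).of_le (by norm_cast; omega), fun j l => (hΦ.2 j l).of_succ⟩
  obtain ⟨C₁, hC₁⟩ := exists_bessel hΦ' hc
  obtain ⟨C₂, hC₂⟩ := exists_norm_fourier_le (BddDeriv.localAmplitude hΦ hb)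
    (r := 2 * n + 2) (fun q => tsupport_localAmplitude_subset _ _ _)
  set Γ : ENNReal := ∫⁻ w, ENNReal.ofReal (decayWeight (n := n) w) with hΓ
  have hΓt : Γ ≠ ⊤ := (integrable_decayWeight (n := n)).lintegral_lt_top.ne
  refine ⟨Γ.toNNReal * (C₁ * (Real.toNNReal |C₂|) ^ 2), fun i j K hsep v hv => ?_⟩
  have hc1 := (hΦ.1 i).continuous
  have hdec : ∀ k w, ‖𝓕 (localAmplitude (Φ i) (b i) (latticePt j, latticePt k)) w‖ ≤
      |C₂| * decayWeight w := fun k w =>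
    (hC₂ (i, latticePt j, latticePt k) w).trans
      (mul_le_mul_of_nonneg_right (le_abs_self _) (decayWeight_pos w).le)
  have hFc : ∀ k, Continuous (𝓕 (localAmplitude (Φ i) (b i) (latticePt j, latticePt k))) :=
    fun k => continuous_fourier_of_integrable (integrable_localAmplitude hΦ hb i _)
  have hFi : ∀ k, Integrable (𝓕 (localAmplitude (Φ i) (b i) (latticePt j, latticePt k))) :=
    fun k => (integrable_decayWeight.const_mul |C₂|).mono' (hFc k).aestronglyMeasurable
      (Filter.Eventually.of_forall (hdec k))
  set a : (Fin n → ℤ) → EuclideanSpace ℝ (Fin n ⊕ Fin n) → ℂ := fun k w =>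
    Complex.exp (-(Complex.I * Φ i (latticePt j, latticePt k))) *
      𝓕 (localAmplitude (Φ i) (b i) (latticePt j, latticePt k)) w *
        localTransform (Φ i) v j k w with ha
  have ham : ∀ k, Measurable (a k) := fun k =>
    (measurable_const.mul (hFc k).measurable).mul (measurable_localTransform hc1 hv j k)
  have hae : ∀ k w, ‖a k w‖ₑ ≤ ENNReal.ofReal (|C₂| * decayWeight w) *
      ‖localTransform (Φ i) v j k w‖ₑ := by
    intro k w
    have h1 : ‖Complex.exp (-(Complex.I * Φ i (latticePt j, latticePt k)))‖ₑ = 1 := by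
      rw [← ofReal_norm, ← mul_neg, ← Complex.ofReal_neg, norm_cexp_I_mul, ENNReal.ofReal_one]
    simp only [ha, enorm_mul, h1, one_mul]
    gcongr
    rw [← ofReal_norm]
    exact ENNReal.ofReal_le_ofReal (hdec k w)
  set F : EuclideanSpace ℝ (Fin n) → EuclideanSpace ℝ (Fin n ⊕ Fin n) → ℂ := fun y w =>
    ∑ k ∈ K, a k w * Complex.exp (Complex.I * Φ i (y, latticePt k)) with hF
  have hFm : Measurable (Function.uncurry F) := by
    refine Finset.measurable_fun_sum _ fun k _ => ((ham k).comp measurable_snd).mul ?_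
    exact (hc1.cexp_phase (continuous_fst.prodMk continuous_const)).measurable
  have hpt : ∀ y ∈ unitBox j, ‖∑ k ∈ K, ∫ η in unitBox k,
        Complex.exp (Complex.I * Φ i (y, η)) * b i (y, η) * v η‖ₑ ^ 2 ≤
      Γ * ∫⁻ w, ENNReal.ofReal (decayWeight w)⁻¹ * ‖F y w‖ₑ ^ 2 := by
    intro y hy
    have hb0 : ∀ k, ∃ M, ∀ w, ‖localTransform (Φ i) v j k w‖ ≤ M := fun k => by
      refine ⟨∫ η in unitBox k, ‖v η‖, fun w => ?_⟩
      refine (norm_integral_le_integral_norm _).trans_eq ?_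
      congr 1; ext η
      rw [norm_mul, norm_mul, norm_pairChar, norm_cexp_I_mul, mul_one, mul_one]
    have hint : ∀ k, Integrable fun w => pairChar w (y - latticePt j, 0) *
        (a k w * Complex.exp (Complex.I * Φ i (y, latticePt k))) := by
      intro k
      obtain ⟨M, hM⟩ := hb0 k
      have h1 : Integrable (a k) :=
        ((hFi k).const_mul _).mul_bdd (c := M)
          (measurable_localTransform hc1 hv j k).aestronglyMeasurable
          (Filter.Eventually.of_forall hM)
      refine (h1.mul_const _).bdd_mul (c := 1) ?_ (Filter.Eventually.of_forall fun w => ?_)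
      · exact (continuous_pairChar continuous_id continuous_const).aestronglyMeasurable
      · rw [norm_pairChar]
    have h2 : ∑ k ∈ K, ∫ η in unitBox k,
        Complex.exp (Complex.I * Φ i (y, η)) * b i (y, η) * v η =
        ∫ w, pairChar w (y - latticePt j, 0) * F y w := by
      have h3 : ∀ k ∈ K, ∫ η in unitBox k,
          Complex.exp (Complex.I * Φ i (y, η)) * b i (y, η) * v η = _ := fun k _ =>
        integral_unitBox_eq hc1 hv (BddDeriv.localAmplitude_continuous hΦ hb i _) (hFi k) hy
      rw [Finset.sum_congr rfl h3, ← integral_finsetSum K fun k _ => hint k]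
      congr 1; ext w
      rw [hF, Finset.mul_sum]
    rw [h2]
    -- Cauchy–Schwarz in `w`, with the weight and its inverse. The character in `y` is the same for
    -- all `k`, so it stands outside the sum and drops out in modulus.
    calc ‖∫ w, pairChar w (y - latticePt j, 0) * F y w‖ₑ ^ 2
        ≤ (∫⁻ w, ENNReal.ofReal (√(decayWeight w)) *
          (ENNReal.ofReal (√(decayWeight w))⁻¹ * ‖F y w‖ₑ)) ^ 2 := by
          gcongr
          refine (enorm_integral_le_lintegral_enorm _).trans (lintegral_mono fun w => ?_)
          have h4 : ‖pairChar w (y - latticePt j, 0)‖ₑ = 1 := by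
            rw [← ofReal_norm, norm_pairChar, ENNReal.ofReal_one]
          have h5 : 0 < √(decayWeight w) := Real.sqrt_pos.2 (decayWeight_pos w)
          rw [enorm_mul, h4, one_mul, ← mul_assoc, ← ENNReal.ofReal_mul h5.le,
            mul_inv_cancel₀ h5.ne', ENNReal.ofReal_one, one_mul]
      _ ≤ (∫⁻ w, ENNReal.ofReal (√(decayWeight w)) ^ 2) *
          ∫⁻ w, (ENNReal.ofReal (√(decayWeight w))⁻¹ * ‖F y w‖ₑ) ^ 2 := by
          refine lintegral_mul_sq_le ?_ ?_
          · exact (ENNReal.measurable_ofReal.comp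
              continuous_decayWeight.measurable.sqrt).aemeasurable
          · exact ((ENNReal.measurable_ofReal.comp continuous_decayWeight.measurable.sqrt.inv).mul
              (hFm.of_uncurry_left.enorm)).aemeasurable
      _ = _ := by
          congr 1
          · refine lintegral_congr fun w => ?_
            rw [← ENNReal.ofReal_pow (Real.sqrt_nonneg _), Real.sq_sqrt (decayWeight_pos w).le]
          · refine lintegral_congr fun w => ?_
            rw [mul_pow, ← ENNReal.ofReal_pow (by positivity), inv_pow,
              Real.sq_sqrt (decayWeight_pos w).le]
  have hwm : Measurable fun w : EuclideanSpace ℝ (Fin n ⊕ Fin n) =>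
      ENNReal.ofReal (decayWeight w)⁻¹ :=
    ENNReal.measurable_ofReal.comp continuous_decayWeight.measurable.inv
  calc _ ≤ ∫⁻ y in unitBox j, Γ * ∫⁻ w, ENNReal.ofReal (decayWeight w)⁻¹ * ‖F y w‖ₑ ^ 2 :=
        setLIntegral_mono' (measurableSet_unitBox j) hpt
    _ = Γ * ∫⁻ y in unitBox j, ∫⁻ w, ENNReal.ofReal (decayWeight w)⁻¹ * ‖F y w‖ₑ ^ 2 :=
        lintegral_const_mul' _ _ hΓt
    _ = Γ * ∫⁻ w, ∫⁻ y in unitBox j, ENNReal.ofReal (decayWeight w)⁻¹ * ‖F y w‖ₑ ^ 2 := by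
        rw [lintegral_lintegral_swap]
        exact ((hwm.comp measurable_snd).mul (hFm.enorm.pow_const 2)).aemeasurable
    _ ≤ Γ * ∫⁻ w, ((C₁ * (Real.toNNReal |C₂|) ^ 2 : ℝ≥0) : ENNReal) *
          (ENNReal.ofReal (decayWeight w) *
            ∑ k ∈ K, ‖localTransform (Φ i) v j k w‖ₑ ^ 2) := by
        gcongr with w
        rw [lintegral_const_mul' _ _ ENNReal.ofReal_ne_top]
        -- At fixed `w` Bessel's inequality applies to the coefficients `a k w`. Their squares carry
        -- two powers of the weight, one of which cancels the inverse weight.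
        calc _ ≤ ENNReal.ofReal (decayWeight w)⁻¹ * (C₁ * ∑ k ∈ K, ‖a k w‖ₑ ^ 2) := by
              gcongr
              exact hC₁ i j K (fun y _ => hsep y) fun k => a k w
          _ ≤ ENNReal.ofReal (decayWeight w)⁻¹ * (C₁ * ∑ k ∈ K,
              (ENNReal.ofReal (|C₂| * decayWeight w) *
                ‖localTransform (Φ i) v j k w‖ₑ) ^ 2) := by
              gcongr with k hk
              exact hae k w
          _ = _ := by
              have hw := decayWeight_pos w
              simp only [mul_pow, ← Finset.mul_sum]
              rw [ENNReal.ofReal_mul (abs_nonneg _), ENNReal.coe_mul, ENNReal.coe_pow,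
                ← ENNReal.ofReal.eq_1]
              have h1 : ENNReal.ofReal (decayWeight w)⁻¹ * ENNReal.ofReal (decayWeight w) = 1 := by
                rw [← ENNReal.ofReal_mul (by positivity), inv_mul_cancel₀ hw.ne',
                  ENNReal.ofReal_one]
              calc _ = (ENNReal.ofReal (decayWeight w)⁻¹ * ENNReal.ofReal (decayWeight w)) *
                    (C₁ * ENNReal.ofReal |C₂| ^ 2 * (ENNReal.ofReal (decayWeight w) *
                      ∑ k ∈ K, ‖localTransform (Φ i) v j k w‖ₑ ^ 2)) := by ring
                _ = _ := by rw [h1, one_mul]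
    _ = _ := by
        rw [lintegral_const_mul' _ _ ENNReal.coe_ne_top, ← mul_assoc, ENNReal.coe_mul (Γ.toNNReal),
          ENNReal.coe_toNNReal hΓt]

/-- The `L²` estimate on finitely many unit cubes in both variables. -/
theorem exists_sum_lintegral_unitBox_le (hΦ : MixedBdd (2 * n + 1) Φ)
    (hb : BddDeriv pairDir Set.univ (2 * n + 1) b) {c : ℝ} (hc : 0 < c) :
    ∃ C : ℝ≥0, ∀ i (K : Finset (Fin n → ℤ)),
      (∀ y, ∀ k ∈ K, ∀ l ∈ K, FstSeparated (Φ i) c y (latticePt k) (latticePt l)) →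
      (∀ k ∈ K, ∀ η, ‖η - latticePt k‖ ≤ n + 3 → ∀ y y',
        FstSeparated (fun z => Φ i z.swap) c η y y') →
      ∀ (J : Finset (Fin n → ℤ)) (v : EuclideanSpace ℝ (Fin n) → ℂ), Continuous v →
      ∑ j ∈ J, ∫⁻ y in unitBox j, ‖∑ k ∈ K, ∫ η in unitBox k,
        Complex.exp (Complex.I * Φ i (y, η)) * b i (y, η) * v η‖ₑ ^ 2 ≤
        C * ∑ k ∈ K, ∫⁻ η in unitBox k, ‖v η‖ₑ ^ 2 := by
  have hΦ' : MixedBdd (2 * n) Φ :=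
    ⟨fun i => (hΦ.1 i).of_le (by norm_cast; omega), fun j l => (hΦ.2 j l).of_succ⟩
  obtain ⟨C₁, hC₁⟩ := exists_lintegral_unitBox_le hΦ hb hc
  obtain ⟨C₂, hC₂⟩ := exists_dual_bessel hΦ' hc
  set Γ : ENNReal := ∫⁻ w, ENNReal.ofReal (decayWeight (n := n) w) with hΓ
  have hΓt : Γ ≠ ⊤ := (integrable_decayWeight (n := n)).lintegral_lt_top.ne
  refine ⟨C₁ * Γ.toNNReal * C₂, fun i K hsep hsep' J v hv => ?_⟩
  have hc1 := (hΦ.1 i).continuous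
  have hwm : Measurable fun w : EuclideanSpace ℝ (Fin n ⊕ Fin n) =>
      ENNReal.ofReal (decayWeight w) :=
    ENNReal.measurable_ofReal.comp continuous_decayWeight.measurable
  -- The character in `η` has modulus one and is absorbed into `v`; the dual Bessel inequality then
  -- sums over `j` for each `k`, uniformly in `w`.
  have hdual : ∀ w, ∑ j ∈ J, ∑ k ∈ K, ‖localTransform (Φ i) v j k w‖ₑ ^ 2 ≤
      C₂ * ∑ k ∈ K, ∫⁻ η in unitBox k, ‖v η‖ₑ ^ 2 := by
    intro w
    rw [Finset.sum_comm, Finset.mul_sum]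
    refine Finset.sum_le_sum fun k hk => ?_
    refine (hC₂ i k J (fun η hη j _ j' _ => hsep' k hk η hη _ _)
      (fun η => v η * pairChar w (0, η - latticePt k)) ?_).trans_eq ?_
    · exact hv.mul (continuous_pairChar continuous_const
        (continuous_const.prodMk (continuous_id.sub continuous_const)))
    · congr 1
      refine lintegral_congr fun η => ?_
      have h4 : ‖pairChar w (0, η - latticePt k)‖ₑ = 1 := by
        rw [← ofReal_norm, norm_pairChar, ENNReal.ofReal_one]
      rw [enorm_mul, h4, mul_one]
  calc _ ≤ ∑ j ∈ J, C₁ * ∫⁻ w, ENNReal.ofReal (decayWeight w) *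
          ∑ k ∈ K, ‖localTransform (Φ i) v j k w‖ₑ ^ 2 :=
        Finset.sum_le_sum fun j _ => hC₁ i j K hsep v hv
    _ = C₁ * ∫⁻ w, ENNReal.ofReal (decayWeight w) *
          ∑ j ∈ J, ∑ k ∈ K, ‖localTransform (Φ i) v j k w‖ₑ ^ 2 := by
        rw [← Finset.mul_sum, ← lintegral_finsetSum]
        · simp only [Finset.mul_sum]
        · exact fun j _ => hwm.mul (Finset.measurable_fun_sum _ fun k _ =>
            (measurable_localTransform hc1 hv j k).enorm.pow_const 2)
    _ ≤ C₁ * ∫⁻ w : EuclideanSpace ℝ (Fin n ⊕ Fin n), ENNReal.ofReal (decayWeight w) *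
          (C₂ * ∑ k ∈ K, ∫⁻ η in unitBox k, ‖v η‖ₑ ^ 2) := by
        gcongr with w
        exact hdual w
    _ = _ := by
        rw [lintegral_mul_const _ hwm, ENNReal.coe_mul, ENNReal.coe_mul, ENNReal.coe_toNNReal hΓt]
        ring

end

theorem enorm_sum_sq_le {α : Type*} (s : Finset α) (f : α → ℂ) :
    ‖∑ a ∈ s, f a‖ₑ ^ 2 ≤ s.card * ∑ a ∈ s, ‖f a‖ₑ ^ 2 := by
  have h1 : ‖∑ a ∈ s, f a‖ ^ 2 ≤ s.card * ∑ a ∈ s, ‖f a‖ ^ 2 :=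
    (pow_le_pow_left₀ (norm_nonneg _) (norm_sum_le _ _) 2).trans sq_sum_le_card_mul_sum_sq
  have h2 := ENNReal.ofReal_le_ofReal h1
  rw [ENNReal.ofReal_mul (by positivity), ENNReal.ofReal_sum_of_nonneg fun k _ => by positivity,
    ENNReal.ofReal_natCast, ENNReal.ofReal_pow (norm_nonneg _), ofReal_norm] at h2
  simpa only [ENNReal.ofReal_pow (norm_nonneg _), ofReal_norm] using h2

/-! ### Summation over all cubes. -/

section
variable {ι : Type*} {n : ℕ}
  {Φ : ι → EuclideanSpace ℝ (Fin n) × EuclideanSpace ℝ (Fin n) → ℝ}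
  {b : ι → EuclideanSpace ℝ (Fin n) × EuclideanSpace ℝ (Fin n) → ℂ}

theorem lintegral_eq_tsum_unitBox (f : EuclideanSpace ℝ (Fin n) → ENNReal) :
    ∫⁻ y, f y = ∑' j, ∫⁻ y in unitBox j, f y := by
  rw [← lintegral_iUnion measurableSet_unitBox pairwise_disjoint_unitBox, iUnion_unitBox,
    setLIntegral_univ]

theorem lintegral_le_of_forall_finset {f : EuclideanSpace ℝ (Fin n) → ENNReal} {B : ENNReal}
    (h : ∀ J : Finset (Fin n → ℤ), ∑ j ∈ J, ∫⁻ y in unitBox j, f y ≤ B) : ∫⁻ y, f y ≤ B := by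
  rw [lintegral_eq_tsum_unitBox, ENNReal.tsum_eq_iSup_sum]
  exact iSup_le h

/-- The `L²` estimate for oscillatory integral operators whose phase has nondegenerate mixed
derivatives, in terms of separation of the gradients of the phase. -/
theorem exists_lintegral_oscillatory_le (hΦ : MixedBdd (2 * n + 1) Φ)
    (hb : BddDeriv pairDir Set.univ (2 * n + 1) b) {c : ℝ} (hc : 0 < c) {γ : Type*} [Fintype γ]
    (cl : (Fin n → ℤ) → γ) (act : (Fin n → ℤ) → Prop)
    (h0 : ∀ i k, ¬act k → ∀ y, ∀ η ∈ unitBox k, b i (y, η) = 0)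
    (h1 : ∀ i y k l, act k → act l → cl k = cl l →
      FstSeparated (Φ i) c y (latticePt k) (latticePt l))
    (h2 : ∀ i k, act k → ∀ η, ‖η - latticePt k‖ ≤ n + 3 → ∀ y y',
      FstSeparated (fun z => Φ i z.swap) c η y y') :
    ∃ C : ℝ≥0, ∀ i (v : EuclideanSpace ℝ (Fin n) → ℂ), Continuous v → Integrable v →
      (∀ y, Integrable fun η => Complex.exp (Complex.I * Φ i (y, η)) * b i (y, η) * v η) ∧
      ∫⁻ y, ‖∫ η, Complex.exp (Complex.I * Φ i (y, η)) * b i (y, η) * v η‖ₑ ^ 2 ≤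
        C * ∫⁻ η, ‖v η‖ₑ ^ 2 := by
  classical
  set M := Fintype.card γ with hM
  obtain ⟨C, hC⟩ := exists_sum_lintegral_unitBox_le hΦ hb hc
  obtain ⟨B, hB⟩ := hb.bound
  refine ⟨M * C, fun i v hv hvi => ?_⟩
  have hbc : Continuous (b i) := (hb.contDiff i).continuous
  have hGc : Continuous fun p : EuclideanSpace ℝ (Fin n) × EuclideanSpace ℝ (Fin n) =>
      Complex.exp (Complex.I * Φ i (p.1, p.2)) * b i (p.1, p.2) * v p.2 :=
    (((hΦ.1 i).continuous.cexp_phase continuous_id).mul hbc).mul (hv.comp continuous_snd)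
  have hint : ∀ y, Integrable fun η =>
      Complex.exp (Complex.I * Φ i (y, η)) * b i (y, η) * v η := fun y => by
    refine hvi.bdd_mul (c := B) ?_ (Filter.Eventually.of_forall fun η => ?_)
    · exact (((hΦ.1 i).continuous.cexp_phase (continuous_const.prodMk continuous_id)).mul
        (hbc.comp (continuous_const.prodMk continuous_id))).aestronglyMeasurable
    · rw [norm_mul, norm_cexp_I_mul, one_mul]
      exact hB i _ trivial
  refine ⟨hint, ?_⟩
  set T : (Fin n → ℤ) → EuclideanSpace ℝ (Fin n) → ℂ := fun k y => ∫ η in unitBox k,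
    Complex.exp (Complex.I * Φ i (y, η)) * b i (y, η) * v η with hT
  have hTm : ∀ k, Measurable (T k) := fun k =>
    (StronglyMeasurable.integral_prod_right
      (f := fun y η => Complex.exp (Complex.I * Φ i (y, η)) * b i (y, η) * v η)
      hGc.stronglyMeasurable).measurable
  have hT0 : ∀ k, ¬act k → ∀ y, T k y = 0 := fun k hk y => by
    rw [hT]
    refine setIntegral_eq_zero_of_forall_eq_zero fun η hη => ?_
    rw [h0 i k hk y η hη]; simp
  have hfin : ∀ K : Finset (Fin n → ℤ), ∫⁻ y, ‖∑ k ∈ K, T k y‖ₑ ^ 2 ≤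
      (M * C : ℝ≥0) * ∫⁻ η, ‖v η‖ₑ ^ 2 := by
    intro K
    refine lintegral_le_of_forall_finset fun J => ?_
    -- Gradients are separated only within a class. Cauchy–Schwarz over the classes costs the factor
    -- `M`, their number.
    have hsplit : ∀ y, ∑ k ∈ K, T k y =
        ∑ m : γ, ∑ k ∈ (K.filter act).filter (fun k => cl k = m), T k y := fun y => by
      rw [Finset.sum_fiberwise (K.filter act) cl, Finset.sum_filter]
      refine Finset.sum_congr rfl fun k _ => ?_
      split_ifs with h
      · rfl
      · exact hT0 k h y
    have hclass : ∀ m : γ, ∑ j ∈ J, ∫⁻ y in unitBox j,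
        ‖∑ k ∈ (K.filter act).filter (fun k => cl k = m), T k y‖ₑ ^ 2 ≤
        C * ∑ k ∈ (K.filter act).filter (fun k => cl k = m), ∫⁻ η in unitBox k, ‖v η‖ₑ ^ 2 := by
      intro m
      refine hC i _ (fun y k hk l hl => ?_) (fun k hk => ?_) J v hv
      · simp only [Finset.mem_filter] at hk hl
        exact h1 i y k l hk.1.2 hl.1.2 (hk.2.trans hl.2.symm)
      · simp only [Finset.mem_filter] at hk
        exact h2 i k hk.1.2
    calc ∑ j ∈ J, ∫⁻ y in unitBox j, ‖∑ k ∈ K, T k y‖ₑ ^ 2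
        ≤ ∑ j ∈ J, ∫⁻ y in unitBox j, M * ∑ m : γ,
          ‖∑ k ∈ (K.filter act).filter (fun k => cl k = m), T k y‖ₑ ^ 2 := by
          refine Finset.sum_le_sum fun j _ => lintegral_mono fun y => ?_
          rw [hsplit]
          refine (enorm_sum_sq_le _ _).trans_eq ?_
          rw [Finset.card_univ]
      _ = M * ∑ m : γ, ∑ j ∈ J, ∫⁻ y in unitBox j,
          ‖∑ k ∈ (K.filter act).filter (fun k => cl k = m), T k y‖ₑ ^ 2 := by
          rw [Finset.sum_comm, Finset.mul_sum]
          refine Finset.sum_congr rfl fun j _ => ?_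
          rw [lintegral_const_mul' _ _ (ENNReal.natCast_ne_top M), lintegral_finsetSum]
          exact fun m _ => (Finset.measurable_fun_sum _ fun k _ => hTm k).enorm.pow_const 2
      _ ≤ M * ∑ m : γ, C * ∑ k ∈ (K.filter act).filter (fun k => cl k = m),
            ∫⁻ η in unitBox k, ‖v η‖ₑ ^ 2 := by
          gcongr with m
          exact hclass m
      _ = M * (C * ∑ k ∈ K.filter act, ∫⁻ η in unitBox k, ‖v η‖ₑ ^ 2) := by
          rw [← Finset.mul_sum, Finset.sum_fiberwise (K.filter act) cl]
      _ ≤ M * (C * ∫⁻ η, ‖v η‖ₑ ^ 2) := by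
          gcongr
          rw [lintegral_eq_tsum_unitBox]
          exact ENNReal.sum_le_tsum _
      _ = _ := by push_cast; ring
  -- The partial sums along a sequence of finite sets converge pointwise to the full integral, and
  -- Fatou's lemma preserves the bound.
  obtain ⟨K, hK⟩ := Filter.exists_seq_tendsto (Filter.atTop : Filter (Finset (Fin n → ℤ)))
  have hlim : ∀ y, Filter.Tendsto (fun m => ‖∑ k ∈ K m, T k y‖ₑ ^ 2) Filter.atTop
      (nhds (‖∫ η, Complex.exp (Complex.I * Φ i (y, η)) * b i (y, η) * v η‖ₑ ^ 2)) := fun y => by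
    have h3 := hasSum_integral_iUnion (measurableSet_unitBox (n := n)) pairwise_disjoint_unitBox
      (hint y).integrableOn
    rw [iUnion_unitBox, setIntegral_univ] at h3
    exact ((ENNReal.continuous_pow 2).tendsto _).comp
      ((continuous_enorm.tendsto _).comp (h3.comp hK))
  calc _ = ∫⁻ y, Filter.liminf (fun m => ‖∑ k ∈ K m, T k y‖ₑ ^ 2) Filter.atTop :=
        lintegral_congr fun y => (hlim y).liminf_eq.symm
    _ ≤ Filter.liminf (fun m => ∫⁻ y, ‖∑ k ∈ K m, T k y‖ₑ ^ 2) Filter.atTop :=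
        lintegral_liminf_le fun m =>
          (Finset.measurable_fun_sum _ fun k _ => hTm k).enorm.pow_const 2
    _ ≤ Filter.liminf (fun _ : ℕ => (M * C : ℝ≥0) * ∫⁻ η, ‖v η‖ₑ ^ 2) Filter.atTop :=
        Filter.liminf_le_liminf (Filter.Eventually.of_forall fun m => hfin (K m))
    _ = _ := Filter.liminf_const _

end

/-! ### Mixed partial derivatives as derivatives on `ℝⁿ × ℝⁿ`. -/

section
variable {V W F : Type*} [NormedAddCommGroup V] [NormedSpace ℝ V] [NormedAddCommGroup W]
  [NormedSpace ℝ W] [NormedAddCommGroup F] [NormedSpace ℝ F]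

theorem ContDiffOn.iteratedFDeriv_apply_const {U : Set V} (hU : IsOpen U) {f : V → F} {p m : ℕ}
    (hf : ContDiffOn ℝ (p + m : ℕ) f U) (v : Fin p → V) :
    ContDiffOn ℝ m (fun z => iteratedFDeriv ℝ p f z v) U := fun z hz => by
  have h : ContDiffAt ℝ m (iteratedFDeriv ℝ p f) z :=
    (hf.contDiffAt (hU.mem_nhds hz)).iteratedFDeriv_right (by norm_cast; omega)
  exact ((ContinuousMultilinearMap.apply ℝ (fun _ : Fin p => V) F v).contDiff.contDiffAt.comp z
    h).contDiffWithinAt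

theorem ContDiffAt.iteratedFDeriv_succ_apply {f : V → F} {x : V} {p : ℕ}
    (hf : ContDiffAt ℝ (p + 1 : ℕ) f x) (v : Fin (p + 1) → V) :
    iteratedFDeriv ℝ (p + 1) f x v
      = fderiv ℝ (fun y => iteratedFDeriv ℝ p f y (Fin.tail v)) x (v 0) :=
  DifferentiableAt.iteratedFDeriv_succ_apply_left'
    ((hf.iteratedFDeriv_right (m := 1) (by norm_cast; omega)).differentiableAt (by norm_num))

/-- Iterated derivatives along an affine slice. -/
theorem iteratedFDeriv_comp_slice {U : Set V} (hU : IsOpen U) {f : V → F} {p : ℕ}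
    (hf : ContDiffOn ℝ p f U) {L : W → V} {A : W →L[ℝ] V} (hLc : ContDiff ℝ ⊤ L)
    (hL : ∀ w, HasFDerivAt L A w) {w : W} (hw : L w ∈ U) (v : Fin p → W) :
    iteratedFDeriv ℝ p (fun w => f (L w)) w v = iteratedFDeriv ℝ p f (L w) (fun k => A (v k)) := by
  induction p generalizing w with
  | zero => simp
  | succ p ih =>
    have hfa := hf.contDiffAt (hU.mem_nhds hw)
    have hc : ContDiffAt ℝ (p + 1 : ℕ) (fun w => f (L w)) w :=
      hfa.comp w (hLc.contDiffAt.of_le le_top)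
    rw [hc.iteratedFDeriv_succ_apply, hfa.iteratedFDeriv_succ_apply]
    have hev : (fun w => iteratedFDeriv ℝ p (fun w => f (L w)) w (Fin.tail v)) =ᶠ[nhds w]
        fun w => iteratedFDeriv ℝ p f (L w) (fun k => A (Fin.tail v k)) :=
      Filter.eventually_of_mem (hLc.continuous.continuousAt.preimage_mem_nhds (hU.mem_nhds hw))
        fun w' hw' => ih (hf.of_le (by norm_cast; omega)) hw' _
    rw [hev.fderiv_eq]
    have hd := ((ContDiffOn.iteratedFDeriv_apply_const (m := 1) hU hf
      (fun k => A (Fin.tail v k))).contDiffAt (hU.mem_nhds hw)).differentiableAt (by norm_num)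
    have := (hd.hasFDerivAt.comp w (hL w)).fderiv
    simp only [Function.comp_def] at this
    rw [this]
    rfl

end

section
variable {n : ℕ} {F : Type*} [NormedAddCommGroup F] [NormedSpace ℝ F]
  {f : EuclideanSpace ℝ (Fin n) → EuclideanSpace ℝ (Fin n) → F}
  {O : Set (EuclideanSpace ℝ (Fin n))} {p q m : ℕ}

theorem iteratedFDeriv_snd_eq (hO : IsOpen O)
    (hf : ContDiffOn ℝ q (fun z : EuclideanSpace ℝ (Fin n) × EuclideanSpace ℝ (Fin n) => f z.1 z.2)
      {z | z.2 ∈ O}) {x ξ : EuclideanSpace ℝ (Fin n)} (hξ : ξ ∈ O) (J : Fin q → Fin n) :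
    iteratedFDeriv ℝ q (fun η => f x η) ξ (fun k => EuclideanSpace.single (J k) (1 : ℝ))
      = iteratedFDeriv ℝ q
          (fun z : EuclideanSpace ℝ (Fin n) × EuclideanSpace ℝ (Fin n) => f z.1 z.2) (x, ξ)
          (fun k => pairDir (.inr (J k))) :=
  iteratedFDeriv_comp_slice (hO.preimage continuous_snd) hf (L := fun η => (x, η))
    (A := ContinuousLinearMap.inr ℝ _ _) (contDiff_prodMk_right x)
    (fun w => hasFDerivAt_prodMk_right x w) hξ _

/-- Restriction to a slice is composition with an affine map. On the product all directional
derivatives live on the same function, and their order can be exchanged. -/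
theorem mixedPartial_eq (hO : IsOpen O)
    (hf : ContDiffOn ℝ (q + p : ℕ)
      (fun z : EuclideanSpace ℝ (Fin n) × EuclideanSpace ℝ (Fin n) => f z.1 z.2) {z | z.2 ∈ O})
    (I : Fin p → Fin n) (J : Fin q → Fin n)
    {z : EuclideanSpace ℝ (Fin n) × EuclideanSpace ℝ (Fin n)} (hz : z.2 ∈ O) :
    mixedPartial I J f z.1 z.2 = iteratedFDeriv ℝ p (fun z' => iteratedFDeriv ℝ q
        (fun z : EuclideanSpace ℝ (Fin n) × EuclideanSpace ℝ (Fin n) => f z.1 z.2) z'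
          (fun k => pairDir (.inr (J k)))) z (fun k => pairDir (.inl (I k))) := by
  unfold mixedPartial
  have hq : ContDiffOn ℝ q (fun z : EuclideanSpace ℝ (Fin n) × EuclideanSpace ℝ (Fin n) =>
      f z.1 z.2) {z | z.2 ∈ O} := hf.of_le (by norm_cast; omega)
  simp_rw [fun y => iteratedFDeriv_snd_eq hO hq (x := y) hz J]
  have hU : IsOpen {z : EuclideanSpace ℝ (Fin n) × EuclideanSpace ℝ (Fin n) | z.2 ∈ O} :=
    hO.preimage continuous_snd
  exact iteratedFDeriv_comp_slice hU
    (ContDiffOn.iteratedFDeriv_apply_const hU hf (fun k => pairDir (.inr (J k))))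
    (L := fun y => (y, z.2)) (A := ContinuousLinearMap.inl ℝ _ _)
    (contDiff_prodMk_left z.2) (fun w => hasFDerivAt_prodMk_left w z.2) hz _

theorem mixedPartial_congr (hO : IsOpen O)
    {g : EuclideanSpace ℝ (Fin n) → EuclideanSpace ℝ (Fin n) → F}
    (h : ∀ x, ∀ η ∈ O, f x η = g x η) (I : Fin p → Fin n) (J : Fin q → Fin n)
    (x : EuclideanSpace ℝ (Fin n)) {ξ : EuclideanSpace ℝ (Fin n)} (hξ : ξ ∈ O) :
    mixedPartial I J f x ξ = mixedPartial I J g x ξ := by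
  have : ∀ y, iteratedFDeriv ℝ q (f y) ξ = iteratedFDeriv ℝ q (g y) ξ := fun y =>
    (Filter.EventuallyEq.iteratedFDeriv (𝕜 := ℝ)
      (Filter.eventually_of_mem (hO.mem_nhds hξ) (h y)) q).eq_of_nhds
  simp only [mixedPartial, this]

theorem contDiffOn_mixedPartial (hO : IsOpen O)
    (hf : ContDiffOn ℝ (q + (p + m) : ℕ)
      (fun z : EuclideanSpace ℝ (Fin n) × EuclideanSpace ℝ (Fin n) => f z.1 z.2) {z | z.2 ∈ O})
    (I : Fin p → Fin n) (J : Fin q → Fin n) :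
    ContDiffOn ℝ m (fun z : EuclideanSpace ℝ (Fin n) × EuclideanSpace ℝ (Fin n) =>
      mixedPartial I J f z.1 z.2) {z | z.2 ∈ O} := by
  have hU : IsOpen {z : EuclideanSpace ℝ (Fin n) × EuclideanSpace ℝ (Fin n) | z.2 ∈ O} :=
    hO.preimage continuous_snd
  exact (ContDiffOn.iteratedFDeriv_apply_const hU
    (ContDiffOn.iteratedFDeriv_apply_const hU hf _) _).congr fun z hz =>
      mixedPartial_eq hO (hf.of_le (by norm_cast; omega)) I J hz

theorem mixedPartial_succ_left (hO : IsOpen O)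
    (hf : ContDiffOn ℝ (q + (p + 1) : ℕ)
      (fun z : EuclideanSpace ℝ (Fin n) × EuclideanSpace ℝ (Fin n) => f z.1 z.2) {z | z.2 ∈ O})
    (I : Fin (p + 1) → Fin n) (J : Fin q → Fin n)
    {z : EuclideanSpace ℝ (Fin n) × EuclideanSpace ℝ (Fin n)} (hz : z.2 ∈ O) :
    mixedPartial I J f z.1 z.2 = fderiv ℝ
      (fun z : EuclideanSpace ℝ (Fin n) × EuclideanSpace ℝ (Fin n) =>
        mixedPartial (Fin.tail I) J f z.1 z.2) z (pairDir (.inl (I 0))) := by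
  have hU : IsOpen {z : EuclideanSpace ℝ (Fin n) × EuclideanSpace ℝ (Fin n) | z.2 ∈ O} :=
    hO.preimage continuous_snd
  rw [mixedPartial_eq hO hf I J hz, ((ContDiffOn.iteratedFDeriv_apply_const hU hf _).contDiffAt
    (hU.mem_nhds hz)).iteratedFDeriv_succ_apply]
  congr 1
  refine Filter.EventuallyEq.fderiv_eq (Filter.eventually_of_mem (hU.mem_nhds hz) fun z' hz' => ?_)
  exact (mixedPartial_eq hO (hf.of_le (by norm_cast; omega)) (Fin.tail I) J hz').symm

/-- The additional `ξ`-derivative sits inside the `x`-derivatives; induction on `p` moves it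
outermost by symmetry of second derivatives. -/
theorem mixedPartial_succ_right (hO : IsOpen O)
    (hf : ContDiffOn ℝ (q + 1 + p : ℕ)
      (fun z : EuclideanSpace ℝ (Fin n) × EuclideanSpace ℝ (Fin n) => f z.1 z.2) {z | z.2 ∈ O})
    (I : Fin p → Fin n) (J : Fin (q + 1) → Fin n)
    {z : EuclideanSpace ℝ (Fin n) × EuclideanSpace ℝ (Fin n)} (hz : z.2 ∈ O) :
    mixedPartial I J f z.1 z.2 = fderiv ℝ
      (fun z : EuclideanSpace ℝ (Fin n) × EuclideanSpace ℝ (Fin n) =>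
        mixedPartial I (Fin.tail J) f z.1 z.2) z (pairDir (.inr (J 0))) := by
  have hU : IsOpen {z : EuclideanSpace ℝ (Fin n) × EuclideanSpace ℝ (Fin n) | z.2 ∈ O} :=
    hO.preimage continuous_snd
  induction p generalizing z with
  | zero =>
    rw [mixedPartial_eq hO (hf.of_le (by norm_cast)) I J hz, iteratedFDeriv_zero_apply,
      ((hf.of_le (m := (q + 1 : ℕ)) (by norm_cast)).contDiffAt
        (hU.mem_nhds hz)).iteratedFDeriv_succ_apply]
    congr 1
    refine Filter.EventuallyEq.fderiv_eq
      (Filter.eventually_of_mem (hU.mem_nhds hz) fun z' hz' => ?_)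
    change _ = mixedPartial I (Fin.tail J) f z'.1 z'.2
    rw [mixedPartial_eq hO (hf.of_le (by norm_cast; omega)) I _ hz', iteratedFDeriv_zero_apply]
    rfl
  | succ p ih =>
    rw [mixedPartial_succ_left hO (hf.of_le (by norm_cast)) I J hz]
    have h1 : (fun z : EuclideanSpace ℝ (Fin n) × EuclideanSpace ℝ (Fin n) =>
        mixedPartial (Fin.tail I) J f z.1 z.2) =ᶠ[nhds z] fun z => fderiv ℝ
      (fun z : EuclideanSpace ℝ (Fin n) × EuclideanSpace ℝ (Fin n) =>
        mixedPartial (Fin.tail I) (Fin.tail J) f z.1 z.2) z (pairDir (.inr (J 0))) :=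
      Filter.eventually_of_mem (hU.mem_nhds hz) fun z' hz' =>
        ih (hf.of_le (by norm_cast; omega)) _ hz'
    have h2 : (fun z : EuclideanSpace ℝ (Fin n) × EuclideanSpace ℝ (Fin n) =>
        mixedPartial I (Fin.tail J) f z.1 z.2) =ᶠ[nhds z] fun z => fderiv ℝ
      (fun z : EuclideanSpace ℝ (Fin n) × EuclideanSpace ℝ (Fin n) =>
        mixedPartial (Fin.tail I) (Fin.tail J) f z.1 z.2) z (pairDir (.inl (I 0))) :=
      Filter.eventually_of_mem (hU.mem_nhds hz) fun z' hz' =>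
        mixedPartial_succ_left hO (hf.of_le (by norm_cast; omega)) _ _ hz'
    rw [h1.fderiv_eq, h2.fderiv_eq]
    exact fderiv_fderiv_apply_comm ((contDiffOn_mixedPartial (m := 2) hO
      (hf.of_le (by norm_cast; omega)) _ _).contDiffAt (hU.mem_nhds hz)) _ _

theorem mixedPartial_scale (hO : IsOpen O) {r s s' : ℝ}
    (hf : ContDiffOn ℝ (q + p : ℕ)
      (fun z : EuclideanSpace ℝ (Fin n) × EuclideanSpace ℝ (Fin n) => f z.1 z.2) {z | z.2 ∈ O})
    (I : Fin p → Fin n) (J : Fin q → Fin n)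
    (x : EuclideanSpace ℝ (Fin n)) {ξ : EuclideanSpace ℝ (Fin n)} (hξ : s' • ξ ∈ O) :
    mixedPartial I J (fun y η => r • f (s • y) (s' • η)) x ξ
      = (r * s ^ p * s' ^ q) • mixedPartial I J f (s • x) (s' • ξ) := by
  have hsl : ∀ x, ContDiffOn ℝ q (f x) O := fun x =>
    (hf.of_le (by norm_cast; omega)).comp (contDiff_prodMk_right x).contDiffOn fun η hη => hη
  have hmul : ∀ (s : ℝ), ContDiff ℝ ⊤ (fun w : EuclideanSpace ℝ (Fin n) => s • w) :=
    fun s => contDiff_const_smul s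
  have hmul' : ∀ (s : ℝ) (w : EuclideanSpace ℝ (Fin n)), HasFDerivAt
      (fun w : EuclideanSpace ℝ (Fin n) => s • w) (s • ContinuousLinearMap.id ℝ _) w :=
    fun s w => (s • ContinuousLinearMap.id ℝ (EuclideanSpace ℝ (Fin n))).hasFDerivAt
  have h1 : ∀ y, iteratedFDeriv ℝ q (fun η => r • f (s • y) (s' • η)) ξ
      (fun k => EuclideanSpace.single (J k) (1 : ℝ))
      = (r * s' ^ q) • iteratedFDeriv ℝ q (fun η => f (s • y) η) (s' • ξ)
      (fun k => EuclideanSpace.single (J k) (1 : ℝ)) := by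
    intro y
    rw [iteratedFDeriv_comp_slice (f := fun η => r • f (s • y) η) (L := fun η => s' • η) hO
      ((hsl _).const_smul r) (hmul s') (hmul' s') hξ]
    rw [iteratedFDeriv_const_smul_apply' ((hsl _).contDiffAt (hO.mem_nhds hξ))]
    simp [mul_smul, ContinuousMultilinearMap.map_smul_univ]
  unfold mixedPartial
  simp_rw [h1]
  have h2 : ContDiff ℝ p (fun y => iteratedFDeriv ℝ q (fun η => f y η) (s' • ξ)
      (fun k => EuclideanSpace.single (J k) (1 : ℝ))) := by
    have hU : IsOpen {z : EuclideanSpace ℝ (Fin n) × EuclideanSpace ℝ (Fin n) | z.2 ∈ O} :=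
      hO.preimage continuous_snd
    have hq : ContDiffOn ℝ q (fun z : EuclideanSpace ℝ (Fin n) × EuclideanSpace ℝ (Fin n) =>
        f z.1 z.2) {z | z.2 ∈ O} := hf.of_le (by norm_cast; omega)
    simp_rw [fun y => iteratedFDeriv_snd_eq hO hq (x := y) hξ J]
    rw [← contDiffOn_univ]
    exact (ContDiffOn.iteratedFDeriv_apply_const hU hf _).comp
      (contDiff_prodMk_left (s' • ξ)).contDiffOn fun y _ => hξ
  rw [iteratedFDeriv_comp_slice (U := Set.univ) (L := fun y => s • y) isOpen_univ
    (f := fun y => (r * s' ^ q) • iteratedFDeriv ℝ q (fun η => f y η) (s' • ξ)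
      (fun k => EuclideanSpace.single (J k) (1 : ℝ))) (h2.const_smul _).contDiffOn
      (hmul s) (hmul' s) (Set.mem_univ _)]
  rw [iteratedFDeriv_const_smul_apply' h2.contDiffAt]
  simp only [smul_apply,
    ContinuousLinearMap.id_apply, ContinuousMultilinearMap.map_smul_univ, smul_smul]
  simp
  ring_nf

/-- Each further derivative raises `p` or `q` by one, so `N` of them stay within the available
bounds when `p + N` and `q + N` are at most `M`. The lower limits `p₀`, `q₀` accommodate phases,
whose pure derivatives are not bounded. -/
theorem BddDeriv.mixedPartial {ι : Type*} {O' : Set (EuclideanSpace ℝ (Fin n))} (hO : IsOpen O)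
    (hO' : IsOpen O') (hOO' : O' ⊆ O) {N M : ℕ}
    {f : ι → EuclideanSpace ℝ (Fin n) → EuclideanSpace ℝ (Fin n) → F}
    (hf : ∀ i, ContDiffOn ℝ (M + M : ℕ)
      (fun z : EuclideanSpace ℝ (Fin n) × EuclideanSpace ℝ (Fin n) => f i z.1 z.2) {z | z.2 ∈ O})
    {p₀ q₀ : ℕ} (hb : ∀ p q, p₀ ≤ p → p ≤ M → q₀ ≤ q → q ≤ M → ∀ (I : Fin p → Fin n)
      (J : Fin q → Fin n), ∃ B, ∀ i x, ∀ ξ ∈ O', ‖_root_.mixedPartial I J (f i) x ξ‖ ≤ B)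
    (hp₀ : p₀ ≤ p) (hq₀ : q₀ ≤ q) (hp : p + N ≤ M) (hq : q + N ≤ M)
    (I : Fin p → Fin n) (J : Fin q → Fin n) :
    BddDeriv pairDir {z | z.2 ∈ O'} N (fun i z => _root_.mixedPartial I J (f i) z.1 z.2) := by
  have hU : IsOpen {z : EuclideanSpace ℝ (Fin n) × EuclideanSpace ℝ (Fin n) | z.2 ∈ O'} :=
    hO'.preimage continuous_snd
  have hc : ∀ {p q : ℕ} (N : ℕ) (I : Fin p → Fin n) (J : Fin q → Fin n), p + N ≤ M → q + N ≤ M →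
      ∀ i, ContDiffOn ℝ N (fun z : EuclideanSpace ℝ (Fin n) × EuclideanSpace ℝ (Fin n) =>
        _root_.mixedPartial I J (f i) z.1 z.2) {z | z.2 ∈ O'} := fun N I J h h' i =>
    (contDiffOn_mixedPartial hO ((hf i).of_le (by norm_cast; omega)) I J).mono
      fun z hz => hOO' hz
  have hbd : ∀ {p q : ℕ} (I : Fin p → Fin n) (J : Fin q → Fin n), p₀ ≤ p → p ≤ M → q₀ ≤ q →
      q ≤ M → ∃ B, ∀ i, ∀ z : EuclideanSpace ℝ (Fin n) × EuclideanSpace ℝ (Fin n),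
        z ∈ {z : EuclideanSpace ℝ (Fin n) × EuclideanSpace ℝ (Fin n) | z.2 ∈ O'} →
        ‖_root_.mixedPartial I J (f i) z.1 z.2‖ ≤ B := fun I J h1 h2 h3 h4 =>
    (hb _ _ h1 h2 h3 h4 I J).imp fun B hB i z hz => hB i z.1 z.2 hz
  induction N generalizing p q with
  | zero => exact ⟨hc 0 I J hp hq, hbd I J hp₀ (by omega) hq₀ (by omega)⟩
  | succ N ih =>
    refine ⟨hc (N + 1) I J hp hq, hbd I J hp₀ (by omega) hq₀ (by omega), ?_⟩
    rintro (e | e)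
    · refine (ih (p := p + 1) (by omega) hq₀ (by omega) (by omega) (Fin.cons e I) J).congr hU
        fun i z hz => ?_
      have := mixedPartial_succ_left hO ((hf i).of_le (by norm_cast; omega)) (Fin.cons e I) J
        (hOO' hz)
      rw [this]; simp
    · refine (ih (q := q + 1) hp₀ (by omega) (by omega) (by omega) I (Fin.cons e J)).congr hU
        fun i z hz => ?_
      have := mixedPartial_succ_right hO ((hf i).of_le (by norm_cast; omega)) I (Fin.cons e J)
        (hOO' hz)
      rw [this]; simp

end

/-! ### Homogeneous phases and the removal of the singularity at zero frequency. -/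

section
variable {n : ℕ} {ψ : EuclideanSpace ℝ (Fin n) → EuclideanSpace ℝ (Fin n) → ℝ} {N : ℕ}

/-- Differentiating `r⁻¹ ψ(x, rξ) = ψ(x, ξ)` shows that `q` derivatives in `ξ` leave degree `1 - q`.
The case `q = 0` leads to Euler's identity; for `q = 1` the mixed Hessian depends only on the
direction of `ξ`. -/
theorem mixedPartial_homogeneous
    {p q : ℕ} (hψ : ContDiffOn ℝ (q + p : ℕ)
      (fun z : EuclideanSpace ℝ (Fin n) × EuclideanSpace ℝ (Fin n) => ψ z.1 z.2) {z | z.2 ≠ 0})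
    (hom : ∀ x ξ, ξ ≠ 0 → ∀ r : ℝ, 0 < r → ψ x (r • ξ) = r * ψ x ξ)
    (I : Fin p → Fin n) (J : Fin q → Fin n) (x : EuclideanSpace ℝ (Fin n))
    {ξ : EuclideanSpace ℝ (Fin n)} (hξ : ξ ≠ 0) {r : ℝ} (hr : 0 < r) :
    r ^ q * mixedPartial I J ψ x (r • ξ) = r * mixedPartial I J ψ x ξ := by
  have hO : IsOpen {ξ : EuclideanSpace ℝ (Fin n) | ξ ≠ 0} := isOpen_ne
  have h1 := mixedPartial_scale hO (r := r⁻¹) (s := 1) (s' := r) hψ I J x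
    (ξ := ξ) (smul_ne_zero hr.ne' hξ)
  have h2 := mixedPartial_congr hO (f := fun y η => r⁻¹ • ψ ((1 : ℝ) • y) (r • η)) (g := ψ)
    (fun y η hη => by
      rw [one_smul, hom y η hη r hr, smul_eq_mul, inv_mul_cancel_left₀ hr.ne']) I J x hξ
  rw [← h2, h1]
  simp only [one_pow, mul_one, smul_eq_mul, one_smul]
  field_simp

theorem fderiv_mixedPartial_snd {p : ℕ} (hψ : ContDiffOn ℝ (1 + p : ℕ)
      (fun z : EuclideanSpace ℝ (Fin n) × EuclideanSpace ℝ (Fin n) => ψ z.1 z.2) {z | z.2 ≠ 0})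
    (I : Fin p → Fin n) (m : Fin n)
    {z : EuclideanSpace ℝ (Fin n) × EuclideanSpace ℝ (Fin n)} (hz : z.2 ≠ 0) :
    fderiv ℝ (fun z : EuclideanSpace ℝ (Fin n) × EuclideanSpace ℝ (Fin n) =>
      mixedPartial I ![] ψ z.1 z.2) z (pairDir (.inr m)) = mixedPartial I ![m] ψ z.1 z.2 := by
  have hO : IsOpen {ξ : EuclideanSpace ℝ (Fin n) | ξ ≠ 0} := isOpen_ne
  rw [mixedPartial_succ_right (q := 0) hO (by simpa using hψ) I ![m] hz,
    Subsingleton.elim (Fin.tail ![m]) ![]]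
  rfl

theorem fderiv_mixedPartial_fst (hψ : ContDiffOn ℝ (1 : ℕ)
      (fun z : EuclideanSpace ℝ (Fin n) × EuclideanSpace ℝ (Fin n) => ψ z.1 z.2) {z | z.2 ≠ 0})
    (m : Fin n) {z : EuclideanSpace ℝ (Fin n) × EuclideanSpace ℝ (Fin n)} (hz : z.2 ≠ 0) :
    fderiv ℝ (fun z : EuclideanSpace ℝ (Fin n) × EuclideanSpace ℝ (Fin n) => ψ z.1 z.2) z
      (pairDir (.inl m)) = mixedPartial ![m] ![] ψ z.1 z.2 := by
  have hO : IsOpen {ξ : EuclideanSpace ℝ (Fin n) | ξ ≠ 0} := isOpen_ne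
  rw [mixedPartial_succ_left (p := 0) (q := 0) hO (by simpa using hψ) ![m] ![] hz]
  simp [mixedPartial]

/-- Euler's identity. -/
theorem mixedPartial_eq_sum {p : ℕ} (hψ : ContDiffOn ℝ (1 + p : ℕ)
      (fun z : EuclideanSpace ℝ (Fin n) × EuclideanSpace ℝ (Fin n) => ψ z.1 z.2) {z | z.2 ≠ 0})
    (hom : ∀ x ξ, ξ ≠ 0 → ∀ r : ℝ, 0 < r → ψ x (r • ξ) = r * ψ x ξ)
    (I : Fin p → Fin n) (x : EuclideanSpace ℝ (Fin n))
    {ξ : EuclideanSpace ℝ (Fin n)} (hξ : ξ ≠ 0) :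
    mixedPartial I ![] ψ x ξ = ∑ m, ξ m * mixedPartial I ![m] ψ x ξ := by
  have hO : IsOpen {ξ : EuclideanSpace ℝ (Fin n) | ξ ≠ 0} := isOpen_ne
  have hU : IsOpen {z : EuclideanSpace ℝ (Fin n) × EuclideanSpace ℝ (Fin n) | z.2 ≠ 0} :=
    hO.preimage continuous_snd
  set G := fun z : EuclideanSpace ℝ (Fin n) × EuclideanSpace ℝ (Fin n) =>
    mixedPartial I ![] ψ z.1 z.2 with hG
  have hGd : DifferentiableAt ℝ G (x, ξ) :=
    ((contDiffOn_mixedPartial (m := 1) (q := 0) hO (hψ.of_le (by norm_cast; omega)) I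
      ![]).contDiffAt (hU.mem_nhds hξ)).differentiableAt (by norm_num)
  have hc : HasDerivAt (fun r : ℝ => ((x, r • ξ) : EuclideanSpace ℝ (Fin n) × _)) (0, ξ) 1 := by
    have := (hasDerivAt_const (1 : ℝ) x).prodMk ((hasDerivAt_id (1 : ℝ)).smul_const ξ)
    simpa using this
  -- The derivative of `r ↦ G (x, r • ξ)` at `r = 1` is computed twice, by the chain rule and by
  -- homogeneity of degree one.
  have h1 : HasDerivAt (fun r : ℝ => G (x, r • ξ)) (fderiv ℝ G (x, ξ) (0, ξ)) 1 := by
    have h := HasFDerivAt.comp_hasDerivAt (l := G) (l' := fderiv ℝ G (x, ξ)) (1 : ℝ)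
      (by simpa using hGd.hasFDerivAt) hc
    exact h
  have h2 : HasDerivAt (fun r : ℝ => G (x, r • ξ)) (G (x, ξ)) 1 := by
    have : HasDerivAt (fun r : ℝ => r * G (x, ξ)) (G (x, ξ)) 1 := by
      simpa using (hasDerivAt_id (1 : ℝ)).mul_const (G (x, ξ))
    refine this.congr_of_eventuallyEq (Filter.eventually_of_mem
      (isOpen_Ioi.mem_nhds (Set.mem_Ioi.2 one_pos)) fun r hr => ?_)
    have := mixedPartial_homogeneous (q := 0) (hψ.of_le (by norm_cast; omega)) hom I ![] x hξ hr
    simpa using this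
  have h3 : ((0, ξ) : EuclideanSpace ℝ (Fin n) × EuclideanSpace ℝ (Fin n))
      = ∑ m, ξ m • pairDir (.inr m) := by
    have := (EuclideanSpace.basisFun (Fin n) ℝ).sum_repr ξ
    refine Prod.ext ?_ ?_
    · simp [pairDir, Prod.fst_sum]
    · simp only [pairDir, Prod.snd_sum]
      simpa [coordDir] using this.symm
  have h4 := h2.unique h1
  rw [h3, map_sum] at h4
  refine h4.trans (Finset.sum_congr rfl fun m _ => ?_)
  rw [map_smul, fderiv_mixedPartial_snd hψ I m hξ, smul_eq_mul]

/-- A cutoff near the singular frequency. -/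
noncomputable def freqBump (n : ℕ) : ContDiffBump (0 : EuclideanSpace ℝ (Fin n)) where
  rIn := 3 / 2
  rOut := 2
  rIn_pos := by norm_num
  rIn_lt_rOut := by norm_num

theorem freqBump_eq_one {ξ : EuclideanSpace ℝ (Fin n)} (h : ‖ξ‖ < 3 / 2) : freqBump n ξ = 1 :=
  (freqBump n).one_of_mem_closedBall (by simpa [freqBump] using h.le)

theorem freqBump_eq_zero {ξ : EuclideanSpace ℝ (Fin n)} (h : 2 ≤ ‖ξ‖) : freqBump n ξ = 0 :=
  (freqBump n).zero_of_le_dist (by simpa [freqBump] using h)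

/-- The phase `y · η + ψ(y, η)`, modified near `η = 0` so that it becomes smooth there. -/
noncomputable def globalPhase (ψ : EuclideanSpace ℝ (Fin n) → EuclideanSpace ℝ (Fin n) → ℝ)
    (z : EuclideanSpace ℝ (Fin n) × EuclideanSpace ℝ (Fin n)) : ℝ :=
  inner ℝ z.1 z.2 + (1 - freqBump n z.2) * ψ z.1 z.2

theorem contDiff_globalPhase (hψ : ContDiffOn ℝ N
      (fun z : EuclideanSpace ℝ (Fin n) × EuclideanSpace ℝ (Fin n) => ψ z.1 z.2) {z | z.2 ≠ 0}) :
    ContDiff ℝ N (globalPhase ψ) := by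
  have hU : IsOpen {z : EuclideanSpace ℝ (Fin n) × EuclideanSpace ℝ (Fin n) | z.2 ≠ 0} :=
    isOpen_ne.preimage continuous_snd
  refine ContDiff.add (contDiff_fst.inner ℝ contDiff_snd) (contDiff_iff_contDiffAt.2 fun z => ?_)
  by_cases hz : z.2 = 0
  · refine (contDiffAt_const (c := (0 : ℝ))).congr_of_eventuallyEq ?_
    have : {z : EuclideanSpace ℝ (Fin n) × EuclideanSpace ℝ (Fin n) | ‖z.2‖ < 3 / 2} ∈ nhds z :=
      (isOpen_lt continuous_snd.norm continuous_const).mem_nhds (by simp [hz])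
    filter_upwards [this] with z' hz'
    rw [freqBump_eq_one hz']; simp
  · exact (contDiffAt_const.sub ((freqBump n).contDiff.contDiffAt.comp z contDiffAt_snd)).mul
      (hψ.contDiffAt (hU.mem_nhds hz))

theorem fderiv_globalPhase_fst (hψ : ContDiffOn ℝ (1 : ℕ)
      (fun z : EuclideanSpace ℝ (Fin n) × EuclideanSpace ℝ (Fin n) => ψ z.1 z.2) {z | z.2 ≠ 0})
    (j : Fin n) {z : EuclideanSpace ℝ (Fin n) × EuclideanSpace ℝ (Fin n)} (hz : z.2 ≠ 0) :
    fderiv ℝ (globalPhase ψ) z (pairDir (.inl j)) =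
      z.2 j + (1 - freqBump n z.2) * mixedPartial ![j] ![] ψ z.1 z.2 := by
  have hU : IsOpen {z : EuclideanSpace ℝ (Fin n) × EuclideanSpace ℝ (Fin n) | z.2 ≠ 0} :=
    isOpen_ne.preimage continuous_snd
  have h1 : HasFDerivAt (fun z : EuclideanSpace ℝ (Fin n) × EuclideanSpace ℝ (Fin n) =>
      (inner ℝ z.1 z.2 : ℝ)) _ z :=
    (((contDiff_fst.inner ℝ contDiff_snd).differentiable (n := 1) (by norm_num)) z).hasFDerivAt
  have h2 : HasFDerivAt (fun z : EuclideanSpace ℝ (Fin n) × EuclideanSpace ℝ (Fin n) =>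
      1 - freqBump n z.2) _ z := ((((freqBump n).contDiff (n := 1)).differentiable (by norm_num)
        z.2).hasFDerivAt.comp z hasFDerivAt_snd).const_sub 1
  have h3 := ((hψ.contDiffAt (hU.mem_nhds hz)).differentiableAt (by norm_num)).hasFDerivAt
  have h4 : HasFDerivAt (globalPhase ψ) _ z := h1.add (h2.mul h3)
  rw [h4.fderiv, ← fderiv_mixedPartial_fst hψ j hz]
  rw [_root_.add_apply, fderiv_inner_apply ℝ differentiableAt_fst differentiableAt_snd]
  simp [pairDir, coordDir, EuclideanSpace.inner_single_left, fderiv_fst, fderiv_snd]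

/-- The mixed second derivatives of `globalPhase`, minus the identity matrix. -/
theorem fderiv_fderiv_globalPhase (hψ : ContDiffOn ℝ (2 : ℕ)
      (fun z : EuclideanSpace ℝ (Fin n) × EuclideanSpace ℝ (Fin n) => ψ z.1 z.2) {z | z.2 ≠ 0})
    (hom : ∀ x ξ, ξ ≠ 0 → ∀ r : ℝ, 0 < r → ψ x (r • ξ) = r * ψ x ξ)
    (j l : Fin n) {z : EuclideanSpace ℝ (Fin n) × EuclideanSpace ℝ (Fin n)} (hz : z.2 ≠ 0) :
    fderiv ℝ (fun z => fderiv ℝ (globalPhase ψ) z (pairDir (.inl j))) z (pairDir (.inr l)) =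
      (if j = l then 1 else 0) +
        (∑ m, -(fderiv ℝ (freqBump n) z.2 (coordDir l) * z.2 m) *
            mixedPartial ![j] ![m] ψ z.1 z.2 +
          (1 - freqBump n z.2) * mixedPartial ![j] ![l] ψ z.1 z.2) := by
  have hO : IsOpen {ξ : EuclideanSpace ℝ (Fin n) | ξ ≠ 0} := isOpen_ne
  have hU : IsOpen {z : EuclideanSpace ℝ (Fin n) × EuclideanSpace ℝ (Fin n) | z.2 ≠ 0} :=
    isOpen_ne.preimage continuous_snd
  have hev : (fun z => fderiv ℝ (globalPhase ψ) z (pairDir (.inl j))) =ᶠ[nhds z] fun z =>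
      z.2 j + (1 - freqBump n z.2) * mixedPartial ![j] ![] ψ z.1 z.2 :=
    Filter.eventually_of_mem (hU.mem_nhds hz) fun z' hz' =>
      fderiv_globalPhase_fst (hψ.of_le (by norm_num)) j hz'
  rw [hev.fderiv_eq]
  have h1 : HasFDerivAt (fun z : EuclideanSpace ℝ (Fin n) × EuclideanSpace ℝ (Fin n) => z.2 j) _ z :=
    ((EuclideanSpace.proj j).comp (ContinuousLinearMap.snd ℝ (EuclideanSpace ℝ (Fin n))
      (EuclideanSpace ℝ (Fin n)))).hasFDerivAt
  have h2 : HasFDerivAt (fun z : EuclideanSpace ℝ (Fin n) × EuclideanSpace ℝ (Fin n) =>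
      1 - freqBump n z.2) _ z := ((((freqBump n).contDiff (n := 1)).differentiable (by norm_num)
        z.2).hasFDerivAt.comp z hasFDerivAt_snd).const_sub 1
  have h3 := ((contDiffOn_mixedPartial (m := 1) (q := 0) (p := 1) hO
    (hψ.of_le (by norm_num)) ![j] ![]).contDiffAt
      (hU.mem_nhds hz)).differentiableAt (by norm_num) |>.hasFDerivAt
  rw [(h1.fun_add (h2.fun_mul h3)).fderiv]
  have h4 := fderiv_mixedPartial_snd (p := 1) hψ ![j] l hz
  -- A derivative falling on the cutoff leaves `∂_{y_j} ψ`, for which no bound is assumed; Euler's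
  -- identity expresses it through mixed derivatives.
  have h5 := mixedPartial_eq_sum (p := 1) hψ hom ![j] z.1 hz
  simp only [_root_.add_apply, _root_.smul_apply, h4, h5]
  have h6 : (EuclideanSpace.proj j : EuclideanSpace ℝ (Fin n) →L[ℝ] ℝ) (coordDir l)
      = if j = l then 1 else 0 := by simp [coordDir]
  simp only [pairDir, Sum.elim_inr, ContinuousLinearMap.comp_apply, _root_.neg_apply,
    ContinuousLinearMap.coe_snd', h6, smul_eq_mul]
  rw [add_comm (Finset.sum _ _), Finset.sum_mul]
  congr 2
  exact Finset.sum_congr rfl fun m _ => by ring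

end

section
variable {ι : Type*} {n N : ℕ}

theorem BddDeriv.comp_snd {g : EuclideanSpace ℝ (Fin n) → ℝ} (hg : ContDiff ℝ N g)
    (hs : HasCompactSupport g) :
    BddDeriv pairDir Set.univ N
      (fun (_ : ι) (z : EuclideanSpace ℝ (Fin n) × EuclideanSpace ℝ (Fin n)) => g z.2) := by
  have h1 : BddDeriv (fun e : Fin n ⊕ Fin n => (pairDir e).2) Set.univ N (fun _ : ι => g) :=
    BddDeriv.of_hasCompactSupport hg hs
  simpa using h1.comp_affine (U' := Set.univ) isOpen_univ isOpen_univ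
    (ContinuousLinearMap.snd ℝ (EuclideanSpace ℝ (Fin n)) (EuclideanSpace ℝ (Fin n)))
    (fun _ => 0) id (d' := pairDir) id (fun e => rfl) (fun _ _ _ => trivial)

variable {ψ : ι → EuclideanSpace ℝ (Fin n) → EuclideanSpace ℝ (Fin n) → ℝ}

/-- The mixed Hessian is the identity plus a remainder `R` that vanishes for `|η| < 3/2`, so bounds
on `|η| > 1` suffice. The factors `η_m` from Euler's identity come with the compactly supported
gradient of the cutoff. -/
theorem mixedBdd_globalPhase
    (hψ : ∀ i, ContDiffOn ℝ (4 * n + 4 : ℕ)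
      (fun z : EuclideanSpace ℝ (Fin n) × EuclideanSpace ℝ (Fin n) => ψ i z.1 z.2) {z | z.2 ≠ 0})
    (hom : ∀ i x ξ, ξ ≠ 0 → ∀ r : ℝ, 0 < r → ψ i x (r • ξ) = r * ψ i x ξ)
    (hbd : ∀ p q : ℕ, 1 ≤ p → p ≤ 2 * n + 2 → 1 ≤ q → q ≤ 2 * n + 2 →
      ∀ (I : Fin p → Fin n) (J : Fin q → Fin n), ∃ B : ℝ, ∀ i x ξ, 1 ≤ ‖ξ‖ →
        ‖mixedPartial I J (ψ i) x ξ‖ ≤ B) :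
    MixedBdd (2 * n + 1) (fun i => globalPhase (ψ i)) := by
  refine ⟨fun i => contDiff_globalPhase ((hψ i).of_le (by norm_cast; omega)), fun j l => ?_⟩
  set U : Set (EuclideanSpace ℝ (Fin n) × EuclideanSpace ℝ (Fin n)) :=
    {z | z.2 ∈ {ξ : EuclideanSpace ℝ (Fin n) | 1 < ‖ξ‖}}
  set W : Set (EuclideanSpace ℝ (Fin n) × EuclideanSpace ℝ (Fin n)) := {z | ‖z.2‖ < 3 / 2}
    with hWdef
  have hO' : IsOpen {ξ : EuclideanSpace ℝ (Fin n) | 1 < ‖ξ‖} :=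
    isOpen_lt continuous_const continuous_norm
  have hU : IsOpen U := hO'.preimage continuous_snd
  have hW : IsOpen W := isOpen_lt continuous_snd.norm continuous_const
  have hP : ∀ m, BddDeriv pairDir U (2 * n + 1)
      (fun i z => mixedPartial ![j] ![m] (ψ i) z.1 z.2) := fun m =>
    BddDeriv.mixedPartial (M := 2 * n + 2) (p₀ := 1) (q₀ := 1) isOpen_ne hO'
      (fun ξ (hξ : 1 < ‖ξ‖) => norm_ne_zero_iff.1 (by linarith))
      (fun i => (hψ i).of_le (by norm_cast; omega))
      (fun p q h1 h2 h3 h4 I J => (hbd p q h1 h2 h3 h4 I J).imp fun B hB i x ξ hξ =>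
        hB i x ξ (le_of_lt hξ)) le_rfl le_rfl (by omega) (by omega) _ _
  have hχ : BddDeriv pairDir Set.univ (2 * n + 1) (fun (_ : ι)
      (z : EuclideanSpace ℝ (Fin n) × EuclideanSpace ℝ (Fin n)) => freqBump n z.2) :=
    BddDeriv.comp_snd (freqBump n).contDiff (freqBump n).hasCompactSupport
  have hχ' : ∀ m, BddDeriv pairDir Set.univ (2 * n + 1) (fun (_ : ι)
      (z : EuclideanSpace ℝ (Fin n) × EuclideanSpace ℝ (Fin n)) =>
        fderiv ℝ (freqBump n) z.2 (coordDir l) * z.2 m) := fun m =>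
    BddDeriv.comp_snd (g := fun ξ => fderiv ℝ (freqBump n) ξ (coordDir l) * ξ m)
      ((((freqBump n).contDiff (n := (2 * n + 1 + 1 : ℕ))).fderiv_right
        (m := (2 * n + 1 : ℕ)) (by norm_cast)).clm_apply contDiff_const |>.mul
          (EuclideanSpace.proj (𝕜 := ℝ) m).contDiff)
      (((freqBump n).hasCompactSupport.fderiv_apply ℝ _).mul_right)
  let R : ι → EuclideanSpace ℝ (Fin n) × EuclideanSpace ℝ (Fin n) → ℝ := fun i z =>
    ∑ m, -(fderiv ℝ (freqBump n) z.2 (coordDir l) * z.2 m) * mixedPartial ![j] ![m] (ψ i) z.1 z.2 +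
      (1 - freqBump n z.2) * mixedPartial ![j] ![l] (ψ i) z.1 z.2
  have hR : BddDeriv pairDir U (2 * n + 1) R := by
    refine BddDeriv.add hU (BddDeriv.sum hU _ fun m _ => ?_) ?_
    · exact BddDeriv.mul hU (((hχ' m).mono_set (Set.subset_univ _)).neg hU) (hP m)
    · exact BddDeriv.mul hU ((BddDeriv.const (C := 1) (by simp)).sub hU
        (hχ.mono_set (Set.subset_univ _))) (hP l)
  have hχW : ∀ z ∈ W, fderiv ℝ (freqBump n) z.2 = 0 := fun z hz => by
    have : (freqBump n : EuclideanSpace ℝ (Fin n) → ℝ) =ᶠ[nhds z.2] fun _ => 1 :=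
      Filter.eventually_of_mem ((isOpen_lt continuous_norm continuous_const).mem_nhds hz)
        fun ξ hξ => freqBump_eq_one hξ
    rw [this.fderiv_eq]; simp
  have hR' : BddDeriv pairDir Set.univ (2 * n + 1) R := by
    refine BddDeriv.of_eq_zero hU hW hR (fun i z hz => ?_) fun z => ?_
    · simp [R, hχW z hz, freqBump_eq_one hz]
    · rcases lt_or_ge 1 ‖z.2‖ with h | h
      · exact Or.inl h
      · exact Or.inr (show ‖z.2‖ < 3 / 2 by linarith)
  refine BddDeriv.congr isOpen_univ (BddDeriv.add isOpen_univ
    (BddDeriv.const (c := fun _ => if j = l then (1 : ℝ) else 0) (C := 1) fun _ => by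
      split_ifs <;> simp) hR') fun i z _ => ?_
  -- The formula for the mixed derivatives needs `ψ` smooth at the point. Near `η = 0` the cutoff is
  -- 1 and the phase is just `y · η`.
  by_cases hz : z.2 = 0
  · have hzW : z ∈ W := by simp [hWdef, hz]
    have hev : (fun z => fderiv ℝ (globalPhase (ψ i)) z (pairDir (.inl j))) =ᶠ[nhds z]
        fun z => z.2 j := by
      refine Filter.eventually_of_mem (hW.mem_nhds hzW) fun z' hz' => ?_
      have : globalPhase (ψ i) =ᶠ[nhds z'] fun z => inner ℝ z.1 z.2 :=
        Filter.eventually_of_mem (hW.mem_nhds hz') fun z'' hz'' => by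
          simp [globalPhase, freqBump_eq_one hz'']
      simp only [this.fderiv_eq]
      rw [fderiv_inner_apply ℝ differentiableAt_fst differentiableAt_snd]
      simp [pairDir, coordDir, fderiv_fst, fderiv_snd, EuclideanSpace.inner_single_left]
    have h1 : HasFDerivAt (fun z : EuclideanSpace ℝ (Fin n) × EuclideanSpace ℝ (Fin n) => z.2 j) _
        z := ((EuclideanSpace.proj j).comp (ContinuousLinearMap.snd ℝ (EuclideanSpace ℝ (Fin n))
      (EuclideanSpace ℝ (Fin n)))).hasFDerivAt
    rw [hev.fderiv_eq, h1.fderiv]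
    simp [R, hχW z hzW, freqBump_eq_one hzW, pairDir, coordDir]
  · exact fderiv_fderiv_globalPhase ((hψ i).of_le (by norm_cast; omega)) (hom i) j l hz

end

/-! ### Separation of gradients, and the estimate for the modified phase. -/

section
variable {ι : Type*} {n : ℕ}

/-- The matrix of mixed second derivatives of a function of two variables. -/
noncomputable def mixedMatrix (Φ : EuclideanSpace ℝ (Fin n) × EuclideanSpace ℝ (Fin n) → ℝ)
    (z : EuclideanSpace ℝ (Fin n) × EuclideanSpace ℝ (Fin n)) : Matrix (Fin n) (Fin n) ℝ :=
  Matrix.of fun j l => fderiv ℝ (fun z => fderiv ℝ Φ z (pairDir (.inl j))) z (pairDir (.inr l))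

/-- The gradient of `Φ` in its first variable. -/
noncomputable def fstGradient (Φ : EuclideanSpace ℝ (Fin n) × EuclideanSpace ℝ (Fin n) → ℝ)
    (z : EuclideanSpace ℝ (Fin n) × EuclideanSpace ℝ (Fin n)) : EuclideanSpace ℝ (Fin n) :=
  WithLp.toLp 2 fun j => fderiv ℝ Φ z (pairDir (.inl j))

theorem fstSeparated_of_norm_le {Φ : EuclideanSpace ℝ (Fin n) × EuclideanSpace ℝ (Fin n) → ℝ}
    {c : ℝ} (hc : 0 ≤ c) {y k l : EuclideanSpace ℝ (Fin n)}
    (h : c * ‖k - l‖ ≤ ‖fstGradient Φ (y, k) - fstGradient Φ (y, l)‖) :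
    FstSeparated Φ c y k l := by
  have h2 := pow_le_pow_left₀ (by positivity) h 2
  rw [EuclideanSpace.norm_sq_eq (fstGradient Φ (y, k) - fstGradient Φ (y, l))] at h2
  simpa [FstSeparated, fstGradient] using h2

theorem hasFDerivAt_fstGradient
    {Φ : EuclideanSpace ℝ (Fin n) × EuclideanSpace ℝ (Fin n) → ℝ} (hΦ : ContDiff ℝ 2 Φ)
    (y η : EuclideanSpace ℝ (Fin n)) :
    HasFDerivAt (fun η => fstGradient Φ (y, η))
      (Matrix.toEuclideanCLM (𝕜 := ℝ) (mixedMatrix Φ (y, η))) η := by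
  rw [← hasFDerivWithinAt_univ, hasFDerivWithinAt_euclidean]
  intro j
  rw [hasFDerivWithinAt_univ]
  have hd : DifferentiableAt ℝ (fun z => fderiv ℝ Φ z (pairDir (.inl j))) (y, η) :=
    (((hΦ.fderiv_right (m := 1) (by norm_num)).clm_apply contDiff_const).differentiable
      (by norm_num)) _
  have h1 := hd.hasFDerivAt.comp η (hasFDerivAt_prodMk_right y η)
  refine h1.congr_fderiv ?_
  ext w
  have hw : ((0, w) : EuclideanSpace ℝ (Fin n) × EuclideanSpace ℝ (Fin n))
      = ∑ m, w m • pairDir (.inr m) := by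
    have := (EuclideanSpace.basisFun (Fin n) ℝ).sum_repr w
    refine Prod.ext ?_ ?_
    · simp [pairDir, Prod.fst_sum]
    · simp only [pairDir, Prod.snd_sum]
      simpa [coordDir] using this.symm
  simp [hw, Matrix.ofLp_toEuclideanCLM, Matrix.mulVec, dotProduct, mixedMatrix, mul_comm]

theorem norm_toEuclideanCLM_le {M : Matrix (Fin n) (Fin n) ℝ} {C : ℝ} (hC : 0 ≤ C)
    (h : ∀ j l, |M j l| ≤ C) : ‖Matrix.toEuclideanCLM (𝕜 := ℝ) M‖ ≤ n * (n * C) := by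
  refine ContinuousLinearMap.opNorm_le_bound _ (by positivity) fun w => ?_
  refine norm_clm_apply_le_of_coordDir _ (fun l => ?_) w
  refine (euclidean_norm_le_sum _).trans ?_
  have : ∀ j ∈ Finset.univ, |(Matrix.toEuclideanCLM (𝕜 := ℝ) M (coordDir l)) j| ≤ C :=
    fun j _ => by
      simpa [Matrix.ofLp_toEuclideanCLM, coordDir] using h j l
  simpa using Finset.sum_le_sum this

variable {Φ : ι → EuclideanSpace ℝ (Fin n) × EuclideanSpace ℝ (Fin n) → ℝ} {N : ℕ}

theorem MixedBdd.exists_mixedMatrix_le (hΦ : MixedBdd N Φ) :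
    ∃ B, ∀ i z j l, |mixedMatrix (Φ i) z j l| ≤ B := by
  choose C hC using fun j l => (hΦ.2 j l).bound_nonneg
  refine ⟨∑ j, ∑ l, C j l, fun i z j l => ((hC j l).2 i z trivial).trans ?_⟩
  exact (Finset.single_le_sum (f := C j) (fun l _ => (hC j l).1) (Finset.mem_univ l)).trans
    (Finset.single_le_sum (f := fun j => ∑ l, C j l)
      (fun j _ => Finset.sum_nonneg fun l _ => (hC j l).1) (Finset.mem_univ j))

theorem MixedBdd.exists_mixedMatrix_sub_le (hΦ : MixedBdd (N + 1) Φ) :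
    ∃ Λ, 0 ≤ Λ ∧ ∀ i y η η', ‖Matrix.toEuclideanCLM (𝕜 := ℝ) (mixedMatrix (Φ i) (y, η)) -
      Matrix.toEuclideanCLM (𝕜 := ℝ) (mixedMatrix (Φ i) (y, η'))‖ ≤ Λ * ‖η - η'‖ := by
  have h1 : ∀ j l, ∃ C, 0 ≤ C ∧ ∀ i y η η', ‖mixedMatrix (Φ i) (y, η) j l -
      mixedMatrix (Φ i) (y, η') j l‖ ≤ C * ‖η - η'‖ := fun j l =>
    BddDeriv.norm_sub_le (N := N) (fun i => (hΦ.2 j l).contDiff i) fun m => (hΦ.2 j l).deriv _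
  choose C hC using h1
  have hCs : ∀ j l, C j l ≤ ∑ j, ∑ l, C j l := fun j l =>
    (Finset.single_le_sum (f := C j) (fun l _ => (hC j l).1) (Finset.mem_univ l)).trans
    (Finset.single_le_sum (f := fun j => ∑ l, C j l)
      (fun j _ => Finset.sum_nonneg fun l _ => (hC j l).1) (Finset.mem_univ j))
  have hC0 : 0 ≤ ∑ j, ∑ l, C j l :=
    Finset.sum_nonneg fun j _ => Finset.sum_nonneg fun l _ => (hC j l).1
  refine ⟨n * (n * ∑ j, ∑ l, C j l), by positivity, fun i y η η' => ?_⟩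
  rw [← map_sub]
  refine (norm_toEuclideanCLM_le (C := (∑ j, ∑ l, C j l) * ‖η - η'‖) (by positivity)
    fun j l => ?_).trans (by rw [mul_assoc, mul_assoc])
  exact ((hC j l).2 i y η η').trans (by gcongr; exact hCs j l)

end

section
variable {ι : Type*} {n : ℕ}

theorem mixedMatrix_globalPhase
    {ψ : EuclideanSpace ℝ (Fin n) → EuclideanSpace ℝ (Fin n) → ℝ} (hψ : ContDiffOn ℝ (2 : ℕ)
      (fun z : EuclideanSpace ℝ (Fin n) × EuclideanSpace ℝ (Fin n) => ψ z.1 z.2) {z | z.2 ≠ 0})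
    (hom : ∀ x ξ, ξ ≠ 0 → ∀ r : ℝ, 0 < r → ψ x (r • ξ) = r * ψ x ξ)
    {z : EuclideanSpace ℝ (Fin n) × EuclideanSpace ℝ (Fin n)} (hz : 2 < ‖z.2‖) :
    mixedMatrix (globalPhase ψ) z = 1 + mixedHessian ψ z.1 z.2 := by
  have hz0 : z.2 ≠ 0 := norm_ne_zero_iff.1 (by linarith)
  have hχ : fderiv ℝ (freqBump n) z.2 = 0 := by
    have : (freqBump n : EuclideanSpace ℝ (Fin n) → ℝ) =ᶠ[nhds z.2] fun _ => 0 :=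
      Filter.eventually_of_mem ((isOpen_lt continuous_const continuous_norm).mem_nhds hz)
        fun ξ hξ => freqBump_eq_zero (le_of_lt hξ)
    rw [this.fderiv_eq]; simp
  ext j l
  simp only [mixedMatrix, Matrix.of_apply, mixedHessian, Matrix.add_apply, Matrix.one_apply]
  rw [fderiv_fderiv_globalPhase hψ hom j l hz0, hχ, freqBump_eq_zero hz.le]
  simp

theorem exists_mul_norm_le_norm_toEuclideanCLM (n : ℕ) (B : ℝ) {C₀ : ℝ} (hC₀ : 0 < C₀) :
    ∃ c, 0 < c ∧ ∀ M : Matrix (Fin n) (Fin n) ℝ, (∀ i j, |M i j| ≤ B) → C₀ ≤ |M.det| →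
      ∀ w : EuclideanSpace ℝ (Fin n), c * ‖w‖ ≤ ‖Matrix.toEuclideanCLM (𝕜 := ℝ) M w‖ :=
  exists_mul_norm_le_norm_mulVec n B hC₀

variable {Φ : ι → EuclideanSpace ℝ (Fin n) × EuclideanSpace ℝ (Fin n) → ℝ} {N : ℕ}

/-- Global injectivity of `y ↦ ∂_η Φ(y, η)`, quantitatively. -/
theorem MixedBdd.exists_fstSeparated_swap (hΦ : MixedBdd (N + 1) Φ) {C₀ : ℝ} (hC₀ : 0 < C₀)
    (hdet : ∀ i y η, 2 < ‖η‖ → C₀ ≤ |(mixedMatrix (Φ i) (y, η)).det|) :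
    ∃ c, 0 < c ∧ ∀ i η, 2 < ‖η‖ → ∀ y y', FstSeparated (fun z => Φ i z.swap) c η y y' := by
  have hΨ := hΦ.swap
  obtain ⟨B, hB⟩ := hΨ.exists_mixedMatrix_le
  obtain ⟨Λ, hΛ0, hΛ⟩ := hΨ.exists_mixedMatrix_sub_le
  obtain ⟨c, hc, hlow⟩ := exists_mul_norm_le_norm_toEuclideanCLM n B hC₀
  refine ⟨c / 2, by positivity, fun i η hη y y' => fstSeparated_of_norm_le (by positivity) ?_⟩
  have hd : ∀ y, C₀ ≤ |(mixedMatrix (fun z => Φ i z.swap) (η, y)).det| := fun y => by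
    have h2 : mixedMatrix (fun z => Φ i z.swap) (η, y) =
        (mixedMatrix (Φ i) (y, η)).transpose := by
      ext j l
      exact fderiv_fderiv_comp_swap ((hΦ.1 i).of_le (by norm_cast; omega)) j l (η, y)
    rw [h2, Matrix.det_transpose]
    exact hdet i y η hη
  -- For fixed `|η| > 2` the hypotheses hold at every `y`, so the global inverse function theorem
  -- applies on the whole space; exchanging the variables only transposes the matrix.
  exact mul_norm_sub_le_of_fderiv hc hΛ0
    (fun y => hasFDerivAt_fstGradient ((hΨ.1 i).of_le (by norm_cast; omega)) η y)
    (fun y w => hlow _ (hB i _) (hd y) w) (fun y y' => hΛ i η y y') y' y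

/-- The set is a union of balls whose centre `ρ u` and radius `ε ρ` are linear in `ρ`. Its convexity
is what the mean value inequality on a cone requires. -/
theorem convex_cone_ball {V : Type*} [NormedAddCommGroup V] [NormedSpace ℝ V] (u : V) (ε A : ℝ) :
    Convex ℝ {η : V | ∃ ρ, A ≤ ρ ∧ ‖η - ρ • u‖ ≤ ε * ρ} := by
  rintro η ⟨ρ, hρ, h⟩ η' ⟨ρ', hρ', h'⟩ a b ha hb hab
  refine ⟨a * ρ + b * ρ',
    (Convex.combo_self hab A).symm.le.trans (by simp only [smul_eq_mul]; gcongr), ?_⟩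
  have : a • η + b • η' - (a * ρ + b * ρ') • u = a • (η - ρ • u) + b • (η' - ρ' • u) := by
    module
  rw [this]
  refine (norm_add_le _ _).trans ?_
  rw [norm_smul, norm_smul, Real.norm_of_nonneg ha, Real.norm_of_nonneg hb]
  nlinarith [mul_le_mul_of_nonneg_left h ha, mul_le_mul_of_nonneg_left h' hb]

/-- Injectivity of `η ↦ ∂_y Φ(y, η)` on narrow cones, quantitatively. -/
theorem MixedBdd.exists_fstSeparated_cone (hΦ : MixedBdd (N + 1) Φ) {C₀ : ℝ} (hC₀ : 0 < C₀)
    (hdet : ∀ i y η, 2 < ‖η‖ → C₀ ≤ |(mixedMatrix (Φ i) (y, η)).det|)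
    (hhom : ∀ i y η, ∀ r : ℝ, 0 < r → 2 < ‖η‖ → 2 < ‖r • η‖ →
      mixedMatrix (Φ i) (y, η) = mixedMatrix (Φ i) (y, r • η)) :
    ∃ c ε : ℝ, 0 < c ∧ 0 < ε ∧ ∀ i y (u : EuclideanSpace ℝ (Fin n)), ‖u‖ = 1 → ∀ k l,
      (∃ ρ, 10 ≤ ρ ∧ ‖k - ρ • u‖ ≤ ε * ρ) → (∃ ρ, 10 ≤ ρ ∧ ‖l - ρ • u‖ ≤ ε * ρ) →
      FstSeparated (Φ i) c y k l := by
  obtain ⟨B, hB⟩ := hΦ.exists_mixedMatrix_le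
  obtain ⟨Λ, hΛ0, hΛ⟩ := hΦ.exists_mixedMatrix_sub_le
  obtain ⟨c, hc, hlow⟩ := exists_mul_norm_le_norm_toEuclideanCLM n B hC₀
  -- The bound `1 / 4` keeps the cone and its rescaling to height 3 outside the ball of radius 2;
  -- the other one makes the variation of the derivative over the cone at most `c / 2`.
  set ε := min (1 / 4) (c / (6 * (Λ + 1))) with hε
  have hε0 : 0 < ε := by positivity
  have hε4 : ε ≤ 1 / 4 := min_le_left _ _
  have hεΛ : Λ * (3 * ε) ≤ c / 2 := by
    have h1 : ε ≤ c / (6 * (Λ + 1)) := min_le_right _ _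
    rw [le_div_iff₀ (by positivity)] at h1
    nlinarith
  refine ⟨c / 2, ε, by positivity, hε0, fun i y u hu k l hk hl =>
    fstSeparated_of_norm_le (by positivity) ?_⟩
  -- By homogeneity of degree 0 every point of the cone is compared, after scaling by `3 / ρ`, with
  -- the single point `3 u`, at distance at most `3 ε`.
  set T := Matrix.toEuclideanCLM (𝕜 := ℝ) (mixedMatrix (Φ i) (y, (3 : ℝ) • u))
    with hT
  have hbound : ∀ η ∈ {η : EuclideanSpace ℝ (Fin n) | ∃ ρ, 10 ≤ ρ ∧ ‖η - ρ • u‖ ≤ ε * ρ},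
      ‖Matrix.toEuclideanCLM (𝕜 := ℝ) (mixedMatrix (Φ i) (y, η)) - T‖ ≤ c / 2 := by
    rintro η ⟨ρ, hρ, h⟩
    have hρ0 : 0 < ρ := by linarith
    have hnρ : ‖ρ • u‖ = ρ := by rw [norm_smul, hu, mul_one, Real.norm_of_nonneg hρ0.le]
    have h1 : (1 - ε) * ρ ≤ ‖η‖ := by
      have := norm_sub_norm_le (ρ • u) η
      rw [norm_sub_rev, hnρ] at this
      linarith
    have h2 : 2 < ‖η‖ := by nlinarith
    have h3 : ‖(3 / ρ) • η - (3 : ℝ) • u‖ ≤ 3 * ε := by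
      have : (3 / ρ) • η - (3 : ℝ) • u = (3 / ρ) • (η - ρ • u) := by
        rw [smul_sub, smul_smul, div_mul_cancel₀ _ hρ0.ne']
      rw [this, norm_smul, Real.norm_of_nonneg (by positivity)]
      calc 3 / ρ * ‖η - ρ • u‖ ≤ 3 / ρ * (ε * ρ) := by gcongr
        _ = 3 * ε := by field_simp
    have h4 : 2 < ‖(3 / ρ) • η‖ := by
      rw [norm_smul, Real.norm_of_nonneg (by positivity), div_mul_eq_mul_div, lt_div_iff₀ hρ0]
      nlinarith
    rw [hhom i y η (3 / ρ) (by positivity) h2 h4]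
    refine (hΛ i y _ _).trans (le_trans ?_ hεΛ)
    gcongr
  have hmv := (convex_cone_ball u ε 10).norm_image_sub_le_of_norm_hasFDerivWithin_le'
    (f := fun η => fstGradient (Φ i) (y, η))
    (fun η _ => (hasFDerivAt_fstGradient ((hΦ.1 i).of_le (by norm_cast; omega)) y
      η).hasFDerivWithinAt) hbound hl hk
  have hTl : c * ‖k - l‖ ≤ ‖T (k - l)‖ := by
    refine hlow _ (hB i _) ?_ _
    have h3u : 2 < ‖(3 : ℝ) • u‖ := by rw [norm_smul, hu]; norm_num
    exact hdet i y _ h3u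
  have := norm_sub_norm_le (T (k - l))
    (T (k - l) - (fstGradient (Φ i) (y, k) - fstGradient (Φ i) (y, l)))
  rw [sub_sub_cancel, norm_sub_rev (T (k - l))] at this
  linarith

/-- The `L²` bound for oscillatory integrals with phase `y · η + ψ(y, η)` and amplitude supported
away from the origin in `η`. -/
theorem exists_lintegral_globalPhase_le
    {ψ : ι → EuclideanSpace ℝ (Fin n) → EuclideanSpace ℝ (Fin n) → ℝ}
    (hψ : ∀ i, ContDiffOn ℝ (4 * n + 4 : ℕ)
      (fun z : EuclideanSpace ℝ (Fin n) × EuclideanSpace ℝ (Fin n) => ψ i z.1 z.2) {z | z.2 ≠ 0})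
    (hom : ∀ i x ξ, ξ ≠ 0 → ∀ r : ℝ, 0 < r → ψ i x (r • ξ) = r * ψ i x ξ)
    {C₀ : ℝ} (hC₀ : 0 < C₀)
    (hdet : ∀ i x ξ, ξ ≠ 0 → C₀ ≤ |(1 + mixedHessian (ψ i) x ξ).det|)
    (hbd : ∀ p q : ℕ, 1 ≤ p → p ≤ 2 * n + 2 → 1 ≤ q → q ≤ 2 * n + 2 →
      ∀ (I : Fin p → Fin n) (J : Fin q → Fin n), ∃ B : ℝ, ∀ i x ξ, 1 ≤ ‖ξ‖ →
        ‖mixedPartial I J (ψ i) x ξ‖ ≤ B)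
    {b : ι → EuclideanSpace ℝ (Fin n) × EuclideanSpace ℝ (Fin n) → ℂ}
    (hb : BddDeriv pairDir Set.univ (2 * n + 1) b)
    (hsupp : ∀ i y η, b i (y, η) ≠ 0 → (2 * n + 10 : ℝ) ≤ ‖η‖) :
    ∃ C : ℝ≥0, ∀ i (v : EuclideanSpace ℝ (Fin n) → ℂ), Continuous v → Integrable v →
      (∀ y, Integrable fun η =>
        Complex.exp (Complex.I * globalPhase (ψ i) (y, η)) * b i (y, η) * v η) ∧
      ∫⁻ y, ‖∫ η, Complex.exp (Complex.I * globalPhase (ψ i) (y, η)) * b i (y, η) * v η‖ₑ ^ 2 ≤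
        C * ∫⁻ η, ‖v η‖ₑ ^ 2 := by
  classical
  have hΦ := mixedBdd_globalPhase hψ hom hbd
  have hψ2 : ∀ i, ContDiffOn ℝ (2 : ℕ) (fun z : EuclideanSpace ℝ (Fin n) ×
      EuclideanSpace ℝ (Fin n) => ψ i z.1 z.2) {z | z.2 ≠ 0} := fun i =>
    (hψ i).of_le (by norm_cast; omega)
  have hM : ∀ i y (η : EuclideanSpace ℝ (Fin n)), 2 < ‖η‖ →
      mixedMatrix (globalPhase (ψ i)) (y, η) = 1 + mixedHessian (ψ i) y η := fun i y η hη =>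
    mixedMatrix_globalPhase (z := (y, η)) (hψ2 i) (hom i) hη
  have hne : ∀ η : EuclideanSpace ℝ (Fin n), 2 < ‖η‖ → η ≠ 0 := fun η hη =>
    norm_ne_zero_iff.1 (by linarith)
  have hd : ∀ i y (η : EuclideanSpace ℝ (Fin n)), 2 < ‖η‖ →
      C₀ ≤ |(mixedMatrix (globalPhase (ψ i)) (y, η)).det| := fun i y η hη => by
    rw [hM i y η hη]; exact hdet i y η (hne η hη)
  have hh : ∀ i y (η : EuclideanSpace ℝ (Fin n)), ∀ r : ℝ, 0 < r → 2 < ‖η‖ → 2 < ‖r • η‖ →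
      mixedMatrix (globalPhase (ψ i)) (y, η) = mixedMatrix (globalPhase (ψ i)) (y, r • η) := by
    intro i y η r hr h1 h2
    rw [hM i y η h1, hM i y _ h2]
    congr 1
    ext a b
    have := mixedPartial_homogeneous (p := 1) (q := 1) (hψ2 i) (hom i) ![a] ![b] y
      (hne η h1) hr
    rw [pow_one] at this
    exact (mul_left_cancel₀ hr.ne' this).symm
  obtain ⟨c₁, hc₁, hs₁⟩ := hΦ.exists_fstSeparated_swap hC₀ hd
  obtain ⟨c₂, ε, hc₂, hε, hs₂⟩ := hΦ.exists_fstSeparated_cone hC₀ hd hh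
  -- Finitely many cones cover all directions, and the class of a lattice point is a cone containing
  -- it. The value `none` is left for points near the origin, which are inactive.
  obtain ⟨s, hs, hsf, hcov⟩ :=
    (isCompact_sphere (0 : EuclideanSpace ℝ (Fin n)) 1).finite_cover_balls hε
  have : Fintype s := hsf.fintype
  have hcl : ∀ k : Fin n → ℤ, ∃ g : Option s, (n + 10 : ℝ) ≤ ‖latticePt k‖ → ∃ u : s, g = some u ∧
      ∃ ρ, 10 ≤ ρ ∧ ‖latticePt k - ρ • (u : EuclideanSpace ℝ (Fin n))‖ ≤ ε * ρ := by
    intro k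
    by_cases hk : (n + 10 : ℝ) ≤ ‖latticePt k‖
    · have hk0 : 0 < ‖latticePt k‖ := lt_of_lt_of_le (by positivity) hk
      have hmem : (‖latticePt k‖⁻¹ • latticePt k) ∈
          Metric.sphere (0 : EuclideanSpace ℝ (Fin n)) 1 := by
        rw [mem_sphere_zero_iff_norm, norm_smul, norm_inv, norm_norm, inv_mul_cancel₀ hk0.ne']
      obtain ⟨u, hu, hku⟩ := Set.mem_iUnion₂.1 (hcov hmem)
      refine ⟨some ⟨u, hu⟩, fun _ => ⟨⟨u, hu⟩, rfl, ‖latticePt k‖, ?_, ?_⟩⟩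
      · have : (0 : ℝ) ≤ n := by positivity
        linarith
      · rw [Metric.mem_ball, dist_eq_norm] at hku
        have : latticePt k - ‖latticePt k‖ • u
            = ‖latticePt k‖ • (‖latticePt k‖⁻¹ • latticePt k - u) := by
          rw [smul_sub, smul_inv_smul₀ hk0.ne']
        rw [this, norm_smul, norm_norm, mul_comm]
        gcongr
    · exact ⟨none, fun h => absurd h hk⟩
  choose cl hcl using hcl
  have hmono : ∀ (Φ : EuclideanSpace ℝ (Fin n) × EuclideanSpace ℝ (Fin n) → ℝ) {c c' : ℝ}
      (y k l : EuclideanSpace ℝ (Fin n)), 0 ≤ c → c ≤ c' → FstSeparated Φ c' y k l →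
      FstSeparated Φ c y k l := fun Φ c c' y k l h0 h h' =>
    le_trans (by gcongr) h'
  -- A cube meeting `‖η‖ ≥ 2n + 10` has its corner at norm at least `n + 10`, and then all points
  -- within `n + 3` of this corner have norm at least `7 > 2`, outside the modified region.
  refine exists_lintegral_oscillatory_le hΦ hb (lt_min hc₁ hc₂) cl
    (fun k => (n + 10 : ℝ) ≤ ‖latticePt k‖) (fun i k hk y η hη => ?_)
    (fun i y k l hk hl hkl => ?_) (fun i k hk η hη y y' => ?_)
  · by_contra h
    have h1 := hsupp i y η h
    have h2 := norm_sub_latticePt_le hη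
    have h3 := norm_sub_norm_le η (latticePt k)
    linarith [not_le.1 hk]
  · obtain ⟨u, hu, hku⟩ := hcl k hk
    obtain ⟨u', hu', hlu⟩ := hcl l hl
    obtain rfl : u = u' := by
      rw [hu, hu'] at hkl; exact Option.some_injective _ hkl
    exact hmono _ _ _ _ (lt_min hc₁ hc₂).le (min_le_right _ _) (hs₂ i y u
      (mem_sphere_zero_iff_norm.1 (hs u.2)) _ _ hku hlu)
  · refine hmono _ _ _ _ (lt_min hc₁ hc₂).le (min_le_left _ _) (hs₁ i η ?_ y y')
    have h3 := norm_sub_norm_le (latticePt k) η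
    rw [norm_sub_rev] at h3
    linarith

end

/-! ### Plancherel and dilation. -/

section
variable {n : ℕ}

theorem lintegral_comp_smul (f : EuclideanSpace ℝ (Fin n) → ENNReal) {s : ℝ} (hs : 0 < s) :
    ∫⁻ x, f (s • x) = ENNReal.ofReal (s ^ n)⁻¹ * ∫⁻ x, f x := by
  have h1 := (Homeomorph.smulOfNeZero (α := EuclideanSpace ℝ (Fin n)) s
    hs.ne').measurableEmbedding.lintegral_map (μ := volume) f
  have h2 : Measure.map (Homeomorph.smulOfNeZero (α := EuclideanSpace ℝ (Fin n)) s hs.ne')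
      volume = ENNReal.ofReal |(s ^ n)⁻¹| • volume := by
    have := Measure.map_addHaar_smul (volume : Measure (EuclideanSpace ℝ (Fin n))) hs.ne'
    rw [finrank_euclideanSpace_fin] at this
    exact this
  rw [h2, lintegral_smul_measure, abs_of_pos (by positivity)] at h1
  exact h1.symm

theorem eLpNorm_two_sq {α F : Type*} [MeasurableSpace α] [NormedAddCommGroup F] (f : α → F)
    (μ : Measure α) : eLpNorm f 2 μ ^ 2 = ∫⁻ x, ‖f x‖ₑ ^ 2 ∂μ := by
  have := eLpNorm_nnreal_pow_eq_lintegral (f := f) (μ := μ) (p := 2) (by norm_num)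
  simpa using this

section
open scoped FourierTransform

theorem angularFourier_eq (u : 𝓢(EuclideanSpace ℝ (Fin n), ℂ)) (ξ : EuclideanSpace ℝ (Fin n)) :
    angularFourier u ξ = 𝓕 u ((2 * Real.pi)⁻¹ • ξ) := by
  rw [SchwartzMap.fourier_coe, Real.fourier_eq', angularFourier]
  congr 1 with x
  rw [inner_smul_right, smul_eq_mul]
  congr 2
  have : -2 * Real.pi * ((2 * Real.pi)⁻¹ * inner ℝ x ξ) = -(inner ℝ x ξ : ℝ) := by
    field_simp
  rw [this]
  push_cast
  ring

theorem lintegral_enorm_fourier_sq (u : 𝓢(EuclideanSpace ℝ (Fin n), ℂ)) :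
    ∫⁻ ξ, ‖𝓕 u ξ‖ₑ ^ 2 = eLpNorm u 2 volume ^ 2 := by
  rw [← eLpNorm_two_sq (fun ξ => 𝓕 u ξ)]
  have h := SchwartzMap.norm_fourier_toL2_eq u
  rw [SchwartzMap.norm_toLp, SchwartzMap.norm_toLp, ENNReal.toReal_eq_toReal_iff'
    ((𝓕 u).memLp 2 volume).eLpNorm_ne_top (u.memLp 2 volume).eLpNorm_ne_top] at h
  rw [h]

theorem continuous_angularFourier (u : 𝓢(EuclideanSpace ℝ (Fin n), ℂ)) :
    Continuous (angularFourier u) := by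
  rw [funext (angularFourier_eq u)]
  exact (𝓕 u).continuous.comp (continuous_const_smul _)

theorem integrable_angularFourier (u : 𝓢(EuclideanSpace ℝ (Fin n), ℂ)) :
    Integrable (angularFourier u) := by
  rw [funext (angularFourier_eq u)]
  exact (𝓕 u).integrable.comp_smul (by positivity)

theorem lintegral_enorm_angularFourier_sq (u : 𝓢(EuclideanSpace ℝ (Fin n), ℂ)) :
    ∫⁻ ξ, ‖angularFourier u ξ‖ₑ ^ 2 =
      ENNReal.ofReal ((2 * Real.pi) ^ n) * eLpNorm u 2 volume ^ 2 := by
  simp_rw [angularFourier_eq u]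
  rw [lintegral_comp_smul (fun ξ => ‖𝓕 u ξ‖ₑ ^ 2) (by positivity), lintegral_enorm_fourier_sq,
    inv_pow, inv_inv]

end

/-- Transfer of an `L²` bound through the dilation `(x, ξ) ↦ (s⁻¹ x, s ξ)`. -/
theorem fio_bound_of_dilation
    {φ : ℝ → EuclideanSpace ℝ (Fin n) → EuclideanSpace ℝ (Fin n) → ℝ}
    {a : ℝ → EuclideanSpace ℝ (Fin n) → EuclideanSpace ℝ (Fin n) → ℂ} {t s : ℝ} (hs : 0 < s)
    {g : EuclideanSpace ℝ (Fin n) × EuclideanSpace ℝ (Fin n) → ℂ} (hg : Continuous g)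
    (hga : ∀ x ξ, Complex.exp (Complex.I * ((inner ℝ x ξ + t * φ t x ξ : ℝ) : ℂ)) * a t x ξ =
      g (s⁻¹ • x, s • ξ)) {C : ℝ≥0}
    (hC : ∀ v : EuclideanSpace ℝ (Fin n) → ℂ, Continuous v → Integrable v →
      (∀ y, Integrable fun η => g (y, η) * v η) ∧
      ∫⁻ y, ‖∫ η, g (y, η) * v η‖ₑ ^ 2 ≤ C * ∫⁻ η, ‖v η‖ₑ ^ 2)
    (u : 𝓢(EuclideanSpace ℝ (Fin n), ℂ)) :
    (∀ x, Integrable (fioIntegrand φ a t u x) volume) ∧ MemLp (fio φ a t u) 2 volume ∧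
      eLpNorm (fio φ a t u) 2 volume ≤
        (NNReal.sqrt (C * ((2 * Real.pi) ^ n).toNNReal) : ENNReal) * eLpNorm u 2 volume := by
  set v : EuclideanSpace ℝ (Fin n) → ℂ := fun η => angularFourier u (s⁻¹ • η) with hv
  have hvc : Continuous v := (continuous_angularFourier u).comp (continuous_const_smul _)
  have hvi : Integrable v := (integrable_angularFourier u).comp_smul (by positivity)
  obtain ⟨h1, h2⟩ := hC v hvc hvi
  have hI : ∀ x ξ, fioIntegrand φ a t u x ξ = g (s⁻¹ • x, s • ξ) * v (s • ξ) := fun x ξ => by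
    simp only [fioIntegrand, hga, hv, inv_smul_smul₀ hs.ne']
  have hint : ∀ x, Integrable (fioIntegrand φ a t u x) volume := fun x => by
    rw [funext (hI x)]
    exact (h1 (s⁻¹ • x)).comp_smul hs.ne'
  have hmeas : AEStronglyMeasurable (fio φ a t u) volume := by
    have : Continuous (Function.uncurry (fioIntegrand φ a t u)) := by
      have h3 : Function.uncurry (fioIntegrand φ a t u) =
          fun p => g (s⁻¹ • p.1, s • p.2) * v (s • p.2) := funext fun p => hI p.1 p.2
      rw [h3]
      fun_prop
    exact this.stronglyMeasurable.integral_prod_right.aestronglyMeasurable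
  have hfio : ∀ x, fio φ a t u x = ((s ^ n)⁻¹ : ℝ) • ∫ η, g (s⁻¹ • x, η) * v η := fun x => by
    have := Measure.integral_comp_smul_of_nonneg volume (fun η => g (s⁻¹ • x, η) * v η) s
      (hR := hs.le)
    rw [finrank_euclideanSpace_fin] at this
    rw [← this, fio]
    exact integral_congr_ae (Filter.Eventually.of_forall (hI x))
  have hroot : (NNReal.sqrt (C * ((2 * Real.pi) ^ n).toNNReal) : ENNReal) ^ 2 =
      C * ENNReal.ofReal ((2 * Real.pi) ^ n) := by
    rw [← ENNReal.coe_pow, NNReal.sq_sqrt, ENNReal.coe_mul]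
    rfl
  set K := NNReal.sqrt (C * ((2 * Real.pi) ^ n).toNNReal)
  have hsq : eLpNorm (fio φ a t u) 2 volume ^ 2 ≤ (K * eLpNorm u 2 volume) ^ 2 := by
    have hsn : 0 < s ^ n := by positivity
    have hv2 : ∫⁻ η, ‖v η‖ₑ ^ 2 = ENNReal.ofReal (s ^ n) *
        (ENNReal.ofReal ((2 * Real.pi) ^ n) * eLpNorm u 2 volume ^ 2) := by
      rw [← lintegral_enorm_angularFourier_sq,
        lintegral_comp_smul (fun ξ => ‖angularFourier u ξ‖ₑ ^ 2) (by positivity), inv_pow, inv_inv]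
    rw [eLpNorm_two_sq]
    simp_rw [hfio, enorm_smul, mul_pow]
    rw [lintegral_const_mul' _ _ (by simp),
      lintegral_comp_smul (fun y => ‖∫ η, g (y, η) * v η‖ₑ ^ 2) (by positivity), inv_pow, inv_inv,
      Real.enorm_of_nonneg (by positivity)]
    -- The substitution in `η` contributes `s⁻ⁿ`, squared; the one in `y` and the norm of `v`
    -- contribute `sⁿ` each. The bound is therefore invariant under dilation.
    have hcancel : ENNReal.ofReal (s ^ n)⁻¹ ^ 2 * (ENNReal.ofReal (s ^ n) *
        ENNReal.ofReal (s ^ n)) = 1 := by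
      rw [← ENNReal.ofReal_mul hsn.le, ← ENNReal.ofReal_pow (by positivity),
        ← ENNReal.ofReal_mul (by positivity)]
      rw [show ((s ^ n)⁻¹) ^ 2 * (s ^ n * s ^ n) = 1 by field_simp, ENNReal.ofReal_one]
    calc _ ≤ ENNReal.ofReal (s ^ n)⁻¹ ^ 2 * (ENNReal.ofReal (s ^ n) * (C * ∫⁻ η, ‖v η‖ₑ ^ 2)) := by
          gcongr
      _ = (ENNReal.ofReal (s ^ n)⁻¹ ^ 2 * (ENNReal.ofReal (s ^ n) * ENNReal.ofReal (s ^ n))) *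
          (C * ENNReal.ofReal ((2 * Real.pi) ^ n) * eLpNorm u 2 volume ^ 2) := by
          rw [hv2]; ring
      _ = _ := by rw [hcancel, one_mul, hroot]
  have hle : eLpNorm (fio φ a t u) 2 volume ≤ K * eLpNorm u 2 volume :=
    (ENNReal.pow_le_pow_left_iff two_ne_zero).1 hsq
  exact ⟨hint, ⟨hmeas, hle.trans_lt (ENNReal.mul_lt_top ENNReal.coe_lt_top
    (u.memLp 2 volume).eLpNorm_lt_top)⟩, hle⟩

end

/-! ### Reduction of the family to a uniform estimate. -/

theorem mainTheorem3 (n : ℕ) (t₀ : ℝ) (ht₀ : 0 < t₀)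
    (φ : ℝ → EuclideanSpace ℝ (Fin n) → EuclideanSpace ℝ (Fin n) → ℝ)
    (a : ℝ → EuclideanSpace ℝ (Fin n) → EuclideanSpace ℝ (Fin n) → ℂ)
    -- regularity of the phase and of the amplitude for each fixed `t`
    (hφ_reg : ∀ t, t₀ ≤ t →
      ContDiffOn ℝ ((4 * n + 4 : ℕ) : WithTop ℕ∞)
        (fun z : EuclideanSpace ℝ (Fin n) × EuclideanSpace ℝ (Fin n) => φ t z.1 z.2)
        {z | z.2 ≠ 0})
    (ha_reg : ∀ t, t₀ ≤ t →
      ContDiff ℝ ((4 * n + 4 : ℕ) : WithTop ℕ∞)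
        (fun z : EuclideanSpace ℝ (Fin n) × EuclideanSpace ℝ (Fin n) => a t z.1 z.2))
    -- the phase is positively homogeneous of degree one in `ξ`
    (hφ_hom : ∀ t, t₀ ≤ t → ∀ x ξ, ξ ≠ 0 → ∀ r : ℝ, 0 < r → φ t x (r • ξ) = r * φ t x ξ)
    -- `|det (I + t ∂_x ∂_ξ φ)| ≥ C₀ > 0`
    (C₀ : ℝ) (hC₀ : 0 < C₀)
    (hφ_det : ∀ t, t₀ ≤ t → ∀ x ξ, ξ ≠ 0 →
      C₀ ≤ |(1 + t • mixedHessian (φ t) x ξ).det|)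
    -- scaled bounds of the phase, needed only for `|ξ| ≥ 1`
    (hφ_bd : ∀ p q : ℕ, 1 ≤ p → p ≤ 2 * n + 2 → 1 ≤ q → q ≤ 2 * n + 2 →
      ∀ (I : Fin p → Fin n) (J : Fin q → Fin n), ∃ B : ℝ, ∀ t, t₀ ≤ t → ∀ x ξ, 1 ≤ ‖ξ‖ →
        |t ^ p * mixedPartial I J (φ t) x ξ| ≤ B)
    -- the amplitude is supported in `t |ξ| ≥ c`
    (c : ℝ) (hc : 0 < c)
    (ha_supp : ∀ t, t₀ ≤ t → ∀ x ξ, a t x ξ ≠ 0 → c ≤ t * ‖ξ‖)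
    -- scaled bounds of the amplitude
    (ha_bd : ∀ p q : ℕ, p ≤ 2 * n + 2 → q ≤ 2 * n + 2 →
      ∀ (I : Fin p → Fin n) (J : Fin q → Fin n), ∃ B : ℝ, ∀ t, t₀ ≤ t → ∀ x ξ,
        ‖((t ^ p : ℝ) : ℂ) * mixedPartial I J (a t) x ξ‖ ≤ B) :
    ∃ K : ℝ≥0, ∀ t, t₀ ≤ t → ∀ u : 𝓢(EuclideanSpace ℝ (Fin n), ℂ),
      (∀ x, Integrable (fioIntegrand φ a t u x) volume) ∧
      MemLp (fio φ a t u) 2 volume ∧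
      eLpNorm (fio φ a t u) 2 volume ≤ (K : ENNReal) * eLpNorm u 2 volume := by
  have hO : IsOpen {ξ : EuclideanSpace ℝ (Fin n) | ξ ≠ 0} := isOpen_ne
  set R₀ : ℝ := 2 * n + 10 with hR₀
  have hR₀0 : 0 < R₀ := by positivity
  -- With `η = tμ ξ` the support condition `t |ξ| ≥ c` becomes `|η| ≥ R₀`.
  set μ : ℝ := R₀ / c with hμ
  have hμ0 : 0 < μ := by positivity
  let ι := {t : ℝ // t₀ ≤ t}
  have ht : ∀ t : ι, 0 < t.1 := fun t => ht₀.trans_le t.2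
  have hs : ∀ t : ι, 0 < t.1 * μ := fun t => mul_pos (ht t) hμ0
  -- By homogeneity `t φ(t, x, η / (tμ)) = μ⁻¹ φ(t, x, η)`, and each `y`-derivative produces the
  -- factor `t` present in the hypotheses. The scalings by 1 match the form of `mixedPartial_scale`.
  let ψ : ι → EuclideanSpace ℝ (Fin n) → EuclideanSpace ℝ (Fin n) → ℝ :=
    fun t y η => μ⁻¹ • φ t.1 ((t.1 * μ) • y) ((1 : ℝ) • η)
  let b : ι → EuclideanSpace ℝ (Fin n) → EuclideanSpace ℝ (Fin n) → ℂ :=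
    fun t y η => (1 : ℝ) • a t.1 ((t.1 * μ) • y) ((t.1 * μ)⁻¹ • η)
  have hψ_reg : ∀ t, ContDiffOn ℝ (4 * n + 4 : ℕ) (fun z : EuclideanSpace ℝ (Fin n) ×
      EuclideanSpace ℝ (Fin n) => ψ t z.1 z.2) {z | z.2 ≠ 0} := fun t =>
    ((hφ_reg t.1 t.2).comp (t := {z | z.2 ≠ 0}) (s := {z | z.2 ≠ 0})
      (f := fun z : EuclideanSpace ℝ (Fin n) × EuclideanSpace ℝ (Fin n) =>
        ((t.1 * μ) • z.1, (1 : ℝ) • z.2))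
      ((contDiff_fst.const_smul _).prodMk (contDiff_snd.const_smul _)).contDiffOn
      fun z hz => by simpa using hz).const_smul _
  have hb_reg : ∀ t, ContDiff ℝ (4 * n + 4 : ℕ) (fun z : EuclideanSpace ℝ (Fin n) ×
      EuclideanSpace ℝ (Fin n) => b t z.1 z.2) := fun t =>
    ((ha_reg t.1 t.2).comp ((contDiff_fst.const_smul (t.1 * μ)).prodMk
      (contDiff_snd.const_smul (t.1 * μ)⁻¹))).const_smul (1 : ℝ)
  have hψ_hom : ∀ t x ξ, ξ ≠ 0 → ∀ r : ℝ, 0 < r → ψ t x (r • ξ) = r * ψ t x ξ := by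
    intro t x ξ hξ r hr
    simp only [ψ, one_smul, hφ_hom t.1 t.2 _ ξ hξ r hr, smul_eq_mul]
    ring
  have hψ_mp : ∀ (t : ι) {p q : ℕ}, p ≤ 2 * n + 2 → q ≤ 2 * n + 2 → ∀ (I : Fin p → Fin n)
      (J : Fin q → Fin n) x ξ, ξ ≠ 0 → mixedPartial I J (ψ t) x ξ =
        (μ⁻¹ * (t.1 * μ) ^ p) * mixedPartial I J (φ t.1) ((t.1 * μ) • x) ξ := by
    intro t p q hp hq I J x ξ hξ
    have := mixedPartial_scale hO (r := μ⁻¹) (s := t.1 * μ) (s' := 1)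
      ((hφ_reg t.1 t.2).of_le (by norm_cast; omega)) I J x (ξ := ξ) (by simpa using hξ)
    exact this.trans (by simp)
  have hb_mp : ∀ (t : ι) {p q : ℕ}, p ≤ 2 * n + 2 → q ≤ 2 * n + 2 → ∀ (I : Fin p → Fin n)
      (J : Fin q → Fin n) x ξ, mixedPartial I J (b t) x ξ =
        ((t.1 * μ) ^ p * (t.1 * μ)⁻¹ ^ q) •
          mixedPartial I J (a t.1) ((t.1 * μ) • x) ((t.1 * μ)⁻¹ • ξ) := by
    intro t p q hp hq I J x ξ
    have := mixedPartial_scale (isOpen_univ (X := EuclideanSpace ℝ (Fin n))) (r := 1)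
      (s := t.1 * μ) (s' := (t.1 * μ)⁻¹)
      (((ha_reg t.1 t.2).of_le (by norm_cast; omega)).contDiffOn) I J x (ξ := ξ) trivial
    rw [one_mul] at this
    exact this
  have hψ_det : ∀ t x ξ, ξ ≠ 0 → C₀ ≤ |(1 + mixedHessian (ψ t) x ξ).det| := by
    intro t x ξ hξ
    have : mixedHessian (ψ t) x ξ = t.1 • mixedHessian (φ t.1) ((t.1 * μ) • x) ξ := by
      ext i j
      simp only [mixedHessian, Matrix.of_apply, Matrix.smul_apply, smul_eq_mul]
      rw [hψ_mp t (p := 1) (q := 1) (by omega) (by omega) _ _ x ξ hξ]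
      field_simp
    rw [this]
    exact hφ_det t.1 t.2 _ ξ hξ
  have hψ_bd : ∀ p q : ℕ, 1 ≤ p → p ≤ 2 * n + 2 → 1 ≤ q → q ≤ 2 * n + 2 →
      ∀ (I : Fin p → Fin n) (J : Fin q → Fin n), ∃ B : ℝ, ∀ t x ξ, 1 ≤ ‖ξ‖ →
        ‖mixedPartial I J (ψ t) x ξ‖ ≤ B := by
    intro p q hp hp' hq hq' I J
    obtain ⟨B, hB⟩ := hφ_bd p q hp hp' hq hq' I J
    refine ⟨μ⁻¹ * μ ^ p * B, fun t x ξ hξ => ?_⟩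
    rw [hψ_mp t hp' hq' I J x ξ (norm_ne_zero_iff.1 (by linarith)),
      show μ⁻¹ * (t.1 * μ) ^ p * mixedPartial I J (φ t.1) ((t.1 * μ) • x) ξ = μ⁻¹ * μ ^ p *
        (t.1 ^ p * mixedPartial I J (φ t.1) ((t.1 * μ) • x) ξ) by rw [mul_pow]; ring,
      norm_mul, Real.norm_of_nonneg (by positivity)]
    gcongr
    exact hB t.1 t.2 _ ξ hξ
  have hb_bd : ∀ p q : ℕ, 0 ≤ p → p ≤ 2 * n + 2 → 0 ≤ q → q ≤ 2 * n + 2 →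
      ∀ (I : Fin p → Fin n) (J : Fin q → Fin n), ∃ B : ℝ, ∀ t x,
        ∀ ξ ∈ (Set.univ : Set (EuclideanSpace ℝ (Fin n))), ‖mixedPartial I J (b t) x ξ‖ ≤ B := by
    intro p q _ hp' _ hq' I J
    obtain ⟨B, hB⟩ := ha_bd p q hp' hq' I J
    refine ⟨μ ^ p * (t₀ * μ)⁻¹ ^ q * B, fun t x ξ _ => ?_⟩
    have h1 := hB t.1 t.2 ((t.1 * μ) • x) ((t.1 * μ)⁻¹ • ξ)
    have htp : 0 < t.1 ^ p := pow_pos (ht t) p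
    rw [norm_mul, Complex.norm_real, Real.norm_of_nonneg htp.le] at h1
    have hst := hs t
    rw [hb_mp t hp' hq' I J x ξ, norm_smul, Real.norm_of_nonneg (by positivity), mul_pow]
    -- Each `η`-derivative of the amplitude brings `(tμ)⁻¹`, which is bounded because `t` stays away
    -- from zero.
    have h2 : (t.1 * μ)⁻¹ ^ q ≤ (t₀ * μ)⁻¹ ^ q := by
      have := t.2
      gcongr
    calc _ = μ ^ p * (t.1 * μ)⁻¹ ^ q * (t.1 ^ p *
          ‖mixedPartial I J (a t.1) ((t.1 * μ) • x) ((t.1 * μ)⁻¹ • ξ)‖) := by ring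
      _ ≤ _ := by gcongr
  have hb : BddDeriv pairDir Set.univ (2 * n + 1) (fun t z => b t z.1 z.2) := by
    have := BddDeriv.mixedPartial (M := 2 * n + 2) (N := 2 * n + 1) (f := b) isOpen_univ
      isOpen_univ le_rfl (fun t => ((hb_reg t).of_le (by norm_cast; omega)).contDiffOn) hb_bd
      le_rfl le_rfl (by omega) (by omega) ![] ![]
    simpa [mixedPartial] using this
  have hb_supp : ∀ t y η, b t y η ≠ 0 → R₀ ≤ ‖η‖ := by
    intro t y η h
    have h1 := ha_supp t.1 t.2 ((t.1 * μ) • y) ((t.1 * μ)⁻¹ • η) (by simpa [b] using h)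
    have hst := hs t
    have htt := ht t
    rw [norm_smul, norm_inv, Real.norm_of_nonneg hst.le] at h1
    have h2 : t.1 * ((t.1 * μ)⁻¹ * ‖η‖) = ‖η‖ * c / R₀ := by
      rw [hμ]; field_simp
    rw [h2, le_div_iff₀ hR₀0, mul_comm] at h1
    exact le_of_mul_le_mul_right h1 hc
  obtain ⟨C, hC⟩ := exists_lintegral_globalPhase_le hψ_reg hψ_hom hC₀ hψ_det hψ_bd hb hb_supp
  refine ⟨NNReal.sqrt (C * ((2 * Real.pi) ^ n).toNNReal), fun t htt u => ?_⟩
  let t' : ι := ⟨t, htt⟩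
  have ht0 : 0 < t := ht t'
  have hst : 0 < t * μ := hs t'
  refine fio_bound_of_dilation hst (g := fun z =>
    Complex.exp (Complex.I * globalPhase (ψ t') z) * b t' z.1 z.2) ?_ (fun x ξ => ?_) (hC t') u
  · exact ((Complex.continuous_exp.comp (continuous_const.mul (Complex.continuous_ofReal.comp
      (contDiff_globalPhase (hψ_reg t')).continuous)))).mul (hb_reg t').continuous
  · have hba : b t' ((t * μ)⁻¹ • x) ((t * μ) • ξ) = a t x ξ := by
      simp only [b, t', one_smul, smul_inv_smul₀ hst.ne', inv_smul_smul₀ hst.ne']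
    -- Where the amplitude is nonzero, `|η| ≥ R₀ ≥ 2`, so the modified phase is the original one;
    -- elsewhere both sides vanish.
    by_cases h : a t x ξ = 0
    · simp only [hba, h, mul_zero]
    · have h1 : R₀ ≤ ‖(t * μ) • ξ‖ := hb_supp t' _ _ (by rw [hba]; exact h)
      have h2 : (2 : ℝ) ≤ ‖(t * μ) • ξ‖ := by
        have : (0 : ℝ) ≤ n := by positivity
        linarith
      have hξ : ξ ≠ 0 := by
        rintro rfl
        rw [smul_zero, norm_zero] at h2
        linarith
      have h3 : globalPhase (ψ t') ((t * μ)⁻¹ • x, (t * μ) • ξ) = inner ℝ x ξ + t * φ t x ξ := by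
        simp only [globalPhase, freqBump_eq_zero h2, ψ, t', one_smul, smul_inv_smul₀ hst.ne',
          hφ_hom t htt x ξ hξ _ hst, inner_smul_left, inner_smul_right, smul_eq_mul]
        simp only [conj_trivial]
        field_simp
        ring
      simp only [h3, hba]
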